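/- Let $\tau>0$, $\omega=\frac{i}{2\sqrt\tau}$, $\omega'=\frac{i\sqrt\tau}{2}$ (so that $\omega\omega'=-\frac14$, $\omega'/\omega=\tau$) and $q=e^{i\pi\tau}$. For real $x$ put $$\gamma(x)=\exp\Bigl\{-\frac14\int\frac{e^{itx}}{\sin\omega t\,\sin\omega' t}\,\frac{dt}{t}\Bigr\},$$ where the contour runs along the real line and bypasses the singularity $t=0$ from above; then $|\gamma(x)|=1$. On $L^2(\mathbb R)$ let $Kf(x)=\gamma(x)f(x)$, $Ff(x)=\int_{\mathbb R}e^{-2\pi ixt}f(t)\,dt$, and let $S=KF$, a unitary operator. Let $\mathcal D$ be the space of entire functions that decay faster than every exponential $e^{-N|\mathrm{Re}\,z|}$, uniformly in every horizontal strip; restriction to $\mathbb R$ embeds $\mathcal D$ into $L^2(\mathbb R)$. On $\mathcal D$ define the invertible operators $Uf(z)=e^{-i\pi z/\omega}f(z)$, $Vf(z)=f(z+2\omega')$, and $$X_1=U,\quad X_2=V,\quad X_3=U^{-1}(1+qV),\quad X_4=U^{-1}(q^{-1}+U+V)V^{-1},\quad X_5=(1+qU)V^{-1},$$ with the index read modulo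 $5$, $X_{i+5}=X_i$. Then: 1. $X_iX_{i+2}=1+qX_{i+1}$ on $\mathcal D$ for all $i\in\mathbb Z/5$. 2. There is a sequence $(T_i)_{i\in\mathbb Z}$ of self-adjoint operators in $L^2(\mathbb R)$ such that $T_1$ and $T_2$ are the closures of $U$ and $V$, each $T_i$ extends $X_i$ (defined on $\mathcal D$), and $$T_{i+1}=S^{-1}T_iS\qquad(i\in\mathbb Z)$$ as unbounded operators, domains included. In particular $S^{-1}T_iSf=X_{i+1}f$ for $f\in\mathcal D$. If $\tau\le1$, then every $T_i$ is the closure of $X_i$. 3. The sequence is $5$-periodic: $T_{i+5}=T_i$ for all $i\in\mathbb Z$. -/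

import Mathlib

open MeasureTheory

namespace QuantumYSystem

noncomputable section

/-- The Hilbert space `L²(ℝ)`. -/
abbrev H : Type := Lp ℂ 2 (volume : Measure ℝ)

/-! ### Parameters -/

/-- For `τ > 0`, the number `ω` of the upper half-plane with `ω ω' = -1/4` and `ω' / ω = τ`. -/
def omega (τ : ℝ) : ℂ := Complex.I / (2 * (Real.sqrt τ : ℂ))

/-- For `τ > 0`, the number `ω'` of the upper half-plane with `ω ω' = -1/4` and `ω' / ω = τ`. -/
def omega' (τ : ℝ) : ℂ := Complex.I * (Real.sqrt τ : ℂ) / 2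

/-- `q = exp (i π τ)`. -/
def q (τ : ℝ) : ℂ := Complex.exp (Complex.I * Real.pi * τ)

theorem omega_mul_omega' {τ : ℝ} (hτ : 0 < τ) : omega τ * omega' τ = -1 / 4 := by
  have h : (Real.sqrt τ : ℂ) ≠ 0 := by exact_mod_cast (Real.sqrt_pos.2 hτ).ne'
  unfold omega omega'
  field_simp
  rw [Complex.I_sq]
  norm_num

theorem omega'_div_omega {τ : ℝ} (hτ : 0 < τ) : omega' τ / omega τ = τ := by
  have h : (Real.sqrt τ : ℂ) ≠ 0 := by exact_mod_cast (Real.sqrt_pos.2 hτ).ne'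
  have h2 : (Real.sqrt τ : ℂ) ^ 2 = τ := by exact_mod_cast Real.sq_sqrt hτ.le
  unfold omega omega'
  field_simp
  exact h2

/-! ### The modular quantum dilogarithm on the real line -/

/-- The contour `ℝ + iε`, parametrized by the real line. It passes above the singularity `t = 0`
and, as `ε = min (√τ) (1/√τ)` is smaller than `2π √τ` and `2π / √τ`, below all the other
singularities in the upper half-plane of the integrand in `gamma`. -/
def contour (τ s : ℝ) : ℂ :=
  (s : ℂ) + Complex.I * ((min (Real.sqrt τ) (1 / Real.sqrt τ) : ℝ) : ℂ)

/-- The integrand `e^{itx} / (sin ωt sin ω't t)` at the point `t` of the contour. -/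
def gammaIntegrand (τ x s : ℝ) : ℂ :=
  Complex.exp (Complex.I * contour τ s * x) /
    (Complex.sin (omega τ * contour τ s) * Complex.sin (omega' τ * contour τ s) * contour τ s)

/-- `γ(x) = Θ(e^{-iπx/ω}) = exp (-(1/4) ∫ e^{itx} / (sin ωt sin ω't) dt/t)` for real `x`. -/
def gamma (τ x : ℝ) : ℂ := Complex.exp (-(1 / 4) * ∫ s : ℝ, gammaIntegrand τ x s)

theorem contour_neg (τ s : ℝ) : contour τ (-s) = -(starRingEnd ℂ) (contour τ s) := by
  unfold contour
  rw [map_add, map_mul, Complex.conj_ofReal, Complex.conj_ofReal, Complex.conj_I]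
  push_cast
  ring

theorem conj_omega (τ : ℝ) : (starRingEnd ℂ) (omega τ) = -omega τ := by
  simp [omega, neg_div, Complex.conj_ofNat]

theorem conj_omega' (τ : ℝ) : (starRingEnd ℂ) (omega' τ) = -omega' τ := by
  simp [omega', neg_div, Complex.conj_ofNat]

theorem gammaIntegrand_neg (τ x s : ℝ) :
    gammaIntegrand τ x (-s) = -(starRingEnd ℂ) (gammaIntegrand τ x s) := by
  unfold gammaIntegrand
  rw [contour_neg, map_div₀, map_mul, map_mul, ← Complex.exp_conj, ← Complex.sin_conj,
    ← Complex.sin_conj, map_mul, map_mul, map_mul, map_mul, conj_omega, conj_omega',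
    Complex.conj_I, Complex.conj_ofReal, ← div_neg]
  congr 1
  · congr 1
    ring
  · rw [mul_neg, mul_neg, neg_mul, neg_mul, mul_neg]

theorem norm_gamma (τ x : ℝ) : ‖gamma τ x‖ = 1 := by
  have h : (∫ s : ℝ, gammaIntegrand τ x s)
      = -(starRingEnd ℂ) (∫ s : ℝ, gammaIntegrand τ x s) := by
    conv_lhs => rw [← integral_neg_eq_self]
    simp_rw [gammaIntegrand_neg]
    rw [integral_neg, integral_conj]
  have h2 := congrArg Complex.re h
  rw [Complex.neg_re, Complex.conj_re] at h2
  have h3 : (∫ s : ℝ, gammaIntegrand τ x s).re = 0 := by linarith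
  have h4 : ((-(1 / 4) : ℂ)) = ((-(1 / 4) : ℝ) : ℂ) := by push_cast; ring
  unfold gamma
  rw [Complex.norm_exp, h4, Complex.re_ofReal_mul, h3, mul_zero, Real.exp_zero]

theorem measurable_gamma (τ : ℝ) : Measurable (gamma τ) := by
  have h : Measurable (Function.uncurry (gammaIntegrand τ)) := by
    unfold Function.uncurry gammaIntegrand contour
    fun_prop
  have h2 : StronglyMeasurable fun x => ∫ s : ℝ, gammaIntegrand τ x s :=
    h.stronglyMeasurable.integral_prod_right
  exact Complex.measurable_exp.comp (h2.measurable.const_mul _)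

/-! ### The evolution operator -/

theorem memLp_mul {m : ℝ → ℂ} (hm : Measurable m) (h1 : ∀ x, ‖m x‖ = 1) (f : H) :
    MemLp (fun x => m x * f x) 2 (volume : Measure ℝ) := by
  refine (Lp.memLp f).of_le (hm.aestronglyMeasurable.mul (Lp.aestronglyMeasurable f)) ?_
  filter_upwards with x
  rw [norm_mul, h1, one_mul]

theorem toLp_mul_mul {m n : ℝ → ℂ} (hm : Measurable m) (hm1 : ∀ x, ‖m x‖ = 1)
    (hn : Measurable n) (hn1 : ∀ x, ‖n x‖ = 1) (h : ∀ x, m x * n x = 1) (f : H) :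
    (memLp_mul hm hm1 ((memLp_mul hn hn1 f).toLp _)).toLp _ = f := by
  apply Lp.ext
  filter_upwards [(memLp_mul hm hm1 ((memLp_mul hn hn1 f).toLp _)).coeFn_toLp,
    (memLp_mul hn hn1 f).coeFn_toLp] with x h1 h2
  rw [h1, h2, ← mul_assoc, h, one_mul]

/-- Multiplication by a measurable function of modulus one, as a unitary operator of `L²(ℝ)`. -/
def mulUnitary (m : ℝ → ℂ) (hm : Measurable m) (h1 : ∀ x, ‖m x‖ = 1) : H ≃ₗᵢ[ℂ] H where
  toFun f := (memLp_mul hm h1 f).toLp _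
  invFun f := (memLp_mul (m := fun x => (m x)⁻¹) hm.inv (by simp [h1]) f).toLp _
  map_add' f g := by
    apply Lp.ext
    filter_upwards [(memLp_mul hm h1 (f + g)).coeFn_toLp, (memLp_mul hm h1 f).coeFn_toLp,
      (memLp_mul hm h1 g).coeFn_toLp, Lp.coeFn_add f g,
      Lp.coeFn_add ((memLp_mul hm h1 f).toLp _) ((memLp_mul hm h1 g).toLp _)]
      with x e1 e2 e3 e4 e5
    rw [e1, e5, Pi.add_apply, e2, e3, e4, Pi.add_apply, mul_add]
  map_smul' c f := by
    apply Lp.ext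
    filter_upwards [(memLp_mul hm h1 (c • f)).coeFn_toLp, (memLp_mul hm h1 f).coeFn_toLp,
      Lp.coeFn_smul c f, Lp.coeFn_smul c ((memLp_mul hm h1 f).toLp _)] with x e1 e2 e3 e4
    rw [e1, RingHom.id_apply, e4, Pi.smul_apply, e2, e3, Pi.smul_apply, smul_eq_mul, smul_eq_mul]
    ring
  left_inv f := toLp_mul_mul hm.inv (by simp [h1]) hm h1
    (fun x => inv_mul_cancel₀ (by rw [← norm_ne_zero_iff, h1]; exact one_ne_zero)) f
  right_inv f := toLp_mul_mul hm h1 hm.inv (by simp [h1])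
    (fun x => mul_inv_cancel₀ (by rw [← norm_ne_zero_iff, h1]; exact one_ne_zero)) f
  norm_map' f := by
    change ‖(memLp_mul hm h1 f).toLp _‖ = ‖f‖
    rw [Lp.norm_toLp, Lp.norm_def]
    congr 1
    refine eLpNorm_congr_norm_ae ?_
    filter_upwards with x
    rw [norm_mul, h1, one_mul]

/-- `K`, the multiplication by `Θ(e^{-iπz/ω}) = γ(z)`. -/
def K (τ : ℝ) : H ≃ₗᵢ[ℂ] H := mulUnitary (gamma τ) (measurable_gamma τ) (norm_gamma τ)

/-- The Fourier transform `F f(z) = ∫ e^{-2πizt} f(t) dt` of `L²(ℝ)`. -/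
def F : H ≃ₗᵢ[ℂ] H := Lp.fourierTransformₗᵢ ℝ ℂ

/-- The unitary operator `S = K F`. -/
def S (τ : ℝ) : H ≃ₗᵢ[ℂ] H := F.trans (K τ)

/-- `S⁻¹ A S` for a unitary `S` and an unbounded operator `A`, on the domain
`{f | S f ∈ dom A}`. -/
def conjOp (S : H ≃ₗᵢ[ℂ] H) (A : H →ₗ.[ℂ] H) : H →ₗ.[ℂ] H where
  domain := A.domain.comap S.toLinearEquiv.toLinearMap
  toFun := S.symm.toLinearEquiv.toLinearMap ∘ₗ A.toFun ∘ₗ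
    S.toLinearEquiv.toLinearMap.restrict (fun _ hx => hx)

/-! ### The domain of the operators `U` and `V` -/

/-- The space of entire functions that decay faster than every exponential, uniformly in every
horizontal strip. -/
def Dom : Submodule ℂ (ℂ → ℂ) where
  carrier := {f | Differentiable ℂ f ∧
    ∀ R N : ℝ, ∃ C : ℝ, ∀ z : ℂ, |z.im| ≤ R → ‖f z‖ * Real.exp (N * |z.re|) ≤ C}
  zero_mem' := ⟨differentiable_const 0, fun _ _ => ⟨0, by simp⟩⟩
  add_mem' := by
    rintro f g ⟨hf, hf'⟩ ⟨hg, hg'⟩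
    refine ⟨hf.add hg, fun R N => ?_⟩
    obtain ⟨C, hC⟩ := hf' R N
    obtain ⟨C', hC'⟩ := hg' R N
    refine ⟨C + C', fun z hz => ?_⟩
    calc ‖f z + g z‖ * Real.exp (N * |z.re|)
        ≤ (‖f z‖ + ‖g z‖) * Real.exp (N * |z.re|) := by gcongr; exact norm_add_le _ _
      _ ≤ C + C' := by rw [add_mul]; exact add_le_add (hC z hz) (hC' z hz)
  smul_mem' := by
    rintro c f ⟨hf, hf'⟩
    refine ⟨hf.const_smul c, fun R N => ?_⟩
    obtain ⟨C, hC⟩ := hf' R N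
    refine ⟨‖c‖ * C, fun z hz => ?_⟩
    rw [Pi.smul_apply, norm_smul, mul_assoc]
    exact mul_le_mul_of_nonneg_left (hC z hz) (norm_nonneg c)

/-- The operator `f(z) ↦ e^{cz} f(z)`. -/
def mulExp (c : ℂ) : Module.End ℂ Dom where
  toFun f := ⟨fun z => Complex.exp (c * z) * f.1 z, by
    obtain ⟨f, hf, hf'⟩ := f
    refine ⟨(by fun_prop : Differentiable ℂ fun z => Complex.exp (c * z)).mul hf, fun R N => ?_⟩
    obtain ⟨C, hC⟩ := hf' R (N + |c.re|)
    refine ⟨Real.exp (|c.im| * R) * C, fun z hz => ?_⟩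
    have h1 : c.re * z.re ≤ |c.re| * |z.re| := by rw [← abs_mul]; exact le_abs_self _
    have h2 : -(c.im * z.im) ≤ |c.im| * R :=
      calc -(c.im * z.im) ≤ |c.im| * |z.im| := by rw [← abs_mul]; exact neg_le_abs _
        _ ≤ |c.im| * R := by gcongr
    calc ‖Complex.exp (c * z) * f z‖ * Real.exp (N * |z.re|)
        = Real.exp (c.re * z.re - c.im * z.im + N * |z.re|) * ‖f z‖ := by
          rw [norm_mul, Complex.norm_exp, Complex.mul_re, Real.exp_add]
          ring
      _ ≤ Real.exp (|c.im| * R + (N + |c.re|) * |z.re|) * ‖f z‖ := by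
          refine mul_le_mul_of_nonneg_right (Real.exp_le_exp.2 ?_) (norm_nonneg _)
          linarith [add_mul N |c.re| |z.re|]
      _ = Real.exp (|c.im| * R) * (‖f z‖ * Real.exp ((N + |c.re|) * |z.re|)) := by
          rw [Real.exp_add]
          ring
      _ ≤ Real.exp (|c.im| * R) * C := by
          gcongr
          exact hC z hz⟩
  map_add' f g := by
    ext z
    simp [mul_add]
  map_smul' a f := by
    ext z
    simp
    ring

/-- The operator `f(z) ↦ f(z + a)`. -/
def shift (a : ℂ) : Module.End ℂ Dom where
  toFun f := ⟨fun z => f.1 (z + a), by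
    obtain ⟨f, hf, hf'⟩ := f
    refine ⟨hf.comp (differentiable_id.add_const a), fun R N => ?_⟩
    obtain ⟨C, hC⟩ := hf' (R + |a.im|) |N|
    refine ⟨Real.exp (|N| * |a.re|) * C, fun z hz => ?_⟩
    have h1 : |z.re| ≤ |(z + a).re| + |a.re| := by
      rw [Complex.add_re]
      simpa using abs_sub (z.re + a.re) a.re
    have h2 : |(z + a).im| ≤ R + |a.im| := by
      rw [Complex.add_im]
      exact (abs_add_le _ _).trans (by linarith)
    have h3 : N * |z.re| ≤ |N| * |a.re| + |N| * |(z + a).re| := by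
      calc N * |z.re| ≤ |N| * |z.re| := by gcongr; exact le_abs_self N
        _ ≤ |N| * (|(z + a).re| + |a.re|) := by gcongr
        _ = _ := by ring
    calc ‖f (z + a)‖ * Real.exp (N * |z.re|)
        ≤ ‖f (z + a)‖ * Real.exp (|N| * |a.re| + |N| * |(z + a).re|) := by gcongr
      _ = Real.exp (|N| * |a.re|) * (‖f (z + a)‖ * Real.exp (|N| * |(z + a).re|)) := by
          rw [Real.exp_add]
          ring
      _ ≤ Real.exp (|N| * |a.re|) * C := by
          gcongr
          exact hC _ h2⟩
  map_add' _ _ := rfl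
  map_smul' _ _ := rfl

theorem mulExp_mul_mulExp {c d : ℂ} (h : c + d = 0) : mulExp c * mulExp d = 1 := by
  ext f z
  change Complex.exp (c * z) * (Complex.exp (d * z) * f.1 z) = f.1 z
  rw [← mul_assoc, ← Complex.exp_add, ← add_mul, h, zero_mul, Complex.exp_zero, one_mul]

theorem shift_mul_shift {a b : ℂ} (h : a + b = 0) : shift a * shift b = 1 := by
  ext f z
  change f.1 (z + a + b) = f.1 z
  rw [add_assoc, h, add_zero]

/-- `U f(z) = e^{-iπz/ω} f(z)`. -/
def U (τ : ℝ) : (Module.End ℂ Dom)ˣ where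
  val := mulExp (-Complex.I * Real.pi / omega τ)
  inv := mulExp (Complex.I * Real.pi / omega τ)
  val_inv := mulExp_mul_mulExp (by ring)
  inv_val := mulExp_mul_mulExp (by ring)

/-- `V f(z) = f(z + 2ω')`. -/
def V (τ : ℝ) : (Module.End ℂ Dom)ˣ where
  val := shift (2 * omega' τ)
  inv := shift (-(2 * omega' τ))
  val_inv := shift_mul_shift (by ring)
  inv_val := shift_mul_shift (by ring)

/-- `X₃ = U⁻¹ (1 + q V)`. -/
def X3 (τ : ℝ) : Module.End ℂ Dom := ↑(U τ)⁻¹ * (1 + q τ • ↑(V τ))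

/-- `X₄ = U⁻¹ (q⁻¹ + U + V) V⁻¹`. -/
def X4 (τ : ℝ) : Module.End ℂ Dom :=
  ↑(U τ)⁻¹ * ((q τ)⁻¹ • (1 : Module.End ℂ Dom) + ↑(U τ) + ↑(V τ)) * ↑(V τ)⁻¹

/-- `X₅ = (1 + q U) V⁻¹`. -/
def X5 (τ : ℝ) : Module.End ℂ Dom := (1 + q τ • ↑(U τ)) * ↑(V τ)⁻¹

/-- The operators `X₁ = U`, `X₂ = V`, `X₃`, `X₄`, `X₅`, indexed modulo 5 (so `X₅` has index 0). -/
def X (τ : ℝ) : ZMod 5 → Module.End ℂ Dom := ![X5 τ, ↑(U τ), ↑(V τ), X3 τ, X4 τ]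

/-! ### The operators as unbounded operators of `L²(ℝ)` -/

theorem memLp_dom (f : Dom) : MemLp (fun x : ℝ => f.1 (x : ℂ)) 2 (volume : Measure ℝ) := by
  obtain ⟨f, hf, hf'⟩ := f
  have hc : Continuous fun x : ℝ => f (x : ℂ) := hf.continuous.comp Complex.continuous_ofReal
  obtain ⟨C, hC⟩ := hf' 0 1
  rw [memLp_two_iff_integrable_sq_norm hc.aestronglyMeasurable]
  refine (integrable_inv_one_add_sq.const_mul (C ^ 2)).mono'
    (hc.norm.pow 2).aestronglyMeasurable ?_
  filter_upwards with x
  have h := hC (x : ℂ) (by simp)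
  rw [Complex.ofReal_re, one_mul] at h
  have h1 : 1 + |x| ≤ Real.exp |x| := by rw [add_comm]; exact Real.add_one_le_exp _
  have h2 : 1 + x ^ 2 ≤ Real.exp |x| ^ 2 := by
    nlinarith [abs_nonneg x, sq_abs x]
  have h3 : (‖f x‖ * Real.exp |x|) ^ 2 ≤ C ^ 2 := by gcongr
  rw [Real.norm_of_nonneg (by positivity), ← div_eq_mul_inv, le_div_iff₀ (by positivity)]
  calc ‖f x‖ ^ 2 * (1 + x ^ 2) ≤ ‖f x‖ ^ 2 * Real.exp |x| ^ 2 := by gcongr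
    _ ≤ C ^ 2 := by rw [← mul_pow]; exact h3

/-- The restriction of a function to the real line, as an element of `L²(ℝ)`. -/
def toH : Dom →ₗ[ℂ] H where
  toFun f := (memLp_dom f).toLp _
  map_add' f g := MemLp.toLp_add (memLp_dom f) (memLp_dom g)
  map_smul' c f := MemLp.toLp_const_smul c (memLp_dom f)

theorem toH_injective : Function.Injective toH := by
  intro f g h
  have h1 := (MemLp.toLp_eq_toLp_iff (memLp_dom f) (memLp_dom g)).1 h
  have h2 : (fun x : ℝ => f.1 (x : ℂ)) = fun x : ℝ => g.1 (x : ℂ) :=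
    (Continuous.ae_eq_iff_eq volume
      (f.2.1.continuous.comp Complex.continuous_ofReal)
      (g.2.1.continuous.comp Complex.continuous_ofReal)).1 h1
  have hf : AnalyticOnNhd ℂ f.1 Set.univ := fun z _ => f.2.1.analyticAt z
  have hg : AnalyticOnNhd ℂ g.1 Set.univ := fun z _ => g.2.1.analyticAt z
  refine Subtype.ext (hf.eq_of_frequently_eq (z₀ := 0) hg ?_)
  have ht : Filter.Tendsto (fun x : ℝ => (x : ℂ)) (nhdsWithin 0 {0}ᶜ) (nhdsWithin 0 {0}ᶜ) := by
    refine tendsto_nhdsWithin_iff.2 ⟨?_, ?_⟩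
    · have := Complex.continuous_ofReal.tendsto (0 : ℝ)
      rw [Complex.ofReal_zero] at this
      exact this.mono_left nhdsWithin_le_nhds
    · filter_upwards [self_mem_nhdsWithin] with x hx
      simpa using hx
  exact ht.frequently (Filter.Frequently.of_forall fun x => congrFun h2 x)

/-- The linear map `A` of `Dom` as an unbounded operator of `L²(ℝ)` with domain `Dom`. -/
def onH (A : Module.End ℂ Dom) : H →ₗ.[ℂ] H where
  domain := LinearMap.range toH
  toFun := toH ∘ₗ A ∘ₗ (LinearEquiv.ofInjective toH toH_injective).symm.toLinearMap

end

end QuantumYSystem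

open QuantumYSystem

/-!
# The quantum pentagon `Y`-system

Write `b = √τ`, so that `U` multiplies by `e^{-2πbz}`, `V` shifts by `ib`, and `UV = q² VU`. All
`Tᵢ` are conjugates of the closure of `U` by powers of `S = KF` (`opT`); hence they are
self-adjoint and nonnegative, and what has to be shown is that `Tᵢ` extends `Xᵢ`, that `Xᵢ` is
essentially self-adjoint for `τ ≤ 1`, and that the sequence is periodic.

Analytic input. The integral that defines `γ` converges in the strip `|Im z| < (b + 1/b)/2`, and
there `γ(x + ib/2) = (1 + e^{-2πbx}) γ(x - ib/2)` (`gammaC_add`): the logarithmic derivative of the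
quotient is the Fourier transform of a hyperbolic secant, found by moving a contour. Together with
`γ(z) conj γ(conj z) = 1` this bounds `1/γ` on the lines `Im z = ±b/2`, and two contour shifts, with
a Phragmén–Lindelöf bound, give for `f ∈ Dom` the identity `integral_inv_gamma_mul`:
`∫ γ⁻¹ (1 + qU) f = ∫ γ⁻¹ V f`. It is a weak form of `γ (1 + q⁻¹U) V γ⁻¹ = V`, which requires no
continuation of `γ` to the line `Im z = b`, where `γ` may be singular.

The extension property. The Fourier transform preserves `Dom` and carries `U` to `V⁻¹` and `V` to
`U`. A pair belongs to the graph of a self-adjoint closure as soon as it satisfies the symmetry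
relation against the original domain (`mem_graph_closure_iff`), and for `X₃`, `X₄`, `X₅` these
relations become instances of the integral identity; `X₄` is tested two steps earlier, on `T₂`,
as `X₃` is not known to be essentially self-adjoint if `τ > 1`.

Essential self-adjointness. By `eq_closure_of_dense` it suffices that `1 + Xᵢ` has dense range. A
vector orthogonal to the range of `1 + X_{i+1}` is carried by `S` to a vector that is orthogonal to
`(1 + Xᵢ) f` for every `f` approximated, together with `Xᵢ f`, by functions `γ g` with `g ∈ Dom`.
Such approximations are the Gaussian regularizations of `f/γ`. For `X₃` and `X₄` they apply to
`f ∈ (1 + qU) Dom`, and `integral_add_integral_V_eq_zero` removes this restriction. It divides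
by `1 + q e^{-2πbz}` in the strip `0 ≤ Im z ≤ b`, and the hypothesis `τ ≤ 1` is what keeps zeros out
of the interior.

Periodicity. For `τ ≤ 1` both `T₅` and `T₀` extend `X₅`, so both are its closure. The operator `S` is
unchanged under `τ ↦ 1/τ` (`S_inv`), and the multipliers of `U` for `τ` and `1/τ` are powers of each
other. A unitary operator that commutes with one of them commutes with the other by the
continuous functional calculus, so the periodicity for `τ > 1` follows from that for `1/τ`.
-/

open MeasureTheory

namespace QuantumYSystem

/-! ### Self-adjoint closures and unitary conjugation -/

section Operators

variable {E : Type*} [NormedAddCommGroup E] [InnerProductSpace ℂ E]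

theorem adjoint_topologicalClosure (G : Submodule ℂ (E × E)) :
    G.topologicalClosure.adjoint = G.adjoint := by
  ext x
  simp only [Submodule.mem_adjoint_iff]
  refine ⟨fun h a b hab => h a b (G.le_topologicalClosure hab), fun h a b hab => ?_⟩
  have hc : IsClosed {p : E × E | inner ℂ p.2 x.1 - inner ℂ p.1 x.2 = 0} :=
    isClosed_eq (by fun_prop) continuous_const
  have : closure (G : Set (E × E)) ⊆ {p : E × E | inner ℂ p.2 x.1 - inner ℂ p.1 x.2 = 0} :=
    closure_minimal (fun p hp => h p.1 p.2 hp) hc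
  exact this hab

variable [CompleteSpace E]

theorem graph_adjoint_eq_of_isSelfAdjoint {T : E →ₗ.[ℂ] E} (hT : IsSelfAdjoint T) :
    T.graph.adjoint = T.graph := by
  rw [← LinearPMap.adjoint_graph_eq_graph_adjoint hT.dense_domain,
    LinearPMap.isSelfAdjoint_def.1 hT]

theorem isSelfAdjoint_of_graph {T : E →ₗ.[ℂ] E} (hd : Dense (T.domain : Set E))
    (hT : T.graph.adjoint = T.graph) : IsSelfAdjoint T := by
  rw [LinearPMap.isSelfAdjoint_def]
  apply LinearPMap.eq_of_eq_graph
  rw [LinearPMap.adjoint_graph_eq_graph_adjoint hd, hT]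

/-- For the closure `A` of a nonnegative operator, `1 + A` is onto when its range is dense: the range
is closed because `‖x‖ ≤ ‖x + A x‖`. -/
theorem exists_add_eq_of_dense {G : Submodule ℂ (E × E)}
    (hpos : ∀ p ∈ G, 0 ≤ (inner ℂ p.1 p.2 : ℂ).re)
    (hdense : ∀ k : E, (∀ p ∈ G, inner ℂ k (p.1 + p.2) = 0) → k = 0) (y : E) :
    ∃ p ∈ G.topologicalClosure, p.1 + p.2 = y := by
  have hpos' : ∀ p ∈ G.topologicalClosure, 0 ≤ (inner ℂ p.1 p.2 : ℂ).re := by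
    intro p hp
    have hc : IsClosed {p : E × E | 0 ≤ (inner ℂ p.1 p.2 : ℂ).re} :=
      isClosed_le continuous_const (by fun_prop)
    exact closure_minimal (fun p hp => hpos p hp) hc hp
  let N : G.topologicalClosure →ₗ[ℂ] E :=
    (LinearMap.fst ℂ E E + LinearMap.snd ℂ E E) ∘ₗ G.topologicalClosure.subtype
  have hN : ∀ p : G.topologicalClosure, N p = p.1.1 + p.1.2 := fun _ => rfl
  have h1 : ∀ p : G.topologicalClosure, ‖p.1.1‖ ≤ ‖N p‖ := by
    intro p
    have h := hpos' p.1 p.2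
    by_contra! hlt
    have h2 : ‖N p‖ ^ 2 = ‖p.1.1‖ ^ 2 + 2 * (inner ℂ p.1.1 p.1.2 : ℂ).re + ‖p.1.2‖ ^ 2 := by
      rw [hN]
      exact norm_add_sq (𝕜 := ℂ) _ _
    nlinarith [norm_nonneg (N p), sq_nonneg ‖p.1.2‖]
  have h2 : ∀ p : G.topologicalClosure, ‖p.1.2‖ ≤ 2 * ‖N p‖ := by
    intro p
    have : p.1.2 = N p - p.1.1 := by rw [hN]; abel
    rw [this]
    linarith [norm_sub_le (N p) p.1.1, h1 p]
  have hanti : AntilipschitzWith 2 N := by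
    refine AddMonoidHomClass.antilipschitz_of_bound N fun p => ?_
    change max ‖p.1.1‖ ‖p.1.2‖ ≤ _
    push_cast
    exact max_le ((h1 p).trans (by linarith [norm_nonneg (N p)])) (h2 p)
  have : CompleteSpace G.topologicalClosure := by
    have := G.isClosed_topologicalClosure
    infer_instance
  have hcl : IsClosed (Set.range N) :=
    hanti.isClosed_range (AddMonoidHomClass.uniformContinuous_of_bound N 2 (fun p => by
      rw [hN]
      have : ‖p‖ = max ‖p.1.1‖ ‖p.1.2‖ := rfl
      have := norm_add_le p.1.1 p.1.2
      have := le_max_left ‖p.1.1‖ ‖p.1.2‖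
      have := le_max_right ‖p.1.1‖ ‖p.1.2‖
      linarith))
  have htop : LinearMap.range N = ⊤ := by
    have hcl' : IsClosed ((LinearMap.range N : Submodule ℂ E) : Set E) := by
      rwa [LinearMap.coe_range]
    have : CompleteSpace (LinearMap.range N) := hcl'.completeSpace_coe
    rw [← Submodule.orthogonal_eq_bot_iff, Submodule.eq_bot_iff]
    intro k hk
    refine hdense k fun p hp => ?_
    rw [Submodule.mem_orthogonal'] at hk
    exact hk _ ⟨⟨p, G.le_topologicalClosure hp⟩, rfl⟩
  obtain ⟨p, hp⟩ := LinearMap.range_eq_top.1 htop y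
  exact ⟨p.1, p.2, hp⟩

/-- A densely defined nonnegative symmetric operator `A` with `1 + A` of dense range is
essentially self-adjoint. -/
theorem isSelfAdjoint_closure {A : E →ₗ.[ℂ] E} (hd : Dense (A.domain : Set E))
    (hsymm : ∀ p ∈ A.graph, ∀ r ∈ A.graph, inner ℂ p.2 r.1 = (inner ℂ p.1 r.2 : ℂ))
    (hpos : ∀ p ∈ A.graph, 0 ≤ (inner ℂ p.1 p.2 : ℂ).re)
    (hdense : ∀ k : E, (∀ p ∈ A.graph, inner ℂ k (p.1 + p.2) = 0) → k = 0) :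
    A.IsClosable ∧ IsSelfAdjoint A.closure := by
  have hle : A ≤ A.adjoint := by
    apply LinearPMap.IsFormalAdjoint.le_adjoint hd
    intro x y
    exact hsymm _ (A.mem_graph x) _ (A.mem_graph y)
  have hcl : A.IsClosable :=
    (LinearPMap.adjoint_isClosed hd).isClosable.leIsClosable hle
  have hG : A.closure.graph = A.graph.topologicalClosure :=
    hcl.graph_closure_eq_closure_graph.symm
  have hsub : A.graph.topologicalClosure ≤ A.graph.adjoint := by
    apply Submodule.topologicalClosure_minimal
    · rw [← LinearPMap.adjoint_graph_eq_graph_adjoint hd]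
      exact LinearPMap.le_graph_iff.2 hle
    · rw [← LinearPMap.adjoint_graph_eq_graph_adjoint hd]
      exact LinearPMap.adjoint_isClosed hd
  refine ⟨hcl, isSelfAdjoint_of_graph (hd.mono A.le_closure.1) ?_⟩
  rw [hG, adjoint_topologicalClosure]
  refine le_antisymm (fun x hx => ?_) hsub
  -- An element `x` of the adjoint graph is compared with the `p` in the closure of the graph that
  -- solves `p.1 + p.2 = x.1 + x.2`; then `x.1 - p.1` is orthogonal to the range of `1 + A`.
  obtain ⟨p, hp, hpx⟩ := exists_add_eq_of_dense hpos hdense (x.1 + x.2)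
  have hp' := (Submodule.mem_adjoint_iff _ _).1 (hsub hp)
  rw [Submodule.mem_adjoint_iff] at hx
  have h2 : p.2 = x.2 + (x.1 - p.1) := by rw [← add_sub_assoc, add_comm x.2, ← hpx]; abel
  have h1 : x.1 - p.1 = 0 := by
    refine hdense _ fun r hr => ?_
    have e1 := sub_eq_zero.1 (hx r.1 r.2 hr)
    have e2 := sub_eq_zero.1 (hp' r.1 r.2 hr)
    rw [h2, inner_add_right] at e2
    rw [← inner_conj_symm, inner_add_left, inner_sub_right r.2, e1, e2]
    simp
  have h3 : x = p := Prod.ext (sub_eq_zero.1 h1) (by rw [h2, h1, add_zero])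
  rwa [h3]

/-- A self-adjoint operator has no proper self-adjoint extension. -/
theorem eq_closure_of_le {A T : E →ₗ.[ℂ] E} (hT : IsSelfAdjoint T)
    (hA : IsSelfAdjoint A.closure) (hle : A ≤ T) : T = A.closure := by
  have hcl : A.IsClosable := hT.isClosed.isClosable.leIsClosable hle
  have h1 : A.closure.graph ≤ T.graph := by
    rw [← hcl.graph_closure_eq_closure_graph]
    exact Submodule.topologicalClosure_minimal _ (LinearPMap.le_graph_iff.2 hle) hT.isClosed
  refine LinearPMap.eq_of_eq_graph (le_antisymm ?_ h1)
  rw [← graph_adjoint_eq_of_isSelfAdjoint hT, ← graph_adjoint_eq_of_isSelfAdjoint hA]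
  intro x hx
  rw [Submodule.mem_adjoint_iff] at hx ⊢
  exact fun a b hab => hx a b (h1 hab)

/-- Membership in a self-adjoint closure can be tested on the original domain. -/
theorem mem_graph_closure_iff {A : E →ₗ.[ℂ] E} (hA : IsSelfAdjoint A.closure)
    (hcl : A.IsClosable) (x : E × E) :
    x ∈ A.closure.graph ↔ ∀ p ∈ A.graph, inner ℂ p.2 x.1 = (inner ℂ p.1 x.2 : ℂ) := by
  rw [← graph_adjoint_eq_of_isSelfAdjoint hA, ← hcl.graph_closure_eq_closure_graph,
    adjoint_topologicalClosure, Submodule.mem_adjoint_iff]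
  exact ⟨fun h p hp => sub_eq_zero.1 (h p.1 p.2 hp), fun h a b hab => sub_eq_zero.2 (h (a, b) hab)⟩

theorem isClosable_of_le {A T : E →ₗ.[ℂ] E} (hT : IsSelfAdjoint T) (hle : A ≤ T) :
    A.IsClosable := hT.isClosed.isClosable.leIsClosable hle

end Operators

theorem mem_graph_conjOp (W : H ≃ₗᵢ[ℂ] H) (A : H →ₗ.[ℂ] H) (x y : H) :
    (x, y) ∈ (conjOp W A).graph ↔ (W x, W y) ∈ A.graph := by
  simp only [LinearPMap.mem_graph_iff]
  constructor
  · rintro ⟨u, hu, hv⟩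
    refine ⟨⟨W u.1, u.2⟩, by rw [← hu], ?_⟩
    rw [← hv]
    exact (W.apply_symm_apply _).symm
  · rintro ⟨u, hu, hv⟩
    have hx : x ∈ (conjOp W A).domain := by
      change W x ∈ A.domain
      rw [← hu]; exact u.2
    refine ⟨⟨x, hx⟩, rfl, ?_⟩
    change W.symm (A ⟨W x, hx⟩) = y
    rw [LinearIsometryEquiv.symm_apply_eq, ← hv]
    congr 1
    exact Subtype.ext hu.symm

theorem conjOp_conjOp (W R : H ≃ₗᵢ[ℂ] H) (A : H →ₗ.[ℂ] H) :
    conjOp W (conjOp R A) = conjOp (R * W) A := by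
  apply LinearPMap.eq_of_eq_graph
  ext ⟨x, y⟩
  rw [mem_graph_conjOp, mem_graph_conjOp, mem_graph_conjOp]
  rfl

theorem conjOp_one (A : H →ₗ.[ℂ] H) : conjOp 1 A = A := by
  apply LinearPMap.eq_of_eq_graph
  ext ⟨x, y⟩
  rw [mem_graph_conjOp]
  rfl

theorem isSelfAdjoint_conjOp (W : H ≃ₗᵢ[ℂ] H) {A : H →ₗ.[ℂ] H} (hA : IsSelfAdjoint A) :
    IsSelfAdjoint (conjOp W A) := by
  refine isSelfAdjoint_of_graph ?_ ?_
  · change Dense (W ⁻¹' (A.domain : Set H))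
    exact hA.dense_domain.preimage W.toHomeomorph.isOpenMap
  · ext ⟨x, y⟩
    rw [mem_graph_conjOp, ← graph_adjoint_eq_of_isSelfAdjoint hA, Submodule.mem_adjoint_iff,
      Submodule.mem_adjoint_iff]
    constructor
    · intro h a b hab
      have := h (W.symm a) (W.symm b) (by
        rw [mem_graph_conjOp, W.apply_symm_apply, W.apply_symm_apply]; exact hab)
      rw [← W.inner_map_map, ← W.inner_map_map (W.symm a), W.apply_symm_apply,
        W.apply_symm_apply] at this
      exact this
    · intro h a b hab
      rw [mem_graph_conjOp] at hab
      have := h _ _ hab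
      simp only [W.inner_map_map] at this
      exact this

theorem mem_graph_onH (A : Module.End ℂ Dom) (p : H × H) :
    p ∈ (onH A).graph ↔ ∃ f : Dom, p = (toH f, toH (A f)) := by
  rw [LinearPMap.mem_graph_iff]
  have key : ∀ f : Dom, (onH A).toFun ⟨toH f, f, rfl⟩ = toH (A f) := by
    intro f
    change toH (A ((LinearEquiv.ofInjective toH toH_injective).symm _)) = _
    congr 2
    exact (LinearEquiv.ofInjective toH toH_injective).symm_apply_apply f
  constructor
  · rintro ⟨⟨_, f, rfl⟩, h1, h2⟩
    refine ⟨f, Prod.ext h1.symm (h2.symm.trans (key f))⟩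
  · rintro ⟨f, rfl⟩
    exact ⟨⟨toH f, f, rfl⟩, rfl, key f⟩

theorem onH_le_iff (A : Module.End ℂ Dom) (T : H →ₗ.[ℂ] H) :
    onH A ≤ T ↔ ∀ f : Dom, (toH f, toH (A f)) ∈ T.graph := by
  rw [← LinearPMap.le_graph_iff]
  constructor
  · exact fun h f => h ((mem_graph_onH A _).2 ⟨f, rfl⟩)
  · rintro h p hp
    obtain ⟨f, rfl⟩ := (mem_graph_onH A p).1 hp
    exact h f

section ContourIntegrals

open Filter Topology Set

/-! ### Contour shifts and integrals depending on a parameter -/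

theorem integrable_exp_neg_mul_abs {δ : ℝ} (hδ : 0 < δ) :
    Integrable fun x : ℝ => Real.exp (-δ * |x|) := by
  have hm : 0 < min 1 (δ ^ 2 / 2) := by positivity
  refine (integrable_inv_one_add_sq.const_mul (min 1 (δ ^ 2 / 2))⁻¹).mono'
    (by fun_prop) ?_
  filter_upwards with x
  rw [Real.norm_of_nonneg (Real.exp_pos _).le, ← mul_inv, neg_mul, Real.exp_neg]
  refine inv_anti₀ (by positivity) ?_
  have h1 := Real.quadratic_le_exp_of_nonneg (x := δ * |x|) (by positivity)
  have h2 : min 1 (δ ^ 2 / 2) * x ^ 2 ≤ δ ^ 2 / 2 * x ^ 2 := by gcongr; exact min_le_right _ _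
  have h3 := min_le_left 1 (δ ^ 2 / 2)
  have h4 : (δ * |x|) ^ 2 = δ ^ 2 * x ^ 2 := by rw [mul_pow, sq_abs]
  nlinarith [mul_nonneg hδ.le (abs_nonneg x)]

theorem integrable_of_norm_le_exp {f : ℝ → ℂ} {C δ : ℝ} (hδ : 0 < δ)
    (hm : AEStronglyMeasurable f) (hf : ∀ x, ‖f x‖ ≤ C * Real.exp (-δ * |x|)) :
    Integrable f :=
  ((integrable_exp_neg_mul_abs hδ).const_mul C).mono' hm (Eventually.of_forall hf)

/-- Cauchy's theorem for a horizontal strip and a function that decays exponentially. -/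
theorem integral_strip_shift {f : ℂ → ℂ} {a b C δ : ℝ} (hab : a ≤ b) (hδ : 0 < δ)
    (hc : ContinuousOn f (Complex.im ⁻¹' Icc a b))
    (hd : DifferentiableOn ℂ f (Complex.im ⁻¹' Ioo a b))
    (hb : ∀ z : ℂ, z.im ∈ Icc a b → ‖f z‖ ≤ C * Real.exp (-δ * |z.re|)) :
    ∫ x : ℝ, f (x + a * Complex.I) = ∫ x : ℝ, f (x + b * Complex.I) := by
  have him : ∀ (x y : ℝ), ((x : ℂ) + y * Complex.I).im = y := by intro x y; simp
  have hre : ∀ (x y : ℝ), ((x : ℂ) + y * Complex.I).re = x := by intro x y; simp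
  have hC : 0 ≤ C := by
    have := (norm_nonneg _).trans (hb (a * Complex.I) (by simpa using hab))
    simpa using this
  have hint : ∀ y ∈ Icc a b, Integrable fun x : ℝ => f (x + y * Complex.I) := by
    intro y hy
    refine integrable_of_norm_le_exp (C := C) hδ ?_ fun x => ?_
    · refine Continuous.aestronglyMeasurable ?_
      refine hc.comp_continuous (by fun_prop) fun x => ?_
      rw [mem_preimage, him]; exact hy
    · have := hb (x + y * Complex.I) (by rw [him]; exact hy)
      rwa [hre] at this
  have hlim : ∀ y ∈ Icc a b, Tendsto (fun R : ℝ => ∫ x in (-R)..R, f (x + y * Complex.I)) atTop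
      (𝓝 (∫ x : ℝ, f (x + y * Complex.I))) := fun y hy =>
    intervalIntegral_tendsto_integral (hint y hy) tendsto_neg_atTop_atBot tendsto_id
  have hside : ∀ s : ℝ → ℝ, (∀ R, |s R| = |R|) →
      Tendsto (fun R : ℝ => Complex.I • ∫ y in a..b, f (s R + y * Complex.I)) atTop (𝓝 0) := by
    intro s hs
    refine squeeze_zero_norm' (a := fun R : ℝ => C * Real.exp (-δ * |R|) * |b - a|) ?_ ?_
    · filter_upwards with R
      rw [norm_smul, Complex.norm_I, one_mul]
      refine intervalIntegral.norm_integral_le_of_norm_le_const fun y hy => ?_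
      rw [uIoc_of_le hab] at hy
      have := hb (s R + y * Complex.I) (by rw [him]; exact ⟨hy.1.le, hy.2⟩)
      rwa [hre, hs] at this
    · have : Tendsto (fun R : ℝ => -δ * |R|) atTop atBot := by
        simp_rw [neg_mul]
        exact tendsto_neg_atTop_atBot.comp (tendsto_abs_atTop_atTop.const_mul_atTop hδ)
      simpa using ((Real.tendsto_exp_atBot.comp this).const_mul C).mul_const |b - a|
  have hrect : ∀ R : ℝ, (∫ x in (-R)..R, f (x + a * Complex.I)) -
      (∫ x in (-R)..R, f (x + b * Complex.I)) +
      Complex.I • (∫ y in a..b, f ((R : ℝ) + y * Complex.I)) -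
      Complex.I • (∫ y in a..b, f ((-R : ℝ) + y * Complex.I)) = 0 := by
    intro R
    have h := Complex.integral_boundary_rect_eq_zero_of_continuousOn_of_differentiableOn f
      ((-R : ℝ) + a * Complex.I) (R + b * Complex.I) ?_ ?_
    · simpa only [him, hre] using h
    · rw [him, him, uIcc_of_le hab]
      exact hc.mono fun z hz => (Complex.mem_reProdIm.1 hz).2
    · rw [him, him, min_eq_left hab, max_eq_right hab]
      exact hd.mono fun z hz => (Complex.mem_reProdIm.1 hz).2
  have h0 := (((hlim a ⟨le_rfl, hab⟩).sub (hlim b ⟨hab, le_rfl⟩)).add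
    (hside id fun _ => rfl)).sub (hside (fun R => -R) fun R => abs_neg R)
  simp only [id] at h0
  rw [tendsto_congr hrect, add_zero, sub_zero] at h0
  exact (sub_eq_zero.1 (tendsto_nhds_unique h0 tendsto_const_nhds))

/-- An integral of holomorphic functions is holomorphic in the parameter when the integrand is
locally dominated: Cauchy's estimate dominates its derivative. -/
theorem differentiableOn_integral {α : Type*} [MeasurableSpace α] {μ : Measure α}
    {F : ℂ → α → ℂ} {W : Set ℂ} (hW : IsOpen W)
    (hm : ∀ z ∈ W, AEStronglyMeasurable (F z) μ)
    (hd : ∀ t, DifferentiableOn ℂ (fun z => F z t) W)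
    (hb : ∀ z₀ ∈ W, ∃ bound : α → ℝ, Integrable bound μ ∧
      ∀ᶠ z in 𝓝 z₀, ∀ t, ‖F z t‖ ≤ bound t) :
    DifferentiableOn ℂ (fun z => ∫ t, F z t ∂μ) W := by
  intro z₀ hz₀
  obtain ⟨bound, hbi, hbd⟩ := hb z₀ hz₀
  obtain ⟨r, hr, hball⟩ := Metric.eventually_nhds_iff_ball.1
    (hbd.and (hW.eventually_mem hz₀))
  have hr2 : 0 < r / 2 := by positivity
  have hsub : ∀ z ∈ Metric.ball z₀ (r / 2), ∀ w ∈ Metric.closedBall z (r / 2 / 2),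
      w ∈ Metric.ball z₀ r := by
    intro z hz w hw
    rw [Metric.mem_ball] at *
    rw [Metric.mem_closedBall] at hw
    linarith [dist_triangle w z z₀]
  have hdiff : ∀ t, ∀ z ∈ Metric.ball z₀ (r / 2),
      HasDerivAt (fun z => F z t) (deriv (fun z => F z t) z) z := by
    intro t z hz
    have hz' := hsub z hz z (Metric.mem_closedBall_self (by positivity))
    exact ((hd t).differentiableAt (hW.mem_nhds (hball z hz').2)).hasDerivAt
  refine (HasDerivAt.differentiableAt (hasDerivAt_integral_of_dominated_loc_of_deriv_le
    (F' := fun z t => deriv (fun z => F z t) z)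
    (bound := fun t => bound t / (r / 2 / 2))
    (Metric.ball_mem_nhds z₀ hr2) ?_ ?_ ?_ ?_ ?_ ?_).2).differentiableWithinAt
  · filter_upwards [hW.mem_nhds hz₀] with z hz using hm z hz
  · exact hbi.mono' (hm z₀ hz₀) (Eventually.of_forall (hball z₀ (Metric.mem_ball_self hr)).1)
  · obtain ⟨u, hu⟩ : ∃ u : ℕ → ℂ, ∀ n, u n = ((r / 2 / ((n : ℝ) + 2) : ℝ) : ℂ) := ⟨_, fun _ => rfl⟩
    have hpos : ∀ n : ℕ, 0 < r / 2 / ((n : ℝ) + 2) := fun n => by positivity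
    have hu0 : ∀ n, u n ≠ 0 := fun n => by
      rw [hu]; exact_mod_cast (hpos n).ne'
    have hut : Tendsto u atTop (𝓝[≠] 0) := by
      refine tendsto_nhdsWithin_iff.2 ⟨?_, Eventually.of_forall hu0⟩
      rw [funext hu, ← Complex.ofReal_zero]
      refine (Complex.continuous_ofReal.tendsto 0).comp ?_
      exact Tendsto.div_atTop tendsto_const_nhds
        (tendsto_atTop_add_const_right _ _ tendsto_natCast_atTop_atTop)
    have hmem : ∀ n, z₀ + u n ∈ W := by
      intro n
      refine (hball _ ?_).2
      rw [Metric.mem_ball, dist_self_add_left, hu, Complex.norm_real,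
        Real.norm_of_nonneg (hpos n).le,
        div_lt_iff₀ (by positivity)]
      nlinarith [(Nat.cast_nonneg n : (0 : ℝ) ≤ n)]
    refine aestronglyMeasurable_of_tendsto_ae (u := atTop)
      (f := fun n t => (u n)⁻¹ • (F (z₀ + u n) t - F z₀ t)) (fun n => ?_) ?_
    · exact ((hm _ (hmem n)).sub (hm z₀ hz₀)).const_mul (u n)⁻¹
    · filter_upwards with t
      exact (hdiff t z₀ (Metric.mem_ball_self hr2)).tendsto_slope_zero.comp hut
  · filter_upwards with t z hz
    refine Complex.norm_deriv_le_of_forall_mem_sphere_norm_le (by positivity) ?_ ?_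
    · refine DifferentiableOn.diffContOnCl ?_
      rw [closure_ball _ (by positivity)]
      exact (hd t).mono fun w hw => (hball w (hsub z hz w hw)).2
    · intro w hw
      exact (hball w (hsub z hz w (Metric.sphere_subset_closedBall hw))).1 t
  · exact hbi.div_const _
  · filter_upwards with t z hz using hdiff t z hz

end ContourIntegrals

section DifferenceEquation

open Filter Topology Set

/-! ### The logarithm of `1 + e^{-2πbx}` as a contour integral -/

/-- The Fourier transform of the hyperbolic secant, from Euler's beta integral for
`B(1/2 + iy, 1/2 - iy)`. -/
theorem integral_exp_div_cosh (y : ℝ) :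
    ∫ w : ℝ, Complex.exp (Complex.I * y * w) / (2 * Complex.cosh (w / 2)) =
      Real.pi / Complex.cosh (Real.pi * y) := by
  set u : ℂ := 1 / 2 + Complex.I * y with hu
  have hu1 : 1 - u = 1 / 2 - Complex.I * y := by rw [hu]; ring
  have hre : 0 < u.re := by simp [hu]
  have hre1 : 0 < (1 - u).re := by rw [hu1]; simp
  have hB : Complex.betaIntegral u (1 - u) = Real.pi / Complex.cosh (Real.pi * y) := by
    have h := Complex.Gamma_mul_Gamma_eq_betaIntegral hre hre1
    rw [Complex.Gamma_mul_Gamma_one_sub, add_sub_cancel, Complex.Gamma_one, one_mul] at h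
    rw [← h, hu, mul_add, mul_one_div, add_comm, Complex.sin_add_pi_div_two,
      show (Real.pi : ℂ) * (Complex.I * y) = (Real.pi * y) * Complex.I by ring,
      Complex.cos_mul_I]
  rw [← hB, Complex.betaIntegral, intervalIntegral.integral_of_le zero_le_one,
    integral_Ioc_eq_integral_Ioo, ← Real.range_sigmoid, ← image_univ,
    integral_image_eq_integral_abs_deriv_smul MeasurableSet.univ
      (fun x _ => (Real.hasDerivAt_sigmoid x).hasDerivWithinAt) Real.sigmoid_injective.injOn,
    setIntegral_univ]
  congr 1
  ext w
  have hp := Real.sigmoid_pos w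
  have hq : 0 < 1 - Real.sigmoid w := sub_pos.2 (Real.sigmoid_lt_one w)
  have hq' : 1 - Real.sigmoid w = Real.sigmoid w * Real.exp (-w) := by
    rw [Real.sigmoid_mul_rexp_neg, Real.sigmoid_neg]
  rw [abs_of_pos (mul_pos hp hq), Complex.real_smul]
  have hp0 : (Real.sigmoid w : ℂ) ≠ 0 := by exact_mod_cast hp.ne'
  have hq0 : (1 - Real.sigmoid w : ℂ) ≠ 0 := by exact_mod_cast hq.ne'
  rw [Complex.cpow_sub _ _ hp0, Complex.cpow_sub _ _ hq0, Complex.cpow_one, Complex.cpow_one]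
  have hlog : Complex.log (1 - Real.sigmoid w) = Complex.log (Real.sigmoid w) - w := by
    have : Complex.log ((1 - Real.sigmoid w : ℝ) : ℂ) = _ := (Complex.ofReal_log hq.le).symm
    push_cast at this
    rw [this, ← Complex.ofReal_log hp.le, hq', Real.log_mul hp.ne' (Real.exp_pos _).ne',
      Real.log_exp]
    push_cast
    ring
  rw [Complex.cpow_def_of_ne_zero hp0, Complex.cpow_def_of_ne_zero hq0, hlog]
  push_cast
  rw [show ∀ a c d e : ℂ, a * c * (d / a * (e / c)) = a * c / (a * c) * (d * e) by
    intros; ring, div_self (mul_ne_zero hp0 hq0), one_mul, ← Complex.exp_add,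
    show Complex.log (Real.sigmoid w) * u + (Complex.log (Real.sigmoid w) - w) * (1 - u)
      = Complex.log (Real.sigmoid w) - w * (1 - u) by ring, Complex.exp_sub,
    Complex.exp_log hp0, Real.sigmoid_def, hu1]
  push_cast
  have h1 : (1 : ℂ) + Complex.exp (-w) ≠ 0 := by
    have : (1 : ℝ) + Real.exp (-w) ≠ 0 := by positivity
    exact_mod_cast this
  have h2 : 2 * Complex.cosh (w / 2) ≠ 0 := by
    have : 2 * Real.cosh (w / 2) ≠ 0 := by positivity
    exact_mod_cast this
  rw [div_eq_iff h2, inv_eq_one_div, div_div, one_div, inv_mul_eq_div, eq_div_iff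
    (mul_ne_zero h1 (Complex.exp_ne_zero _)), Complex.two_cosh]
  rw [mul_left_comm, ← Complex.exp_add, add_mul, one_mul, ← Complex.exp_add]
  congr 2 <;> ring

theorem exp_abs_div_two_le_cosh (x : ℝ) : Real.exp |x| / 2 ≤ Real.cosh x := by
  rw [Real.cosh_eq]
  rcases abs_cases x with ⟨h, _⟩ | ⟨h, _⟩ <;> rw [h] <;>
    linarith [Real.exp_pos x, Real.exp_pos (-x)]

theorem norm_sinh_ge (w : ℂ) : |Real.sin w.im| * (Real.exp |w.re| / 2) ≤ ‖Complex.sinh w‖ := by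
  have h : (Complex.sinh w).im = Real.cosh w.re * Real.sin w.im := by
    conv_lhs => rw [← Complex.re_add_im w, Complex.sinh_add, Complex.cosh_mul_I,
      Complex.sinh_mul_I]
    rw [← Complex.ofReal_sinh, ← Complex.ofReal_cosh, ← Complex.ofReal_sin, ← Complex.ofReal_cos]
    simp [-Complex.ofReal_sin, -Complex.ofReal_cos, -Complex.ofReal_sinh, -Complex.ofReal_cosh]
  calc _ ≤ |Real.sin w.im| * Real.cosh w.re := by
        gcongr; exact exp_abs_div_two_le_cosh _
    _ = |(Complex.sinh w).im| := by
        rw [h, abs_mul, abs_of_pos (Real.cosh_pos _), mul_comm]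
    _ ≤ _ := Complex.abs_im_le_norm _

theorem div_two_mul_im (z : ℂ) (b : ℝ) : (z / (2 * b)).im = z.im / (2 * b) := by
  rw [show (2 * b : ℂ) = ((2 * b : ℝ) : ℂ) by push_cast; ring, Complex.div_ofReal_im]

theorem div_two_mul_re (z : ℂ) (b : ℝ) : (z / (2 * b)).re = z.re / (2 * b) := by
  rw [show (2 * b : ℂ) = ((2 * b : ℝ) : ℂ) by push_cast; ring, Complex.div_ofReal_re]

theorem norm_inv_sinh_le {b ε : ℝ} (hb : 0 < b) (hε : 0 < ε) (z : ℂ) (h1 : ε ≤ z.im)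
    (h2 : z.im ≤ Real.pi * b) : Complex.sinh (z / (2 * b)) ≠ 0 ∧
    ‖(Complex.sinh (z / (2 * b)))⁻¹‖ ≤
      2 / Real.sin (ε / (2 * b)) * Real.exp (-(1 / (2 * b)) * |z.re|) := by
  have h3 : z.im / (2 * b) ≤ Real.pi / 2 := by
    rw [div_le_div_iff₀ (by positivity) (by positivity)]; linarith
  have h4 : ε / (2 * b) ≤ z.im / (2 * b) := by gcongr
  have h5 : 0 < ε / (2 * b) := by positivity
  have hs : 0 < Real.sin (ε / (2 * b)) :=
    Real.sin_pos_of_pos_of_lt_pi h5 (by linarith [Real.pi_pos])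
  have hs2 : Real.sin (ε / (2 * b)) ≤ Real.sin (z.im / (2 * b)) :=
    Real.sin_le_sin_of_le_of_le_pi_div_two (by linarith [Real.pi_pos]) h3 h4
  have h := norm_sinh_ge (z / (2 * b))
  rw [div_two_mul_im, div_two_mul_re, abs_of_pos (hs.trans_le hs2), abs_div,
    abs_of_pos (by positivity : 0 < 2 * b)] at h
  have h6 : Real.sin (ε / (2 * b)) * (Real.exp (|z.re| / (2 * b)) / 2) ≤
      ‖Complex.sinh (z / (2 * b))‖ := le_trans (by gcongr) h
  have h7 : 0 < Real.sin (ε / (2 * b)) * (Real.exp (|z.re| / (2 * b)) / 2) := by positivity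
  refine ⟨norm_pos_iff.1 (h7.trans_le h6), ?_⟩
  rw [norm_inv]
  calc ‖Complex.sinh (z / (2 * b))‖⁻¹
      ≤ (Real.sin (ε / (2 * b)) * (Real.exp (|z.re| / (2 * b)) / 2))⁻¹ := inv_anti₀ h7 h6
    _ = _ := by
      rw [show -(1 / (2 * b)) * |z.re| = -(|z.re| / (2 * b)) by ring, Real.exp_neg]
      field_simp

theorem norm_exp_I_mul (z : ℂ) (x : ℝ) :
    ‖Complex.exp (Complex.I * z * x)‖ = Real.exp (-(z.im * x)) := by
  rw [Complex.norm_exp]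
  simp

/-- The Fourier transform of `1 / sinh (t / 2b)` over a line above the pole `t = 0`, from that of
the hyperbolic secant by a shift of the contour to `Im t = πb`. -/
theorem integral_exp_div_sinh {b ε : ℝ} (hb : 0 < b) (hε : 0 < ε) (hεb : ε ≤ Real.pi * b)
    (x : ℝ) :
    ∫ s : ℝ, Complex.exp (Complex.I * (s + ε * Complex.I) * x) /
        Complex.sinh ((s + ε * Complex.I) / (2 * b)) =
      -Complex.I * (4 * Real.pi * b / (Complex.exp (2 * Real.pi * b * x) + 1)) := by
  have hb0 : (b : ℂ) ≠ 0 := by exact_mod_cast hb.ne'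
  have hne : ∀ z : ℂ, z.im ∈ Icc ε (Real.pi * b) → Complex.sinh (z / (2 * b)) ≠ 0 :=
    fun z hz => (norm_inv_sinh_le hb hε z hz.1 hz.2).1
  have h := integral_strip_shift
    (f := fun z => Complex.exp (Complex.I * z * x) / Complex.sinh (z / (2 * b)))
    (C := Real.exp (Real.pi * b * |x|) * (2 / Real.sin (ε / (2 * b)))) (δ := 1 / (2 * b))
    hεb (by positivity)
    (by
      refine ContinuousOn.div (by fun_prop) (by fun_prop) fun z hz => hne z hz)
    (by
      refine DifferentiableOn.div (by fun_prop) (by fun_prop) fun z hz =>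
        hne z ⟨hz.1.le, hz.2.le⟩)
    (by
      intro z hz
      rw [div_eq_mul_inv, norm_mul, norm_exp_I_mul, mul_assoc]
      refine mul_le_mul (Real.exp_le_exp.2 ?_) (norm_inv_sinh_le hb hε z hz.1 hz.2).2
        (norm_nonneg _) (Real.exp_pos _).le
      calc -(z.im * x) ≤ |z.im * x| := neg_le_abs _
        _ = z.im * |x| := by rw [abs_mul, abs_of_pos (hε.trans_le hz.1)]
        _ ≤ _ := by gcongr; exact hz.2)
  rw [h]
  have h2 : ∀ s : ℝ, Complex.exp (Complex.I * (s + (Real.pi * b : ℝ) * Complex.I) * x) /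
      Complex.sinh ((s + (Real.pi * b : ℝ) * Complex.I) / (2 * b)) =
      (-2 * Complex.I * Complex.exp (-(Real.pi * b * x))) *
        (fun w : ℝ => Complex.exp (Complex.I * ((b * x : ℝ) : ℂ) * w) /
          (2 * Complex.cosh (w / 2))) (s / b) := by
    intro s
    have e1 : (s + (Real.pi * b : ℝ) * Complex.I) / (2 * b) =
        ((s / b : ℝ) : ℂ) / 2 + Real.pi / 2 * Complex.I := by
      push_cast
      field_simp
    have e2 : Complex.I * (s + (Real.pi * b : ℝ) * Complex.I) * x =
        -(Real.pi * b * x) + Complex.I * ((b * x : ℝ) : ℂ) * ((s / b : ℝ) : ℂ) := by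
      push_cast
      field_simp
      linear_combination (Real.pi : ℂ) * b * x * Complex.I_sq
    have e3 : Complex.sinh (((s / b : ℝ) : ℂ) / 2 + Real.pi / 2 * Complex.I) =
        Complex.cosh (((s / b : ℝ) : ℂ) / 2) * Complex.I := by
      rw [Complex.sinh_add, Complex.cosh_mul_I, Complex.sinh_mul_I, Complex.cos_pi_div_two,
        Complex.sin_pi_div_two]
      ring
    rw [e1, e2, e3, Complex.exp_add]
    have h3 : Complex.cosh (((s / b : ℝ) : ℂ) / 2) ≠ 0 := by
      have : Real.cosh (s / b / 2) ≠ 0 := by positivity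
      exact_mod_cast this
    field_simp
    linear_combination Complex.I_sq
  rw [integral_congr_ae (Eventually.of_forall h2), integral_const_mul,
    Measure.integral_comp_div (fun w : ℝ => Complex.exp (Complex.I * ((b * x : ℝ) : ℂ) * w) /
      (2 * Complex.cosh (w / 2))) b, integral_exp_div_cosh, abs_of_pos hb,
    Complex.real_smul]
  have h4 : Complex.cosh (Real.pi * ((b * x : ℝ) : ℂ)) =
      Complex.exp (-(Real.pi * b * x)) * (Complex.exp (2 * Real.pi * b * x) + 1) / 2 := by
    rw [Complex.cosh, mul_add, mul_one, ← Complex.exp_add]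
    push_cast
    ring_nf
  have h5 : Complex.exp (2 * Real.pi * b * x) + 1 ≠ 0 := by
    have : Real.exp (2 * Real.pi * b * x) + 1 ≠ 0 := by positivity
    exact_mod_cast this
  rw [h4]
  field_simp [Complex.exp_ne_zero]
  norm_num

/-- The contour integral `-½ ∫ e^{itx} / (t sinh (t / 2b)) dt` is the logarithm of
`1 + e^{-2πbx}`: both have the same derivative and vanish at `+∞`. -/
theorem integral_exp_div_mul_sinh {b ε : ℝ} (hb : 0 < b) (hε : 0 < ε) (hεb : ε ≤ Real.pi * b)
    (x : ℝ) :
    -(1 / 2) * ∫ s : ℝ, Complex.exp (Complex.I * (s + ε * Complex.I) * x) /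
        ((s + ε * Complex.I) * Complex.sinh ((s + ε * Complex.I) / (2 * b))) =
      (Real.log (1 + Real.exp (-(2 * Real.pi * b * x))) : ℂ) := by
  set t : ℝ → ℂ := fun s => s + ε * Complex.I with ht
  have him : ∀ s, (t s).im = ε := fun s => by simp [ht]
  have hre : ∀ s, (t s).re = s := fun s => by simp [ht]
  have htc : Continuous t := by fun_prop
  have ht0 : ∀ s, t s ≠ 0 := fun s h => hε.ne' (by rw [← him s, h, Complex.zero_im])
  have hsb : ∀ s, ‖(Complex.sinh (t s / (2 * b)))⁻¹‖ ≤
      2 / Real.sin (ε / (2 * b)) * Real.exp (-(1 / (2 * b)) * |s|) := fun s => by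
    have := (norm_inv_sinh_le hb hε (t s) (him s).ge ((him s).trans_le hεb)).2
    rwa [hre] at this
  have hs0 : ∀ s, Complex.sinh (t s / (2 * b)) ≠ 0 := fun s =>
    (norm_inv_sinh_le hb hε (t s) (him s).ge ((him s).trans_le hεb)).1
  have hnt : ∀ s, ε ≤ ‖t s‖ := fun s => by
    have := Complex.abs_im_le_norm (t s)
    rwa [him, abs_of_pos hε] at this
  have hδ : 0 < 1 / (2 * b) := by positivity
  set G : ℝ → ℝ → ℂ := fun x s =>
    Complex.exp (Complex.I * t s * x) / (t s * Complex.sinh (t s / (2 * b))) with hG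
  have hGc : ∀ x, Continuous (G x) := fun x => by
    refine Continuous.div (by fun_prop) (by fun_prop) fun s => mul_ne_zero (ht0 s) (hs0 s)
  have hGb : ∀ x s, ‖G x s‖ ≤ Real.exp (-(ε * x)) *
      (ε⁻¹ * (2 / Real.sin (ε / (2 * b)) * Real.exp (-(1 / (2 * b)) * |s|))) := by
    intro x s
    rw [hG]
    dsimp only
    rw [norm_div, norm_exp_I_mul, him, norm_mul, div_eq_mul_inv, mul_inv,
      ← norm_inv (Complex.sinh _)]
    gcongr
    · exact hnt s
    · exact hsb s
  have hGi : ∀ x, Integrable (G x) := fun x => by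
    refine integrable_of_norm_le_exp (C := Real.exp (-(ε * x)) *
      (ε⁻¹ * (2 / Real.sin (ε / (2 * b))))) hδ (hGc x).aestronglyMeasurable fun s => ?_
    refine (hGb x s).trans_eq (by ring)
  have hderiv : ∀ x : ℝ, HasDerivAt (fun x : ℝ => ∫ s, G x s)
      (Complex.I * ∫ s, Complex.exp (Complex.I * t s * x) / Complex.sinh (t s / (2 * b))) x := by
    intro x₀
    rw [← integral_const_mul]
    refine (hasDerivAt_integral_of_dominated_loc_of_deriv_le
      (F' := fun x s => Complex.I *
        (Complex.exp (Complex.I * t s * x) / Complex.sinh (t s / (2 * b))))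
      (bound := fun s => Real.exp (ε * (|x₀| + 1)) *
        (2 / Real.sin (ε / (2 * b)) * Real.exp (-(1 / (2 * b)) * |s|)))
      (Metric.ball_mem_nhds x₀ one_pos)
      (Eventually.of_forall fun x => (hGc x).aestronglyMeasurable) (hGi x₀) ?_ ?_ ?_ ?_).2
    · refine Continuous.aestronglyMeasurable ?_
      exact continuous_const.mul (Continuous.div (by fun_prop) (by fun_prop) hs0)
    · filter_upwards with s x hx
      rw [norm_mul, Complex.norm_I, one_mul, div_eq_mul_inv, norm_mul, norm_exp_I_mul, him]
      refine mul_le_mul (Real.exp_le_exp.2 ?_) (hsb s) (norm_nonneg _) (Real.exp_pos _).le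
      rw [Metric.mem_ball, Real.dist_eq] at hx
      have h1 : -x ≤ |x₀| + 1 := by
        have := abs_sub_abs_le_abs_sub x x₀
        have := neg_le_abs x
        linarith
      nlinarith
    · exact ((integrable_exp_neg_mul_abs hδ).const_mul _).const_mul _
    · filter_upwards with s x _
      have h1 : HasDerivAt (fun x : ℝ => Complex.exp (Complex.I * t s * x))
          (Complex.exp (Complex.I * t s * x) * (Complex.I * t s)) x := by
        have := ((Complex.ofRealCLM.hasDerivAt (x := x)).const_mul (Complex.I * t s)).cexp
        simpa using this
      have h2 := h1.div_const (t s * Complex.sinh (t s / (2 * b)))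
      refine h2.congr_deriv ?_
      have e1 := ht0 s
      have e2 := hs0 s
      field_simp
  set D : ℝ → ℂ := fun x => -(1 / 2) * (∫ s, G x s) -
    (Real.log (1 + Real.exp (-(2 * Real.pi * b * x))) : ℂ) with hD
  have hD' : ∀ x, HasDerivAt D 0 x := by
    intro x
    have h1 := (hderiv x).const_mul (-(1 / 2) : ℂ)
    have h2 : HasDerivAt (fun x : ℝ => Real.log (1 + Real.exp (-(2 * Real.pi * b * x))))
        (Real.exp (-(2 * Real.pi * b * x)) * (-(2 * Real.pi * b)) /
          (1 + Real.exp (-(2 * Real.pi * b * x)))) x := by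
      refine HasDerivAt.log ?_ (by positivity)
      refine HasDerivAt.const_add _ ?_
      refine HasDerivAt.exp ?_
      simpa using ((hasDerivAt_id' x).const_mul (2 * Real.pi * b)).fun_neg
    have h3 : HasDerivAt D _ x := h1.sub h2.ofReal_comp
    refine h3.congr_deriv ?_
    rw [integral_exp_div_sinh hb hε hεb x]
    have e1 : Complex.exp (2 * Real.pi * b * x) ≠ 0 := Complex.exp_ne_zero _
    have e2 : Complex.exp (2 * Real.pi * b * x) + 1 ≠ 0 := by
      have : Real.exp (2 * Real.pi * b * x) + 1 ≠ 0 := by positivity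
      exact_mod_cast this
    push_cast
    rw [Complex.exp_neg]
    have e3 : 1 + (Complex.exp (2 * Real.pi * b * x))⁻¹ ≠ 0 := by
      rw [← mul_ne_zero_iff_right e1, add_mul, inv_mul_cancel₀ e1, one_mul]
      exact e2
    field_simp
    rw [Complex.I_sq]
    ring
  have hconst : ∀ x y, D x = D y := fun x y =>
    is_const_of_deriv_eq_zero (fun x => (hD' x).differentiableAt) (fun x => (hD' x).deriv) x y
  have hlim : Tendsto D atTop (𝓝 0) := by
    have hexp : ∀ c : ℝ, 0 < c → Tendsto (fun x : ℝ => Real.exp (-(c * x))) atTop (𝓝 0) :=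
      fun c hc => Real.tendsto_exp_atBot.comp
        (tendsto_neg_atTop_atBot.comp (tendsto_id.const_mul_atTop hc))
    have h1 : Tendsto (fun x => ∫ s, G x s) atTop (𝓝 0) := by
      refine squeeze_zero_norm (a := fun x => Real.exp (-(ε * x)) * ∫ s : ℝ,
        (ε⁻¹ * (2 / Real.sin (ε / (2 * b)) * Real.exp (-(1 / (2 * b)) * |s|)))) (fun x => ?_) ?_
      · rw [← integral_const_mul]
        refine norm_integral_le_of_norm_le ?_ (Eventually.of_forall (hGb x))
        exact (((integrable_exp_neg_mul_abs hδ).const_mul _).const_mul _).const_mul _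
      · simpa using (hexp ε hε).mul_const (∫ s : ℝ,
          (ε⁻¹ * (2 / Real.sin (ε / (2 * b)) * Real.exp (-(1 / (2 * b)) * |s|))))
    have h2 : Tendsto (fun x : ℝ => Real.log (1 + Real.exp (-(2 * Real.pi * b * x)))) atTop
        (𝓝 0) := by
      have := ((hexp (2 * Real.pi * b) (by positivity)).const_add 1).log (by norm_num)
      simpa using this
    have h3 : Tendsto D atTop (𝓝 (-(1 / 2) * 0 - ((0 : ℝ) : ℂ))) :=
      (h1.const_mul (-(1 / 2) : ℂ)).sub ((Complex.continuous_ofReal.tendsto 0).comp h2)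
    simpa using h3
  have hx : D x = 0 :=
    tendsto_nhds_unique (tendsto_const_nhds.congr fun y => hconst x y) hlim
  exact sub_eq_zero.1 hx

end DifferenceEquation

section Dilogarithm

open Filter Topology Set

/-! ### The dilogarithm in a strip -/

/-- The integrand of `gamma` for a complex argument. -/
noncomputable def gammaIntegrandC (τ : ℝ) (z : ℂ) (s : ℝ) : ℂ :=
  Complex.exp (Complex.I * contour τ s * z) /
    (Complex.sin (omega τ * contour τ s) * Complex.sin (omega' τ * contour τ s) * contour τ s)

/-- The continuation of `gamma` to the strip `|Im z| < (√τ + 1/√τ) / 2`, in which the defining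
integral converges. -/
noncomputable def gammaC (τ : ℝ) (z : ℂ) : ℂ :=
  Complex.exp (-(1 / 4) * ∫ s : ℝ, gammaIntegrandC τ z s)

theorem gammaC_ofReal (τ x : ℝ) : gammaC τ x = gamma τ x := rfl

theorem gammaC_ne_zero (τ : ℝ) (z : ℂ) : gammaC τ z ≠ 0 := Complex.exp_ne_zero _

/-- The height `min (√τ) (1/√τ)` of the contour. -/
noncomputable def height (τ : ℝ) : ℝ := min (Real.sqrt τ) (1 / Real.sqrt τ)

theorem height_pos {τ : ℝ} (hτ : 0 < τ) : 0 < height τ :=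
  lt_min (Real.sqrt_pos.2 hτ) (one_div_pos.2 (Real.sqrt_pos.2 hτ))

theorem contour_eq (τ s : ℝ) : contour τ s = s + height τ * Complex.I := by
  rw [contour, mul_comm Complex.I]; rfl

theorem contour_im (τ s : ℝ) : (contour τ s).im = height τ := by simp [contour_eq]

theorem contour_re (τ s : ℝ) : (contour τ s).re = s := by simp [contour_eq]

theorem sin_omega_mul {τ : ℝ} (t : ℂ) :
    Complex.sin (omega τ * t) = Complex.sinh (t / (2 * Real.sqrt τ)) * Complex.I := by
  rw [← Complex.sin_mul_I]
  congr 1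
  unfold omega
  ring

theorem sin_omega'_mul {τ : ℝ} (t : ℂ) :
    Complex.sin (omega' τ * t) =
      Complex.sinh (t / (2 * ((1 / Real.sqrt τ : ℝ) : ℂ))) * Complex.I := by
  rw [← Complex.sin_mul_I]
  congr 1
  unfold omega'
  push_cast
  field_simp

theorem continuous_contour (τ : ℝ) : Continuous (contour τ) := by
  unfold contour; fun_prop

theorem norm_gammaIntegrandC_le {τ : ℝ} (hτ : 0 < τ) : ∃ C : ℝ, 0 ≤ C ∧ ∀ (z : ℂ) (s : ℝ),
    ‖gammaIntegrandC τ z s‖ ≤ C * Real.exp (height τ * |z.re|) *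
      Real.exp (-((Real.sqrt τ + 1 / Real.sqrt τ) / 2 - |z.im|) * |s|) := by
  set b := Real.sqrt τ with hb
  have hb0 : 0 < b := Real.sqrt_pos.2 hτ
  have hε := height_pos hτ
  have h1 : height τ ≤ Real.pi * b := by
    have : height τ ≤ b := min_le_left _ _
    nlinarith [Real.pi_gt_three]
  have h2 : height τ ≤ Real.pi * (1 / b) := by
    have : height τ ≤ 1 / b := min_le_right _ _
    have : 0 < 1 / b := by positivity
    nlinarith [Real.pi_gt_three]
  have hs : ∀ c : ℝ, 0 < c → height τ ≤ Real.pi * c → 0 ≤ 2 / Real.sin (height τ / (2 * c)) := by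
    intro c hc h
    refine div_nonneg (by norm_num) (Real.sin_nonneg_of_nonneg_of_le_pi (by positivity) ?_)
    rw [div_le_iff₀ (by positivity)]
    nlinarith [Real.pi_pos]
  refine ⟨2 / Real.sin (height τ / (2 * b)) * (2 / Real.sin (height τ / (2 * (1 / b)))) *
    (height τ)⁻¹, mul_nonneg (mul_nonneg (hs b hb0 h1) (hs _ (by positivity) h2)) (by positivity),
    fun z s => ?_⟩
  have hn : height τ ≤ ‖contour τ s‖ := by
    have := Complex.abs_im_le_norm (contour τ s)
    rwa [contour_im, abs_of_pos hε] at this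
  have e1 := (norm_inv_sinh_le hb0 hε (contour τ s) (contour_im τ s).ge
    ((contour_im τ s).trans_le h1)).2
  have e2 := (norm_inv_sinh_le (by positivity : 0 < 1 / b) hε (contour τ s) (contour_im τ s).ge
    ((contour_im τ s).trans_le h2)).2
  rw [contour_re] at e1 e2
  have e3 : ‖Complex.exp (Complex.I * contour τ s * z)‖ ≤
      Real.exp (height τ * |z.re| + |z.im| * |s|) := by
    rw [Complex.norm_exp]
    refine Real.exp_le_exp.2 ?_
    have : (Complex.I * contour τ s * z).re = -(height τ * z.re) - s * z.im := by
      simp [contour_re, contour_im]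
    rw [this]
    have := mul_le_mul_of_nonneg_left (neg_le_abs z.re) hε.le
    have := neg_le_abs (s * z.im)
    rw [abs_mul, mul_comm |s|] at this
    linarith
  rw [gammaIntegrandC, sin_omega_mul, sin_omega'_mul, ← hb, norm_div, norm_mul, norm_mul, norm_mul,
    norm_mul, Complex.norm_I, mul_one, mul_one, div_eq_mul_inv, mul_inv, mul_inv, ← norm_inv,
    ← norm_inv]
  calc _ ≤ Real.exp (height τ * |z.re| + |z.im| * |s|) *
        ((2 / Real.sin (height τ / (2 * b)) * Real.exp (-(1 / (2 * b)) * |s|)) *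
        (2 / Real.sin (height τ / (2 * (1 / b))) * Real.exp (-(1 / (2 * (1 / b))) * |s|)) *
        (height τ)⁻¹) := by
        have h3 := hs b hb0 h1
        have h4 := hs _ (by positivity) h2
        gcongr
    _ = _ := by
        rw [show -((b + 1 / b) / 2 - |z.im|) * |s| = |z.im| * |s| + -(1 / (2 * b)) * |s| +
          -(1 / (2 * (1 / b))) * |s| by field_simp; ring, Real.exp_add, Real.exp_add, Real.exp_add]
        ring

theorem continuous_gammaIntegrandC {τ : ℝ} (hτ : 0 < τ) (z : ℂ) :
    Continuous (gammaIntegrandC τ z) := by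
  have hb0 : 0 < Real.sqrt τ := Real.sqrt_pos.2 hτ
  have hε := height_pos hτ
  have hc := continuous_contour τ
  unfold gammaIntegrandC
  refine Continuous.div (by fun_prop) (by fun_prop) fun s => ?_
  rw [sin_omega_mul, sin_omega'_mul]
  have h1 : height τ ≤ Real.pi * Real.sqrt τ := by
    have : height τ ≤ Real.sqrt τ := min_le_left _ _
    nlinarith [Real.pi_gt_three]
  have h2 : height τ ≤ Real.pi * (1 / Real.sqrt τ) := by
    have : height τ ≤ 1 / Real.sqrt τ := min_le_right _ _
    have : 0 < 1 / Real.sqrt τ := by positivity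
    nlinarith [Real.pi_gt_three]
  have e1 := (norm_inv_sinh_le hb0 hε (contour τ s) (contour_im τ s).ge
    ((contour_im τ s).trans_le h1)).1
  have e2 := (norm_inv_sinh_le (by positivity : 0 < 1 / Real.sqrt τ) hε (contour τ s)
    (contour_im τ s).ge ((contour_im τ s).trans_le h2)).1
  refine mul_ne_zero (mul_ne_zero (mul_ne_zero e1 Complex.I_ne_zero)
    (mul_ne_zero e2 Complex.I_ne_zero)) fun h => hε.ne' ?_
  rw [← contour_im τ s, h, Complex.zero_im]

theorem half_sqrt_lt {τ : ℝ} (hτ : 0 < τ) :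
    Real.sqrt τ / 2 < (Real.sqrt τ + 1 / Real.sqrt τ) / 2 := by
  have : 0 < 1 / Real.sqrt τ := one_div_pos.2 (Real.sqrt_pos.2 hτ)
  linarith

theorem integrable_gammaIntegrandC {τ : ℝ} (hτ : 0 < τ) {z : ℂ}
    (hz : |z.im| < (Real.sqrt τ + 1 / Real.sqrt τ) / 2) : Integrable (gammaIntegrandC τ z) := by
  obtain ⟨C, -, hC⟩ := norm_gammaIntegrandC_le hτ
  exact integrable_of_norm_le_exp (sub_pos.2 hz)
    (continuous_gammaIntegrandC hτ z).aestronglyMeasurable (hC z)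

theorem differentiableOn_gammaC {τ : ℝ} (hτ : 0 < τ) :
    DifferentiableOn ℂ (gammaC τ) {z | |z.im| < (Real.sqrt τ + 1 / Real.sqrt τ) / 2} := by
  obtain ⟨C, hC0, hC⟩ := norm_gammaIntegrandC_le hτ
  have hε := height_pos hτ
  refine (DifferentiableOn.const_mul ?_ _).cexp
  refine differentiableOn_integral (isOpen_lt (by fun_prop) continuous_const) (fun z _ =>
    (continuous_gammaIntegrandC hτ z).aestronglyMeasurable) (fun s => ?_) ?_
  · refine Differentiable.differentiableOn ?_
    unfold gammaIntegrandC
    exact Differentiable.div_const (by fun_prop) _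
  · intro z₀ hz₀
    change |z₀.im| < _ at hz₀
    obtain ⟨y, hy1, hy2⟩ := exists_between hz₀
    refine ⟨fun s => C * Real.exp (height τ * (|z₀.re| + 1)) *
      Real.exp (-((Real.sqrt τ + 1 / Real.sqrt τ) / 2 - y) * |s|),
      (integrable_exp_neg_mul_abs (sub_pos.2 hy2)).const_mul _, ?_⟩
    have c1 : Continuous fun z : ℂ => |z.im| := by fun_prop
    have c2 : Continuous fun z : ℂ => |z.re| := by fun_prop
    filter_upwards [c1.continuousAt.eventually_lt continuousAt_const hy1,
      c2.continuousAt.eventually_lt continuousAt_const (lt_add_one |z₀.re|)] with z h1 h2 s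
    refine (hC z s).trans ?_
    gcongr

/-- The bound needed for the Phragmén–Lindelöf principle: the integral grows like
`e^{ε |Re z|}` with `ε` the height of the contour. -/
theorem norm_inv_gammaC_le {τ : ℝ} (hτ : 0 < τ) : ∃ B : ℝ, ∀ z : ℂ, |z.im| ≤ Real.sqrt τ / 2 →
    ‖(gammaC τ z)⁻¹‖ ≤ Real.exp (B * Real.exp (height τ * |z.re|)) := by
  obtain ⟨C, hC0, hC⟩ := norm_gammaIntegrandC_le hτ
  have hb0 : 0 < 1 / Real.sqrt τ / 2 := by
    have := Real.sqrt_pos.2 hτ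
    positivity
  refine ⟨1 / 4 * (C * ∫ s : ℝ, Real.exp (-(1 / Real.sqrt τ / 2) * |s|)), fun z hz => ?_⟩
  rw [gammaC, ← Complex.exp_neg, Complex.norm_exp]
  refine Real.exp_le_exp.2 ((Complex.re_le_norm _).trans ?_)
  have h1 : ‖∫ s : ℝ, gammaIntegrandC τ z s‖ ≤
      ∫ s : ℝ, C * Real.exp (height τ * |z.re|) * Real.exp (-(1 / Real.sqrt τ / 2) * |s|) := by
    refine norm_integral_le_of_norm_le ((integrable_exp_neg_mul_abs hb0).const_mul _)
      (Eventually.of_forall fun s => (hC z s).trans ?_)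
    gcongr
    linarith
  rw [integral_const_mul] at h1
  rw [norm_neg, norm_mul]
  calc _ ≤ 1 / 4 * (C * Real.exp (height τ * |z.re|) *
        ∫ s : ℝ, Real.exp (-(1 / Real.sqrt τ / 2) * |s|)) := by
        gcongr
        norm_num
    _ = _ := by ring

theorem gammaIntegrandC_neg (τ : ℝ) (z : ℂ) (s : ℝ) :
    gammaIntegrandC τ z (-s) =
      -(starRingEnd ℂ) (gammaIntegrandC τ ((starRingEnd ℂ) z) s) := by
  unfold gammaIntegrandC
  rw [contour_neg, map_div₀, map_mul, map_mul, ← Complex.exp_conj, ← Complex.sin_conj,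
    ← Complex.sin_conj, map_mul, map_mul, map_mul, map_mul, conj_omega, conj_omega',
    Complex.conj_I, Complex.conj_conj, ← div_neg]
  congr 1
  · congr 1
    ring
  · rw [mul_neg, mul_neg, neg_mul, neg_mul, mul_neg]

/-- The unitarity `|γ| = 1` on the real line, continued analytically. -/
theorem gammaC_mul_conj (τ : ℝ) (z : ℂ) :
    gammaC τ z * (starRingEnd ℂ) (gammaC τ ((starRingEnd ℂ) z)) = 1 := by
  have h : (∫ s : ℝ, gammaIntegrandC τ z s) =
      -(starRingEnd ℂ) (∫ s : ℝ, gammaIntegrandC τ ((starRingEnd ℂ) z) s) := by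
    conv_lhs => rw [← integral_neg_eq_self]
    simp_rw [gammaIntegrandC_neg]
    rw [integral_neg, integral_conj]
  rw [gammaC, gammaC, h, ← Complex.exp_conj, ← Complex.exp_add]
  simp [Complex.conj_ofNat]

/-- The difference equation of the dilogarithm. -/
theorem gammaC_add {τ : ℝ} (hτ : 0 < τ) (x : ℝ) :
    gammaC τ (x + (Real.sqrt τ / 2 : ℝ) * Complex.I) =
      (1 + Complex.exp (-(2 * Real.pi * Real.sqrt τ * x))) *
        gammaC τ (x - (Real.sqrt τ / 2 : ℝ) * Complex.I) := by
  set b := Real.sqrt τ with hb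
  have hb0 : 0 < b := Real.sqrt_pos.2 hτ
  have hε := height_pos hτ
  have h1 : height τ ≤ Real.pi * b := by
    have : height τ ≤ b := min_le_left _ _
    nlinarith [Real.pi_gt_three]
  have hlt := half_sqrt_lt hτ
  have him : ∀ y : ℝ, |y| = b / 2 → |((x : ℂ) + y * Complex.I).im| <
      (Real.sqrt τ + 1 / Real.sqrt τ) / 2 := by
    intro y hy
    simp only [Complex.add_im, Complex.ofReal_im, Complex.mul_im, Complex.ofReal_re,
      Complex.I_im, Complex.I_re, mul_zero, mul_one, add_zero, zero_add]
    rwa [hy]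
  have i1 := integrable_gammaIntegrandC hτ (him (b / 2) (abs_of_pos (by positivity)))
  have i2 := integrable_gammaIntegrandC hτ (him (-(b / 2))
    (by rw [abs_neg, abs_of_pos (by positivity)]))
  have hz2 : (x : ℂ) + ((-(b / 2) : ℝ) : ℂ) * Complex.I = x - (b / 2 : ℝ) * Complex.I := by
    push_cast; ring
  rw [hz2] at i2
  have key : (∫ s : ℝ, gammaIntegrandC τ (x + (b / 2 : ℝ) * Complex.I) s) -
      ∫ s : ℝ, gammaIntegrandC τ (x - (b / 2 : ℝ) * Complex.I) s =
      2 * ∫ s : ℝ, Complex.exp (Complex.I * (s + height τ * Complex.I) * x) /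
        ((s + height τ * Complex.I) *
          Complex.sinh ((s + height τ * Complex.I) / (2 * b))) := by
    rw [← integral_sub i1 i2, ← integral_const_mul]
    congr 1
    ext s
    have e2 := (norm_inv_sinh_le (by positivity : 0 < 1 / b) hε (contour τ s)
      (contour_im τ s).ge ((contour_im τ s).trans_le (by
        have : height τ ≤ 1 / b := min_le_right _ _
        have : 0 < 1 / b := by positivity
        nlinarith [Real.pi_gt_three]))).1
    rw [gammaIntegrandC, gammaIntegrandC, ← contour_eq, sin_omega_mul, sin_omega'_mul, ← hb]
    set t := contour τ s
    have e3 : Complex.exp (Complex.I * t * (x + (b / 2 : ℝ) * Complex.I)) -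
        Complex.exp (Complex.I * t * (x - (b / 2 : ℝ) * Complex.I)) =
        -2 * Complex.exp (Complex.I * t * x) *
          Complex.sinh (t / (2 * ((1 / b : ℝ) : ℂ))) := by
      have hb1 : (b : ℂ) ≠ 0 := by exact_mod_cast hb0.ne'
      rw [Complex.sinh, show Complex.I * t * (x + (b / 2 : ℝ) * Complex.I) =
        Complex.I * t * x + -(t / (2 * ((1 / b : ℝ) : ℂ))) by
          push_cast
          field_simp
          linear_combination t * b * Complex.I_sq,
        show Complex.I * t * (x - (b / 2 : ℝ) * Complex.I) =
        Complex.I * t * x + (t / (2 * ((1 / b : ℝ) : ℂ))) by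
          push_cast
          field_simp
          linear_combination -t * b * Complex.I_sq, Complex.exp_add, Complex.exp_add]
      ring
    rw [← sub_div, e3, show ∀ A B : ℂ, A * Complex.I * (B * Complex.I) * t = -(A * B * t) by
      intro A B; linear_combination A * B * t * Complex.I_sq]
    -- If a denominator vanishes, both sides are `0`.
    by_cases ht : t = 0
    · simp [ht]
    by_cases h0 : Complex.sinh (t / (2 * b)) = 0
    · simp [h0]
    · field_simp
  have hlog := integral_exp_div_mul_sinh hb0 hε h1 x
  have hpos : 0 < 1 + Real.exp (-(2 * Real.pi * b * x)) := by positivity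
  rw [gammaC, gammaC, sub_eq_iff_eq_add.1 key, mul_add, Complex.exp_add]
  congr 1
  rw [show (-(1 / 4) : ℂ) * (2 * ∫ s : ℝ, Complex.exp (Complex.I * (s + height τ * Complex.I) * x) /
        ((s + height τ * Complex.I) *
          Complex.sinh ((s + height τ * Complex.I) / (2 * b)))) = -(1 / 2) *
          ∫ s : ℝ, Complex.exp (Complex.I * (s + height τ * Complex.I) * x) /
        ((s + height τ * Complex.I) *
          Complex.sinh ((s + height τ * Complex.I) / (2 * b))) by ring, hlog,
    ← Complex.ofReal_exp, Real.exp_log hpos]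
  push_cast
  rfl

end Dilogarithm

section KeyIdentity

open Filter Topology Set

/-! ### Functions in `Dom` and the basic integral identity -/

theorem exists_bound (f : Dom) (R N : ℝ) :
    ∃ C : ℝ, 0 ≤ C ∧ ∀ z : ℂ, |z.im| ≤ R → ‖f.1 z‖ ≤ C * Real.exp (-N * |z.re|) := by
  obtain ⟨C, hC⟩ := f.2.2 R N
  refine ⟨max C 0, le_max_right _ _, fun z hz => ?_⟩
  rw [neg_mul, Real.exp_neg, ← div_eq_mul_inv, le_div_iff₀ (Real.exp_pos _)]
  exact (hC z hz).trans (le_max_left _ _)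

theorem continuous_dom_ofReal (f : Dom) : Continuous fun x : ℝ => f.1 (x : ℂ) :=
  f.2.1.continuous.comp Complex.continuous_ofReal

theorem omega_factor {τ : ℝ} (hτ : 0 < τ) :
    -Complex.I * Real.pi / omega τ = -(2 * Real.pi * Real.sqrt τ) := by
  have h : (Real.sqrt τ : ℂ) ≠ 0 := by exact_mod_cast (Real.sqrt_pos.2 hτ).ne'
  unfold omega
  field_simp

theorem U_apply {τ : ℝ} (hτ : 0 < τ) (f : Dom) (z : ℂ) :
    ((U τ : Module.End ℂ Dom) f).1 z =
      Complex.exp (-(2 * Real.pi * Real.sqrt τ * z)) * f.1 z := by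
  change Complex.exp (-Complex.I * Real.pi / omega τ * z) * f.1 z = _
  rw [omega_factor hτ]
  ring_nf

theorem U_inv_apply {τ : ℝ} (hτ : 0 < τ) (f : Dom) (z : ℂ) :
    ((↑(U τ)⁻¹ : Module.End ℂ Dom) f).1 z =
      Complex.exp (2 * Real.pi * Real.sqrt τ * z) * f.1 z := by
  change Complex.exp (Complex.I * Real.pi / omega τ * z) * f.1 z = _
  rw [← neg_neg (Complex.I * Real.pi / omega τ), ← neg_div, ← neg_mul, omega_factor hτ]
  ring_nf

theorem V_apply (τ : ℝ) (f : Dom) (z : ℂ) :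
    ((V τ : Module.End ℂ Dom) f).1 z = f.1 (z + Real.sqrt τ * Complex.I) := by
  change f.1 (z + 2 * omega' τ) = _
  unfold omega'
  ring_nf

theorem V_inv_apply (τ : ℝ) (f : Dom) (z : ℂ) :
    ((↑(V τ)⁻¹ : Module.End ℂ Dom) f).1 z = f.1 (z - Real.sqrt τ * Complex.I) := by
  change f.1 (z + -(2 * omega' τ)) = _
  unfold omega'
  ring_nf

theorem one_add_smul_U_apply {τ : ℝ} (hτ : 0 < τ) (c : ℂ) (f : Dom) (z : ℂ) :
    ((1 + c • (U τ : Module.End ℂ Dom)) f).1 z =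
      (1 + c * Complex.exp (-(2 * Real.pi * Real.sqrt τ * z))) * f.1 z := by
  change f.1 z + c * ((U τ : Module.End ℂ Dom) f).1 z = _
  rw [U_apply hτ]
  ring

/-- `f(z) ↦ conj (f (conj z))`. -/
noncomputable def conjDom (f : Dom) : Dom :=
  ⟨fun z => (starRingEnd ℂ) (f.1 ((starRingEnd ℂ) z)), by
    refine ⟨fun z => ?_, fun R N => ?_⟩
    · have h := DifferentiableAt.conj_conj (f := f.1) (f.2.1 ((starRingEnd ℂ) z))
      rw [Complex.conj_conj] at h
      exact h
    · obtain ⟨C, hC⟩ := f.2.2 R N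
      refine ⟨C, fun z hz => ?_⟩
      have := hC ((starRingEnd ℂ) z) (by simpa using hz)
      simpa using this⟩

theorem conjDom_apply (f : Dom) (z : ℂ) :
    (conjDom f).1 z = (starRingEnd ℂ) (f.1 ((starRingEnd ℂ) z)) := rfl

theorem conjDom_ofReal (f : Dom) (x : ℝ) : (conjDom f).1 x = (starRingEnd ℂ) (f.1 x) := by
  rw [conjDom_apply, Complex.conj_ofReal]

/-- Entire functions of at most exponential growth on horizontal strips: multipliers of `Dom`. -/
def Tempered (a : ℂ → ℂ) : Prop :=
  Differentiable ℂ a ∧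
    ∀ R : ℝ, ∃ C N : ℝ, 0 ≤ C ∧ ∀ z : ℂ, |z.im| ≤ R → ‖a z‖ ≤ C * Real.exp (N * |z.re|)

/-- Multiplication by an entire function of exponential growth. -/
def mulDom (a : ℂ → ℂ) (ha : Tempered a) (f : Dom) : Dom :=
  ⟨fun z => a z * f.1 z, by
    refine ⟨ha.1.mul f.2.1, fun R N => ?_⟩
    obtain ⟨C, M, hC, h⟩ := ha.2 R
    obtain ⟨C', hC', h'⟩ := exists_bound f R (M + N)
    refine ⟨C * C', fun z hz => ?_⟩
    rw [norm_mul]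
    calc ‖a z‖ * ‖f.1 z‖ * Real.exp (N * |z.re|)
        ≤ C * Real.exp (M * |z.re|) * (C' * Real.exp (-(M + N) * |z.re|)) *
          Real.exp (N * |z.re|) := by
          gcongr
          · exact h z hz
          · exact h' z hz
      _ = C * C' * (Real.exp (M * |z.re|) * Real.exp (-(M + N) * |z.re|) *
          Real.exp (N * |z.re|)) := by ring
      _ = C * C' := by
          rw [← Real.exp_add, ← Real.exp_add, show M * |z.re| + -(M + N) * |z.re| + N * |z.re| = 0
            by ring, Real.exp_zero, mul_one]⟩

theorem mulDom_apply (a : ℂ → ℂ) (ha : Tempered a) (f : Dom) (z : ℂ) :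
    (mulDom a ha f).1 z = a z * f.1 z := rfl

theorem tempered_dom (f : Dom) : Tempered f.1 :=
  ⟨f.2.1, fun R => by
    obtain ⟨C, hC, h⟩ := exists_bound f R 0
    exact ⟨C, -0, hC, h⟩⟩

/-- The lines on which `|γ|` is known: it is `1` on the real line, and
`|γ(x ± ib/2)|² = (1 + e^{-2πbx})^{±1}` by the difference equation and the reflection formula. -/
theorem norm_gammaC_ofReal_add {τ : ℝ} (hτ : 0 < τ) {y : ℝ}
    (hy : y = 0 ∨ y = Real.sqrt τ / 2 ∨ y = -(Real.sqrt τ / 2)) (x : ℝ) :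
    ‖(gammaC τ (x + y * Complex.I))⁻¹‖ ≤
      2 * Real.exp (2 * Real.pi * Real.sqrt τ * |x|) := by
  have h0 : 1 ≤ Real.exp (2 * Real.pi * Real.sqrt τ * |x|) := Real.one_le_exp (by positivity)
  set A := gammaC τ (x + (Real.sqrt τ / 2 : ℝ) * Complex.I) with hA
  set A' := gammaC τ (x - (Real.sqrt τ / 2 : ℝ) * Complex.I) with hA'
  set e := Real.exp (-(2 * Real.pi * Real.sqrt τ * x)) with he
  have he0 : 0 < e := Real.exp_pos _
  have he1 : e ≤ Real.exp (2 * Real.pi * Real.sqrt τ * |x|) := by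
    refine Real.exp_le_exp.2 ?_
    rw [← mul_neg]
    gcongr
    exact neg_le_abs x
  have h1 : A = (1 + e : ℝ) * A' := by
    rw [hA, gammaC_add hτ, hA', he]
    push_cast
    ring
  have h2 : ‖A‖ * ‖A'‖ = 1 := by
    have := congrArg norm (gammaC_mul_conj τ (x + (Real.sqrt τ / 2 : ℝ) * Complex.I))
    rw [norm_mul, RCLike.norm_conj, map_add, map_mul, Complex.conj_ofReal, Complex.conj_ofReal,
      Complex.conj_I, mul_neg, ← sub_eq_add_neg, norm_one] at this
    exact this
  have h3 : ‖A‖ = (1 + e) * ‖A'‖ := by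
    rw [h1, norm_mul, Complex.norm_real, Real.norm_of_nonneg (by positivity)]
  have hp : 0 < ‖A'‖ := norm_pos_iff.2 (gammaC_ne_zero _ _)
  have hp' : 0 < ‖A‖ := norm_pos_iff.2 (gammaC_ne_zero _ _)
  have hi : ‖A'‖⁻¹ = ‖A‖ := inv_eq_of_mul_eq_one_left h2
  have hi' : ‖A‖⁻¹ = ‖A'‖ := inv_eq_of_mul_eq_one_right h2
  have h4 : ‖A‖ ^ 2 = 1 + e := by
    rw [sq]
    nth_rw 1 [h3]
    rw [mul_assoc, mul_comm ‖A'‖, h2, mul_one]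
  rcases hy with rfl | rfl | rfl
  · rw [Complex.ofReal_zero, zero_mul, add_zero, gammaC_ofReal, norm_inv, norm_gamma, inv_one]
    linarith
  · rw [norm_inv, hi']
    nlinarith
  · rw [show (x : ℂ) + ((-(Real.sqrt τ / 2) : ℝ) : ℂ) * Complex.I =
      x - (Real.sqrt τ / 2 : ℝ) * Complex.I by push_cast; ring, norm_inv, hi]
    nlinarith

/-- On a strip between two lines where `1/γ` is exponentially bounded, the product of `1/γ` with a
function in `Dom` decays, by the Phragmén–Lindelöf principle. -/
theorem norm_inv_gammaC_mul_le {τ : ℝ} (hτ : 0 < τ) (k : Dom) {y₁ y₂ : ℝ}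
    (hy : y₂ - y₁ = Real.sqrt τ / 2)
    (h1 : y₁ = 0 ∨ y₁ = Real.sqrt τ / 2 ∨ y₁ = -(Real.sqrt τ / 2))
    (h2 : y₂ = 0 ∨ y₂ = Real.sqrt τ / 2 ∨ y₂ = -(Real.sqrt τ / 2)) :
    ∃ C : ℝ, ∀ z : ℂ, z.im ∈ Icc y₁ y₂ →
      ‖(gammaC τ z)⁻¹ * k.1 z‖ ≤ C * Real.exp (-1 * |z.re|) := by
  have hb0 : 0 < Real.sqrt τ := Real.sqrt_pos.2 hτ
  have habs : ∀ y : ℝ, y = 0 ∨ y = Real.sqrt τ / 2 ∨ y = -(Real.sqrt τ / 2) →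
      |y| ≤ Real.sqrt τ / 2 := by
    rintro y (rfl | rfl | rfl)
    · rw [abs_zero]; positivity
    · rw [abs_of_pos (by positivity)]
    · rw [abs_neg, abs_of_pos (by positivity)]
  have hstrip : ∀ z : ℂ, z.im ∈ Icc y₁ y₂ → |z.im| ≤ Real.sqrt τ / 2 := by
    intro z hz
    have e1 := habs y₁ h1
    have e2 := habs y₂ h2
    rw [abs_le] at *
    exact ⟨e1.1.trans hz.1, hz.2.trans e2.2⟩
  obtain ⟨C, hC0, hC⟩ := exists_bound k (Real.sqrt τ / 2) (2 * Real.pi * Real.sqrt τ + 1)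
  obtain ⟨C', hC0', hC'⟩ := exists_bound k (Real.sqrt τ / 2) 1
  obtain ⟨B, hB⟩ := norm_inv_gammaC_le hτ
  have hexp : ∀ (σ : ℝ) (z : ℂ), |σ| = 1 → ‖Complex.exp (σ * z)‖ ≤ Real.exp (|z.re|) := by
    intro σ z hσ
    rw [Complex.norm_exp, Complex.re_ofReal_mul]
    refine Real.exp_le_exp.2 ((le_abs_self _).trans ?_)
    rw [abs_mul, hσ, one_mul]
  have hline : ∀ y : ℝ, (y = 0 ∨ y = Real.sqrt τ / 2 ∨ y = -(Real.sqrt τ / 2)) →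
      ∀ σ : ℝ, |σ| = 1 → ∀ z : ℂ, z.im = y →
      ‖(gammaC τ z)⁻¹ * k.1 z * Complex.exp (σ * z)‖ ≤ 2 * C := by
    intro y hy σ hσ z hz
    have e1 := norm_gammaC_ofReal_add hτ hy z.re
    rw [← hz, Complex.re_add_im] at e1
    have e2 := hC z (by rw [hz]; exact habs y hy)
    rw [norm_mul, norm_mul]
    calc _ ≤ 2 * Real.exp (2 * Real.pi * Real.sqrt τ * |z.re|) *
          (C * Real.exp (-(2 * Real.pi * Real.sqrt τ + 1) * |z.re|)) * Real.exp |z.re| := by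
          gcongr
          exact hexp σ z hσ
      _ = 2 * C * (Real.exp (2 * Real.pi * Real.sqrt τ * |z.re|) *
          Real.exp (-(2 * Real.pi * Real.sqrt τ + 1) * |z.re|) * Real.exp |z.re|) := by ring
      _ = 2 * C := by
          rw [← Real.exp_add, ← Real.exp_add, show 2 * Real.pi * Real.sqrt τ * |z.re| +
            -(2 * Real.pi * Real.sqrt τ + 1) * |z.re| + |z.re| = 0 by ring, Real.exp_zero, mul_one]
  have hdiff : DifferentiableOn ℂ (fun z => (gammaC τ z)⁻¹ * k.1 z)
      {z | |z.im| < (Real.sqrt τ + 1 / Real.sqrt τ) / 2} :=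
    ((differentiableOn_gammaC hτ).inv fun z _ => gammaC_ne_zero τ z).mul k.2.1.differentiableOn
  -- The factors `exp (± z)` turn boundedness into exponential decay.
  have hPL : ∀ σ : ℝ, |σ| = 1 → ∀ z : ℂ, z.im ∈ Icc y₁ y₂ →
      ‖(gammaC τ z)⁻¹ * k.1 z * Complex.exp (σ * z)‖ ≤ 2 * C := by
    intro σ hσ z hz
    refine PhragmenLindelof.horizontal_strip
      (f := fun z => (gammaC τ z)⁻¹ * k.1 z * Complex.exp (σ * z)) ?_ ⟨height τ, ?_, B, ?_⟩
      (hline y₁ h1 σ hσ) (hline y₂ h2 σ hσ) hz.1 hz.2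
    · refine DifferentiableOn.diffContOnCl ?_
      refine DifferentiableOn.mul (hdiff.mono ?_) (by fun_prop)
      have hcl : closure (Complex.im ⁻¹' Ioo y₁ y₂) ⊆ Complex.im ⁻¹' Icc y₁ y₂ :=
        closure_minimal (preimage_mono Ioo_subset_Icc_self)
          (isClosed_Icc.preimage Complex.continuous_im)
      exact hcl.trans fun w hw => (hstrip w hw).trans_lt (half_sqrt_lt hτ)
    · rw [hy, lt_div_iff₀ (by positivity)]
      have e1 : height τ ≤ 1 / Real.sqrt τ := min_le_right _ _
      calc height τ * (Real.sqrt τ / 2) ≤ 1 / Real.sqrt τ * (Real.sqrt τ / 2) := by gcongr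
        _ = 1 / 2 := by field_simp
        _ < Real.pi := by linarith [Real.pi_gt_three]
    · refine Asymptotics.IsBigO.of_bound C' ?_
      refine mem_inf_of_right ?_
      rw [mem_principal]
      intro w hw
      have hw' := hstrip w ⟨hw.1.le, hw.2.le⟩
      change ‖_‖ ≤ _
      rw [norm_mul, norm_mul, Real.norm_of_nonneg (Real.exp_pos _).le]
      calc _ ≤ Real.exp (B * Real.exp (height τ * |w.re|)) *
            (C' * Real.exp (-1 * |w.re|)) * Real.exp |w.re| := by
            gcongr
            · exact hB w hw'
            · exact hC' w hw'
            · exact hexp σ w hσ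
        _ = C' * Real.exp (B * Real.exp (height τ * |w.re|)) *
            (Real.exp (-1 * |w.re|) * Real.exp |w.re|) := by ring
        _ = _ := by
            rw [← Real.exp_add, show -1 * |w.re| + |w.re| = 0 by ring, Real.exp_zero, mul_one]
  refine ⟨2 * C, fun z hz => ?_⟩
  rw [neg_one_mul, Real.exp_neg, ← div_eq_mul_inv, le_div_iff₀ (Real.exp_pos _)]
  rcases abs_cases z.re with ⟨h, _⟩ | ⟨h, _⟩
  · have := hPL 1 (by simp) z hz
    rw [norm_mul, Complex.norm_exp, Complex.re_ofReal_mul, one_mul] at this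
    rwa [h]
  · have := hPL (-1) (by simp) z hz
    rw [norm_mul, Complex.norm_exp, Complex.re_ofReal_mul, neg_one_mul] at this
    rwa [h]

theorem integral_inv_gammaC_shift {τ : ℝ} (hτ : 0 < τ) (k : Dom) {y₁ y₂ : ℝ}
    (hy : y₂ - y₁ = Real.sqrt τ / 2)
    (h1 : y₁ = 0 ∨ y₁ = Real.sqrt τ / 2 ∨ y₁ = -(Real.sqrt τ / 2))
    (h2 : y₂ = 0 ∨ y₂ = Real.sqrt τ / 2 ∨ y₂ = -(Real.sqrt τ / 2)) :
    ∫ x : ℝ, (gammaC τ (x + y₁ * Complex.I))⁻¹ * k.1 (x + y₁ * Complex.I) =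
      ∫ x : ℝ, (gammaC τ (x + y₂ * Complex.I))⁻¹ * k.1 (x + y₂ * Complex.I) := by
  have hb0 : 0 < Real.sqrt τ := Real.sqrt_pos.2 hτ
  obtain ⟨C, hC⟩ := norm_inv_gammaC_mul_le hτ k hy h1 h2
  have hdiff : DifferentiableOn ℂ (fun z => (gammaC τ z)⁻¹ * k.1 z)
      {z | |z.im| < (Real.sqrt τ + 1 / Real.sqrt τ) / 2} :=
    ((differentiableOn_gammaC hτ).inv fun z _ => gammaC_ne_zero τ z).mul k.2.1.differentiableOn
  have hsub : Complex.im ⁻¹' Icc y₁ y₂ ⊆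
      {z | |z.im| < (Real.sqrt τ + 1 / Real.sqrt τ) / 2} := by
    intro z hz
    refine lt_of_le_of_lt ?_ (half_sqrt_lt hτ)
    rw [abs_le]
    have hz1 : y₁ ≤ z.im := hz.1
    have hz2 : z.im ≤ y₂ := hz.2
    rcases h1 with h1 | h1 | h1 <;> rcases h2 with h2 | h2 | h2 <;> constructor <;> linarith
  exact integral_strip_shift (f := fun z => (gammaC τ z)⁻¹ * k.1 z) (by linarith) one_pos
    (hdiff.continuousOn.mono hsub)
    (hdiff.mono ((preimage_mono Ioo_subset_Icc_self).trans hsub)) hC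

theorem q_ne_zero (τ : ℝ) : q τ ≠ 0 := Complex.exp_ne_zero _

theorem conj_q (τ : ℝ) : (starRingEnd ℂ) (q τ) = (q τ)⁻¹ := by
  rw [q, ← Complex.exp_conj, ← Complex.exp_neg]
  simp

theorem continuous_gamma {τ : ℝ} (hτ : 0 < τ) : Continuous (gamma τ) := by
  have h := (differentiableOn_gammaC hτ).continuousOn.comp_continuous Complex.continuous_ofReal
    (fun x => by
      change |(x : ℂ).im| < _
      rw [Complex.ofReal_im, abs_zero]
      have := Real.sqrt_pos.2 hτ
      positivity)
  exact h

theorem gamma_ne_zero (τ x : ℝ) : gamma τ x ≠ 0 := Complex.exp_ne_zero _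

theorem conj_gamma (τ x : ℝ) : (starRingEnd ℂ) (gamma τ x) = (gamma τ x)⁻¹ :=
  (inv_eq_of_mul_eq_one_right (by
    rw [Complex.mul_conj, Complex.normSq_eq_norm_sq, norm_gamma]; simp)).symm

/-- `γ⁻¹ (1 + qU)` and `γ⁻¹ V` have equal integrals: this is `γ (1 + q⁻¹U) V = V γ`, paired with a
test function. The contour is moved by `√τ/2` twice, and the difference equation is used on the
line in between, so that `γ` is only needed in the strip where its integral converges. -/
theorem integral_inv_gamma_mul {τ : ℝ} (hτ : 0 < τ) (f : Dom) :
    ∫ x : ℝ, (gamma τ x)⁻¹ * ((1 + q τ • (U τ : Module.End ℂ Dom)) f).1 x =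
      ∫ x : ℝ, (gamma τ x)⁻¹ * ((V τ : Module.End ℂ Dom) f).1 x := by
  have s1 := integral_inv_gammaC_shift hτ ((1 + q τ • (U τ : Module.End ℂ Dom)) f)
    (y₁ := 0) (y₂ := Real.sqrt τ / 2) (by ring) (by simp) (by simp)
  have s2 := integral_inv_gammaC_shift hτ ((V τ : Module.End ℂ Dom) f)
    (y₁ := -(Real.sqrt τ / 2)) (y₂ := 0) (by ring) (by simp) (by simp)
  simp only [Complex.ofReal_zero, zero_mul, add_zero, gammaC_ofReal] at s1 s2
  rw [s1, ← s2]
  congr 1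
  ext x
  rw [gammaC_add hτ, one_add_smul_U_apply hτ, V_apply, show (x : ℂ) +
    ((-(Real.sqrt τ / 2) : ℝ) : ℂ) * Complex.I = x - (Real.sqrt τ / 2 : ℝ) * Complex.I by
      push_cast; ring]
  have e1 : q τ * Complex.exp (-(2 * Real.pi * Real.sqrt τ *
      (x + (Real.sqrt τ / 2 : ℝ) * Complex.I))) =
      Complex.exp (-(2 * Real.pi * Real.sqrt τ * x)) := by
    have h2 : (Real.sqrt τ : ℂ) ^ 2 = τ := by exact_mod_cast Real.sq_sqrt hτ.le
    rw [q, ← Complex.exp_add]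
    congr 1
    push_cast
    linear_combination (-Complex.I * Real.pi) * h2
  have e2 : (1 : ℂ) + Complex.exp (-(2 * Real.pi * Real.sqrt τ * x)) ≠ 0 := by
    have : (1 : ℝ) + Real.exp (-(2 * Real.pi * Real.sqrt τ * x)) ≠ 0 := by positivity
    exact_mod_cast this
  rw [e1, show (x : ℂ) - (Real.sqrt τ / 2 : ℝ) * Complex.I + Real.sqrt τ * Complex.I =
    x + (Real.sqrt τ / 2 : ℝ) * Complex.I by push_cast; ring]
  have e3 := gammaC_ne_zero τ (x - (Real.sqrt τ / 2 : ℝ) * Complex.I)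
  field_simp

/-- The complex conjugate of `integral_inv_gamma_mul`. -/
theorem integral_gamma_mul {τ : ℝ} (hτ : 0 < τ) (f : Dom) :
    ∫ x : ℝ, gamma τ x * ((1 + (q τ)⁻¹ • (U τ : Module.End ℂ Dom)) f).1 x =
      ∫ x : ℝ, gamma τ x * ((↑(V τ)⁻¹ : Module.End ℂ Dom) f).1 x := by
  have h := congrArg (starRingEnd ℂ) (integral_inv_gamma_mul hτ (conjDom f))
  rw [← integral_conj, ← integral_conj] at h
  have e1 : ∀ x : ℝ, (starRingEnd ℂ) ((gamma τ x)⁻¹ *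
      ((1 + q τ • (U τ : Module.End ℂ Dom)) (conjDom f)).1 x) =
      gamma τ x * ((1 + (q τ)⁻¹ • (U τ : Module.End ℂ Dom)) f).1 x := by
    intro x
    rw [one_add_smul_U_apply hτ, one_add_smul_U_apply hτ, map_mul, map_inv₀, conj_gamma, inv_inv,
      conjDom_ofReal, map_mul, map_add, map_mul, conj_q, Complex.conj_conj, ← Complex.exp_conj]
    simp [Complex.conj_ofNat]
  have e2 : ∀ x : ℝ, (starRingEnd ℂ) ((gamma τ x)⁻¹ *
      ((V τ : Module.End ℂ Dom) (conjDom f)).1 x) =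
      gamma τ x * ((↑(V τ)⁻¹ : Module.End ℂ Dom) f).1 x := by
    intro x
    rw [V_apply, V_inv_apply, map_mul, map_inv₀, conj_gamma, inv_inv, conjDom_apply,
      Complex.conj_conj]
    simp [sub_eq_add_neg]
  simp only [e1, e2] at h
  exact h

end KeyIdentity

section GaussianRegularization

open Filter Topology Set

/-! ### Gaussian regularization -/

/-- Decay faster than every exponential on the real line. -/
def Rapid (h : ℝ → ℂ) : Prop :=
  ∀ N : ℝ, ∃ C : ℝ, 0 ≤ C ∧ ∀ x, ‖h x‖ ≤ C * Real.exp (-N * |x|)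

theorem rapid_dom (f : Dom) : Rapid fun x => f.1 (x : ℂ) := by
  intro N
  obtain ⟨C, hC, h⟩ := exists_bound f 0 N
  exact ⟨C, hC, fun x => by simpa using h x (by simp)⟩

theorem Rapid.mul_of_le {h w : ℝ → ℂ} (hh : Rapid h) {C M : ℝ} (hC : 0 ≤ C)
    (hw : ∀ x, ‖w x‖ ≤ C * Real.exp (M * |x|)) : Rapid fun x => w x * h x := by
  intro N
  obtain ⟨C', hC', h'⟩ := hh (M + N)
  refine ⟨C * C', by positivity, fun x => ?_⟩
  rw [norm_mul]
  calc _ ≤ C * Real.exp (M * |x|) * (C' * Real.exp (-(M + N) * |x|)) := by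
        gcongr
        · exact hw x
        · exact h' x
    _ = C * C' * (Real.exp (M * |x|) * Real.exp (-(M + N) * |x|)) := by ring
    _ = _ := by rw [← Real.exp_add]; ring_nf

theorem Rapid.integrable {h : ℝ → ℂ} (hh : Rapid h) (hm : AEStronglyMeasurable h) :
    Integrable h := by
  obtain ⟨C, -, h'⟩ := hh 1
  exact integrable_of_norm_le_exp one_pos hm h'

/-- The Gaussian approximate identity of variance `1 / (2 (n + 1))`. -/
noncomputable def gauss (n : ℕ) (w : ℂ) : ℂ :=
  ((Real.sqrt (n + 1) / Real.sqrt Real.pi : ℝ) : ℂ) * Complex.exp (-((n : ℂ) + 1) * w ^ 2)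

theorem differentiable_gauss (n : ℕ) : Differentiable ℂ (gauss n) := by
  unfold gauss; fun_prop

theorem norm_gauss (n : ℕ) (w : ℂ) : ‖gauss n w‖ = Real.sqrt (n + 1) / Real.sqrt Real.pi *
    Real.exp (-((n : ℝ) + 1) * (w.re ^ 2 - w.im ^ 2)) := by
  rw [gauss, norm_mul, Complex.norm_real, Real.norm_of_nonneg (by positivity), Complex.norm_exp,
    show (-((n : ℂ) + 1)) = ((-((n : ℝ) + 1) : ℝ) : ℂ) by push_cast; ring, Complex.re_ofReal_mul,
    sq w, Complex.mul_re, sq, sq]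

/-- A Gaussian beats every exponential. -/
theorem exp_neg_sq_le (n : ℕ) (N x : ℝ) : Real.exp (-((n : ℝ) + 1) * x ^ 2) ≤
    Real.exp (N ^ 2) * Real.exp (-N * |x|) := by
  rw [← Real.exp_add]
  refine Real.exp_le_exp.2 ?_
  nlinarith [sq_nonneg (|x| - N), sq_abs x, sq_nonneg N, sq_nonneg x,
    (Nat.cast_nonneg n : (0 : ℝ) ≤ n), mul_nonneg (Nat.cast_nonneg n : (0 : ℝ) ≤ n) (sq_nonneg x),
    sq_nonneg (|x| + N)]

theorem tempered_gauss_sub (n : ℕ) (a : ℂ) : Tempered fun z => gauss n (a - z) := by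
  refine ⟨(differentiable_gauss n).comp (by fun_prop), fun R => ?_⟩
  refine ⟨Real.sqrt (n + 1) / Real.sqrt Real.pi * Real.exp (((n : ℝ) + 1) * (|a.im| + R) ^ 2), 0,
    by positivity, fun z hz => ?_⟩
  rw [norm_gauss, zero_mul, Real.exp_zero, mul_one]
  refine mul_le_mul_of_nonneg_left (Real.exp_le_exp.2 ?_) (by positivity)
  have h1 : (a - z).im ^ 2 ≤ (|a.im| + R) ^ 2 := by
    refine sq_le_sq' ?_ ?_ <;> rw [Complex.sub_im] <;>
      linarith [neg_abs_le a.im, le_abs_self a.im, neg_abs_le z.im, le_abs_self z.im]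
  have h2 : (0 : ℝ) ≤ n + 1 := by positivity
  nlinarith [mul_nonneg h2 (sq_nonneg (a - z).re), mul_le_mul_of_nonneg_left h1 h2]

theorem norm_gauss_mul_le {h : ℝ → ℂ} (hr : Rapid h) (n : ℕ) (R N : ℝ) :
    ∃ C : ℝ, 0 ≤ C ∧ ∀ z : ℂ, |z.im| ≤ R → ∀ t : ℝ,
      ‖gauss n (z - t) * h t‖ ≤ C * Real.exp (-N * |z.re|) * Real.exp (-1 * |t|) := by
  obtain ⟨C, hC, h'⟩ := hr (|N| + 1)
  refine ⟨Real.sqrt (n + 1) / Real.sqrt Real.pi * Real.exp (((n : ℝ) + 1) * R ^ 2) *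
    Real.exp (|N| ^ 2) * C, by positivity, fun z hz t => ?_⟩
  have him : (z - t).im = z.im := by simp
  have hre : (z - t).re = z.re - t := by simp
  have h1 : z.im ^ 2 ≤ R ^ 2 := by
    rw [← sq_abs z.im]
    exact pow_le_pow_left₀ (abs_nonneg _) hz 2
  rw [norm_mul, norm_gauss, him, hre]
  have e1 : Real.exp (-((n : ℝ) + 1) * ((z.re - t) ^ 2 - z.im ^ 2)) ≤
      Real.exp (((n : ℝ) + 1) * R ^ 2) * (Real.exp (|N| ^ 2) * Real.exp (-|N| * |z.re - t|)) := by
    rw [show -((n : ℝ) + 1) * ((z.re - t) ^ 2 - z.im ^ 2) =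
      ((n : ℝ) + 1) * z.im ^ 2 + -((n : ℝ) + 1) * (z.re - t) ^ 2 by ring, Real.exp_add]
    gcongr
    exact exp_neg_sq_le n _ _
  have e2 : Real.exp (-|N| * |z.re - t|) * Real.exp (-(|N| + 1) * |t|) ≤
      Real.exp (-N * |z.re|) * Real.exp (-1 * |t|) := by
    rw [← Real.exp_add, ← Real.exp_add]
    refine Real.exp_le_exp.2 ?_
    have h3 : |z.re| ≤ |z.re - t| + |t| := by simpa using abs_add_le (z.re - t) t
    have h4 := mul_le_mul_of_nonneg_left h3 (abs_nonneg N)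
    have h5 := mul_le_mul_of_nonneg_right (le_abs_self N) (abs_nonneg z.re)
    linarith
  calc _ ≤ Real.sqrt (n + 1) / Real.sqrt Real.pi * (Real.exp (((n : ℝ) + 1) * R ^ 2) *
        (Real.exp (|N| ^ 2) * Real.exp (-|N| * |z.re - t|))) *
        (C * Real.exp (-(|N| + 1) * |t|)) := by
        gcongr
        exact h' t
    _ = Real.sqrt (n + 1) / Real.sqrt Real.pi * Real.exp (((n : ℝ) + 1) * R ^ 2) *
        Real.exp (|N| ^ 2) * C * (Real.exp (-|N| * |z.re - t|) * Real.exp (-(|N| + 1) * |t|)) := by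
        ring
    _ ≤ _ := by
        rw [mul_assoc _ (Real.exp (-N * |z.re|))]
        gcongr

/-- The convolution of a rapidly decreasing continuous function with a Gaussian. -/
noncomputable def gaussConv (n : ℕ) (h : ℝ → ℂ) (hc : Continuous h) (hr : Rapid h) : Dom :=
  ⟨fun z => ∫ t : ℝ, gauss n (z - t) * h t, by
    have hgc : ∀ z : ℂ, Continuous fun t : ℝ => gauss n (z - t) * h t := fun z =>
      ((differentiable_gauss n).continuous.comp (by fun_prop)).mul hc
    refine ⟨?_, fun R N => ?_⟩
    · rw [← differentiableOn_univ]
      refine differentiableOn_integral isOpen_univ (fun z _ => (hgc z).aestronglyMeasurable)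
        (fun t => ?_) fun z₀ _ => ?_
      · exact (((differentiable_gauss n).comp (by fun_prop)).mul_const _).differentiableOn
      · obtain ⟨C, hC, hb⟩ := norm_gauss_mul_le hr n (|z₀.im| + 1) 0
        refine ⟨fun t => C * Real.exp (-1 * |t|),
          (integrable_exp_neg_mul_abs one_pos).const_mul C, ?_⟩
        have c1 : Continuous fun z : ℂ => |z.im| := by fun_prop
        filter_upwards [c1.continuousAt.eventually_lt continuousAt_const (lt_add_one |z₀.im|)]
          with z hz t
        simpa using hb z hz.le t
    · obtain ⟨C, hC, hb⟩ := norm_gauss_mul_le hr n R N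
      refine ⟨C * ∫ t : ℝ, Real.exp (-1 * |t|), fun z hz => ?_⟩
      have h1 : ‖∫ t : ℝ, gauss n (z - t) * h t‖ ≤
          ∫ t : ℝ, C * Real.exp (-N * |z.re|) * Real.exp (-1 * |t|) :=
        norm_integral_le_of_norm_le ((integrable_exp_neg_mul_abs one_pos).const_mul _)
          (Eventually.of_forall (hb z hz))
      rw [integral_const_mul] at h1
      calc _ ≤ C * Real.exp (-N * |z.re|) * (∫ t : ℝ, Real.exp (-1 * |t|)) *
            Real.exp (N * |z.re|) := by gcongr
        _ = C * (∫ t : ℝ, Real.exp (-1 * |t|)) *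
            (Real.exp (-N * |z.re|) * Real.exp (N * |z.re|)) := by ring
        _ = _ := by rw [← Real.exp_add, neg_mul, neg_add_cancel, Real.exp_zero, mul_one]⟩

theorem gaussConv_apply (n : ℕ) {h : ℝ → ℂ} (hc : Continuous h) (hr : Rapid h) (z : ℂ) :
    (gaussConv n h hc hr).1 z = ∫ t : ℝ, gauss n (z - t) * h t := rfl

theorem integral_gauss_mul_eq (n : ℕ) (h : ℝ → ℂ) (x : ℝ) :
    ∫ t : ℝ, gauss n (x - t) * h t = ∫ u : ℝ, ((Real.exp (-u ^ 2) / Real.sqrt Real.pi : ℝ) : ℂ) *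
      h (x - u / Real.sqrt (n + 1)) := by
  set s := Real.sqrt (n + 1) with hs
  have hs0 : 0 < s := Real.sqrt_pos.2 (by positivity)
  have hs2 : s ^ 2 = n + 1 := Real.sq_sqrt (by positivity)
  rw [← integral_sub_left_eq_self _ volume x]
  have h1 := Measure.integral_comp_div (fun t : ℝ => gauss n (x - (x - t : ℝ)) * h (x - t)) s
  rw [abs_of_pos hs0] at h1
  rw [← inv_smul_smul₀ hs0.ne' (∫ t : ℝ, gauss n (x - (x - t : ℝ)) * h (x - t)), ← h1,
    ← integral_smul]
  congr 1
  ext u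
  rw [Complex.real_smul, ← mul_assoc]
  congr 1
  rw [gauss, show (-((n : ℂ) + 1)) * ((x : ℂ) - (x - u / s : ℝ)) ^ 2 = ((-u ^ 2 : ℝ) : ℂ) by
    have : (s : ℂ) ^ 2 = n + 1 := by exact_mod_cast hs2
    have hs1 : (s : ℂ) ≠ 0 := by exact_mod_cast hs0.ne'
    rw [← this]
    push_cast
    field_simp
    ring, ← Complex.ofReal_exp]
  rw [← hs]
  norm_cast
  field_simp

theorem integrable_exp_neg_sq_add (N : ℝ) :
    Integrable fun u : ℝ => Real.exp (-u ^ 2) * Real.exp (N * |u|) := by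
  refine ((integrable_exp_neg_mul_abs one_pos).const_mul (Real.exp ((N + 1) ^ 2))).mono'
    (by fun_prop) (Eventually.of_forall fun u => ?_)
  rw [Real.norm_of_nonneg (by positivity), ← Real.exp_add, ← Real.exp_add]
  refine Real.exp_le_exp.2 ?_
  nlinarith [sq_nonneg (|u| - (N + 1)), sq_abs u, sq_nonneg (N + 1), sq_nonneg (|u| + (N + 1))]

theorem norm_gauss_integrand_le {h : ℝ → ℂ} {C N : ℝ} (hN : 0 ≤ N) (hC : 0 ≤ C)
    (h' : ∀ x, ‖h x‖ ≤ C * Real.exp (-N * |x|)) (n : ℕ) (x u : ℝ) :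
    ‖((Real.exp (-u ^ 2) / Real.sqrt Real.pi : ℝ) : ℂ) * h (x - u / Real.sqrt (n + 1))‖ ≤
      C / Real.sqrt Real.pi * Real.exp (-N * |x|) * (Real.exp (-u ^ 2) * Real.exp (N * |u|)) := by
  have hs1 : 1 ≤ Real.sqrt (n + 1) := by
    rw [Real.one_le_sqrt]
    linarith [(Nat.cast_nonneg n : (0 : ℝ) ≤ n)]
  have hu : |u / Real.sqrt (n + 1)| ≤ |u| := by
    rw [abs_div, abs_of_pos (by positivity : 0 < Real.sqrt (n + 1))]
    exact div_le_self (abs_nonneg u) hs1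
  have e1 : Real.exp (-N * |x - u / Real.sqrt (n + 1)|) ≤
      Real.exp (-N * |x|) * Real.exp (N * |u|) := by
    rw [← Real.exp_add]
    refine Real.exp_le_exp.2 ?_
    have h3 : |x| ≤ |x - u / Real.sqrt (n + 1)| + |u / Real.sqrt (n + 1)| := by
      simpa using abs_add_le (x - u / Real.sqrt (n + 1)) (u / Real.sqrt (n + 1))
    have := mul_le_mul_of_nonneg_left (h3.trans (add_le_add_right hu _)) hN
    linarith
  rw [norm_mul, Complex.norm_real, Real.norm_of_nonneg (by positivity)]
  calc _ ≤ Real.exp (-u ^ 2) / Real.sqrt Real.pi *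
        (C * (Real.exp (-N * |x|) * Real.exp (N * |u|))) := by
        gcongr
        exact (h' _).trans (by gcongr)
    _ = _ := by ring

theorem norm_integral_gauss_mul_le {h : ℝ → ℂ} (hr : Rapid h) (N : ℝ) :
    ∃ C : ℝ, 0 ≤ C ∧ ∀ (n : ℕ) (x : ℝ),
      ‖∫ t : ℝ, gauss n (x - t) * h t‖ ≤ C * Real.exp (-N * |x|) := by
  obtain ⟨C, hC, h'⟩ := hr |N|
  refine ⟨C / Real.sqrt Real.pi * ∫ u : ℝ, Real.exp (-u ^ 2) * Real.exp (|N| * |u|),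
    mul_nonneg (by positivity) (integral_nonneg fun u => by positivity), fun n x => ?_⟩
  rw [integral_gauss_mul_eq]
  have h1 := norm_integral_le_of_norm_le
    ((integrable_exp_neg_sq_add |N|).const_mul (C / Real.sqrt Real.pi * Real.exp (-|N| * |x|)))
    (Eventually.of_forall (norm_gauss_integrand_le (abs_nonneg N) hC h' n x))
  rw [integral_const_mul] at h1
  refine h1.trans ?_
  rw [mul_right_comm]
  have h2 : 0 ≤ ∫ u : ℝ, Real.exp (-u ^ 2) * Real.exp (|N| * |u|) :=
    integral_nonneg fun u => by positivity
  gcongr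
  exact le_abs_self N

theorem tendsto_integral_gauss_mul {h : ℝ → ℂ} (hc : Continuous h) (hr : Rapid h) (x : ℝ) :
    Tendsto (fun n : ℕ => ∫ t : ℝ, gauss n (x - t) * h t) atTop (𝓝 (h x)) := by
  obtain ⟨C, hC, h'⟩ := hr 0
  have hlim : h x = ∫ u : ℝ, ((Real.exp (-u ^ 2) / Real.sqrt Real.pi : ℝ) : ℂ) * h x := by
    rw [integral_mul_const, integral_complex_ofReal, integral_div]
    have := integral_gaussian 1
    simp only [neg_mul, one_mul, div_one] at this
    rw [this, div_self (by positivity), Complex.ofReal_one, one_mul]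
  rw [hlim]
  simp_rw [integral_gauss_mul_eq]
  refine tendsto_integral_of_dominated_convergence
    (fun u => C / Real.sqrt Real.pi * Real.exp (-0 * |x|) *
      (Real.exp (-u ^ 2) * Real.exp (0 * |u|))) (fun n => ?_)
    ((integrable_exp_neg_sq_add 0).const_mul _)
    (fun n => Eventually.of_forall (norm_gauss_integrand_le le_rfl hC h' n x)) ?_
  · exact Continuous.aestronglyMeasurable (by fun_prop)
  · filter_upwards with u
    refine Tendsto.const_mul _ ((hc.tendsto x).comp ?_)
    have h1 : Tendsto (fun n : ℕ => Real.sqrt ((n : ℝ) + 1)) atTop atTop :=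
      Real.tendsto_sqrt_atTop.comp
        (tendsto_atTop_add_const_right _ _ tendsto_natCast_atTop_atTop)
    simpa using (tendsto_const_nhds (x := x)).sub ((tendsto_const_nhds (x := u)).div_atTop h1)

/-- Functions that become integrable after division by some exponential `e^{N|x|}`: the
functionals `f ↦ ∫ κ f` on `Dom` that occur as inner products. -/
def ExpIntegrable (κ : ℝ → ℂ) : Prop :=
  ∃ N : ℝ, Integrable fun x => κ x * (Real.exp (-N * |x|) : ℂ)

theorem ExpIntegrable.aestronglyMeasurable {κ : ℝ → ℂ} (hκ : ExpIntegrable κ) :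
    AEStronglyMeasurable κ := by
  obtain ⟨N, hN⟩ := hκ
  have h : Continuous fun x : ℝ => (Real.exp (N * |x|) : ℂ) := by fun_prop
  refine (hN.aestronglyMeasurable.mul h.aestronglyMeasurable).congr
    (Eventually.of_forall fun x => ?_)
  change κ x * (Real.exp (-N * |x|) : ℂ) * (Real.exp (N * |x|) : ℂ) = κ x
  rw [mul_assoc, ← Complex.ofReal_mul, ← Real.exp_add, neg_mul, neg_add_cancel, Real.exp_zero,
    Complex.ofReal_one, mul_one]

theorem ExpIntegrable.mul_of_le {κ w : ℝ → ℂ} (hκ : ExpIntegrable κ) (hw : Continuous w)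
    {C M : ℝ} (hb : ∀ x, ‖w x‖ ≤ C * Real.exp (M * |x|)) : ExpIntegrable fun x => κ x * w x := by
  have hm := hκ.aestronglyMeasurable
  obtain ⟨N, hN⟩ := hκ
  refine ⟨N + M, (hN.norm.const_mul C).mono' ?_ (Eventually.of_forall fun x => ?_)⟩
  · exact (hm.mul hw.aestronglyMeasurable).mul
      (Continuous.aestronglyMeasurable (by fun_prop))
  · rw [norm_mul, norm_mul, norm_mul, Complex.norm_real, Complex.norm_real,
      Real.norm_of_nonneg (Real.exp_pos _).le, Real.norm_of_nonneg (Real.exp_pos _).le]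
    calc ‖κ x‖ * ‖w x‖ * Real.exp (-(N + M) * |x|)
        ≤ ‖κ x‖ * (C * Real.exp (M * |x|)) * Real.exp (-(N + M) * |x|) := by
          gcongr; exact hb x
      _ = C * (‖κ x‖ * (Real.exp (M * |x|) * Real.exp (-(N + M) * |x|))) := by ring
      _ = _ := by rw [← Real.exp_add]; ring_nf

theorem ExpIntegrable.sub {κ κ' : ℝ → ℂ} (hκ : ExpIntegrable κ) (hκ' : ExpIntegrable κ') :
    ExpIntegrable fun x => κ x - κ' x := by
  have mono : ∀ {κ : ℝ → ℂ} {N M : ℝ}, N ≤ M →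
      Integrable (fun x => κ x * (Real.exp (-N * |x|) : ℂ)) →
      Integrable fun x => κ x * (Real.exp (-M * |x|) : ℂ) := by
    intro κ N M hNM h
    have hm := ExpIntegrable.aestronglyMeasurable ⟨N, h⟩
    refine h.norm.mono' (hm.mul (Continuous.aestronglyMeasurable (by fun_prop)))
      (Eventually.of_forall fun x => ?_)
    rw [norm_mul, norm_mul, Complex.norm_real, Complex.norm_real,
      Real.norm_of_nonneg (Real.exp_pos _).le, Real.norm_of_nonneg (Real.exp_pos _).le]
    gcongr
  obtain ⟨N, hN⟩ := hκ
  obtain ⟨M, hM⟩ := hκ'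
  refine ⟨max N M, ?_⟩
  simp only [sub_mul]
  exact (mono (le_max_left _ _) hN).sub (mono (le_max_right _ _) hM)

theorem ExpIntegrable.integrable_mul {κ h : ℝ → ℂ} (hκ : ExpIntegrable κ) (hr : Rapid h)
    (hm : AEStronglyMeasurable h) : Integrable fun x => κ x * h x := by
  have hm' := hκ.aestronglyMeasurable
  obtain ⟨N, hN⟩ := hκ
  obtain ⟨C, hC, h'⟩ := hr N
  refine (hN.norm.const_mul C).mono' (hm'.mul hm) (Eventually.of_forall fun x => ?_)
  rw [norm_mul, norm_mul, Complex.norm_real, Real.norm_of_nonneg (Real.exp_pos _).le]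
  calc _ ≤ ‖κ x‖ * (C * Real.exp (-N * |x|)) := by gcongr; exact h' x
    _ = _ := by ring

theorem ExpIntegrable.tendsto_integral {κ : ℝ → ℂ} (hκ : ExpIntegrable κ) {A : ℕ → ℝ → ℂ}
    {B : ℝ → ℂ} (hm : ∀ n, AEStronglyMeasurable (A n))
    (hb : ∀ N : ℝ, ∃ C : ℝ, 0 ≤ C ∧ ∀ n x, ‖A n x‖ ≤ C * Real.exp (-N * |x|))
    (hl : ∀ᵐ x, Tendsto (fun n => A n x) atTop (𝓝 (B x))) :
    Tendsto (fun n => ∫ x, κ x * A n x) atTop (𝓝 (∫ x, κ x * B x)) := by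
  have hm' := hκ.aestronglyMeasurable
  obtain ⟨N, hN⟩ := hκ
  obtain ⟨C, hC, h'⟩ := hb N
  refine tendsto_integral_of_dominated_convergence
    (fun x => C * ‖κ x * (Real.exp (-N * |x|) : ℂ)‖) (fun n => hm'.mul (hm n))
    (hN.norm.const_mul C) (fun n => Eventually.of_forall fun x => ?_) ?_
  · rw [norm_mul, norm_mul, Complex.norm_real, Real.norm_of_nonneg (Real.exp_pos _).le]
    calc _ ≤ ‖κ x‖ * (C * Real.exp (-N * |x|)) := by gcongr; exact h' n x
      _ = _ := by ring
  · filter_upwards [hl] with x hx using hx.const_mul _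

theorem expIntegrable_of_memLp {k : ℝ → ℂ} (hk : MemLp k 2) : ExpIntegrable k := by
  refine ⟨1, ?_⟩
  have h : MemLp (fun x : ℝ => (Real.exp (-1 * |x|) : ℂ)) 2 := by
    have hc : Continuous fun x : ℝ => (Real.exp (-1 * |x|) : ℂ) := by fun_prop
    rw [memLp_two_iff_integrable_sq_norm hc.aestronglyMeasurable]
    refine (integrable_exp_neg_mul_abs two_pos).congr (Eventually.of_forall fun x => ?_)
    change _ = ‖(Real.exp (-1 * |x|) : ℂ)‖ ^ 2
    rw [Complex.norm_real, Real.norm_of_nonneg (Real.exp_pos _).le, ← Real.exp_nat_mul]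
    push_cast
    ring_nf
  exact hk.integrable_mul h

theorem expIntegrable_conj (k : H) : ExpIntegrable fun x => (starRingEnd ℂ) (k x) :=
  expIntegrable_of_memLp (Lp.memLp k).star

/-- A function that annihilates `Dom` vanishes almost everywhere. -/
theorem ExpIntegrable.ae_eq_zero {κ : ℝ → ℂ} (hκ : ExpIntegrable κ)
    (h0 : ∀ f : Dom, ∫ x : ℝ, κ x * f.1 x = 0) : ∀ᵐ x : ℝ, κ x = 0 := by
  have hall : ∀ h : ℝ → ℂ, Continuous h → Rapid h → ∫ x : ℝ, κ x * h x = 0 := by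
    intro h hc hr
    have hl := hκ.tendsto_integral (A := fun n x => ∫ t : ℝ, gauss n (x - t) * h t) (B := h)
      (fun n => (continuous_dom_ofReal (gaussConv n h hc hr)).aestronglyMeasurable)
      (norm_integral_gauss_mul_le hr)
      (Eventually.of_forall fun x => tendsto_integral_gauss_mul hc hr x)
    refine tendsto_nhds_unique (hl.congr fun n => ?_) tendsto_const_nhds
    exact h0 (gaussConv n h hc hr)
  obtain ⟨N, hN⟩ := hκ
  have key := ae_eq_zero_of_integral_contDiff_smul_eq_zero hN.locallyIntegrable
    (fun g hg hs => by
      have hc : Continuous fun x : ℝ => (Real.exp (-N * |x|) : ℂ) * (g x : ℂ) := by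
        have := hg.continuous
        fun_prop
      have hr : Rapid fun x : ℝ => (Real.exp (-N * |x|) : ℂ) * (g x : ℂ) := by
        intro M
        have hcs : HasCompactSupport fun x : ℝ =>
            (Real.exp (M * |x|) : ℂ) * ((Real.exp (-N * |x|) : ℂ) * (g x : ℂ)) := by
          refine hs.mono fun x hx => ?_
          rw [Function.mem_support] at hx ⊢
          rintro h
          simp [h] at hx
        obtain ⟨C, hC⟩ := hcs.exists_bound_of_continuous (by fun_prop)
        refine ⟨C, (norm_nonneg _).trans (hC 0), fun x => ?_⟩
        have := hC x
        rw [norm_mul, Complex.norm_real, Real.norm_of_nonneg (Real.exp_pos _).le] at this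
        rw [neg_mul, Real.exp_neg, ← div_eq_mul_inv, le_div_iff₀ (Real.exp_pos _), mul_comm]
        exact this
      rw [← hall _ hc hr]
      congr 1
      ext x
      rw [Complex.real_smul]
      ring)
  filter_upwards [key] with x hx
  simpa [Complex.exp_ne_zero] using hx

end GaussianRegularization

section FourierTransform

open Filter Topology Set
open scoped FourierTransform SchwartzMap

/-! ### The Fourier transform -/

/-- The Fourier transform of a rapidly decreasing function at a complex argument. -/
noncomputable def fourierC (h : ℝ → ℂ) (z : ℂ) : ℂ :=
  ∫ t : ℝ, Complex.exp (-(2 * Real.pi * Complex.I * z * t)) * h t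

theorem fourierC_ofReal (h : ℝ → ℂ) (x : ℝ) : fourierC h x = 𝓕 h x := by
  rw [Real.fourier_real_eq_integral_exp_smul, fourierC]
  congr 1
  ext t
  rw [smul_eq_mul]
  congr 2
  push_cast
  ring

theorem norm_fourier_kernel (z : ℂ) (t : ℝ) :
    ‖Complex.exp (-(2 * Real.pi * Complex.I * z * t))‖ = Real.exp (2 * Real.pi * z.im * t) := by
  rw [Complex.norm_exp]
  congr 1
  simp

theorem tempered_exp (c : ℂ) : Tempered fun z => Complex.exp (c * z) := by
  refine ⟨by fun_prop, fun R =>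
    ⟨Real.exp (|c.im| * R), |c.re|, (Real.exp_pos _).le, fun z hz => ?_⟩⟩
  rw [Complex.norm_exp, ← Real.exp_add, Complex.mul_re]
  refine Real.exp_le_exp.2 ?_
  have h1 : c.re * z.re ≤ |c.re| * |z.re| := by rw [← abs_mul]; exact le_abs_self _
  have h2 : -(c.im * z.im) ≤ |c.im| * |z.im| := by rw [← abs_mul]; exact neg_le_abs _
  have h3 : |c.im| * |z.im| ≤ |c.im| * R := by gcongr
  linarith

theorem Tempered.comp_add {a : ℂ → ℂ} (ha : Tempered a) (w : ℂ) : Tempered fun z => a (z + w) := by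
  refine ⟨ha.1.comp (by fun_prop), fun R => ?_⟩
  obtain ⟨C, N, hC, h⟩ := ha.2 (R + |w.im|)
  refine ⟨C * Real.exp (|N| * |w.re|), |N|, by positivity, fun z hz => ?_⟩
  have h1 : |(z + w).im| ≤ R + |w.im| := by
    rw [Complex.add_im]; exact (abs_add_le _ _).trans (by linarith)
  refine (h _ h1).trans ?_
  rw [mul_assoc, ← Real.exp_add]
  gcongr
  have h2 : |(z + w).re| ≤ |z.re| + |w.re| := by rw [Complex.add_re]; exact abs_add_le _ _
  have h3 := mul_le_mul_of_nonneg_left h2 (abs_nonneg N)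
  have h4 := mul_le_mul_of_nonneg_right (le_abs_self N) (abs_nonneg (z + w).re)
  linarith

theorem Tempered.conj {a : ℂ → ℂ} (ha : Tempered a) :
    Tempered fun z => (starRingEnd ℂ) (a ((starRingEnd ℂ) z)) := by
  refine ⟨fun z => ?_, fun R => ?_⟩
  · have h := DifferentiableAt.conj_conj (f := a) (ha.1 ((starRingEnd ℂ) z))
    rw [Complex.conj_conj] at h
    exact h
  · obtain ⟨C, N, hC, h⟩ := ha.2 R
    refine ⟨C, N, hC, fun z hz => ?_⟩
    have := h ((starRingEnd ℂ) z) (by simpa using hz)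
    simpa using this

theorem tempered_fourierC {h : ℝ → ℂ} (hc : Continuous h) (hr : Rapid h) :
    Tempered (fourierC h) := by
  have hb : ∀ R : ℝ, ∃ C : ℝ, 0 ≤ C ∧ ∀ z : ℂ, |z.im| ≤ R → ∀ t : ℝ,
      ‖Complex.exp (-(2 * Real.pi * Complex.I * z * t)) * h t‖ ≤ C * Real.exp (-1 * |t|) := by
    intro R
    obtain ⟨C, hC, h'⟩ := hr (2 * Real.pi * R + 1)
    refine ⟨C, hC, fun z hz t => ?_⟩
    rw [norm_mul, norm_fourier_kernel]
    have h1 : Real.exp (2 * Real.pi * z.im * t) ≤ Real.exp (2 * Real.pi * R * |t|) := by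
      refine Real.exp_le_exp.2 ?_
      calc 2 * Real.pi * z.im * t ≤ |2 * Real.pi * z.im * t| := le_abs_self _
        _ = 2 * Real.pi * |z.im| * |t| := by
            rw [abs_mul, abs_mul, abs_of_pos (by positivity : 0 < 2 * Real.pi)]
        _ ≤ _ := by gcongr
    calc _ ≤ Real.exp (2 * Real.pi * R * |t|) *
          (C * Real.exp (-(2 * Real.pi * R + 1) * |t|)) := by
          gcongr; exact h' t
      _ = C * (Real.exp (2 * Real.pi * R * |t|) * Real.exp (-(2 * Real.pi * R + 1) * |t|)) := by
          ring
      _ = _ := by rw [← Real.exp_add]; ring_nf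
  refine ⟨?_, fun R => ?_⟩
  · rw [← differentiableOn_univ]
    refine differentiableOn_integral isOpen_univ
      (fun z _ => Continuous.aestronglyMeasurable (by fun_prop)) (fun t => ?_) fun z₀ _ => ?_
    · exact Differentiable.differentiableOn (by fun_prop)
    · obtain ⟨C, hC, hb'⟩ := hb (|z₀.im| + 1)
      refine ⟨fun t => C * Real.exp (-1 * |t|),
        (integrable_exp_neg_mul_abs one_pos).const_mul C, ?_⟩
      have c1 : Continuous fun z : ℂ => |z.im| := by fun_prop
      filter_upwards [c1.continuousAt.eventually_lt continuousAt_const (lt_add_one |z₀.im|)]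
        with z hz t
      exact hb' z hz.le t
  · obtain ⟨C, hC, hb'⟩ := hb R
    refine ⟨∫ t : ℝ, C * Real.exp (-1 * |t|), 0, integral_nonneg fun t => by positivity,
      fun z hz => ?_⟩
    rw [zero_mul, Real.exp_zero, mul_one]
    exact norm_integral_le_of_norm_le ((integrable_exp_neg_mul_abs one_pos).const_mul _)
      (Eventually.of_forall (hb' z hz))

/-- The integral of a function in `Dom` is the same over all horizontal lines. -/
theorem integral_dom_shift (f : Dom) (η : ℝ) :
    ∫ t : ℝ, f.1 t = ∫ t : ℝ, f.1 (t + η * Complex.I) := by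
  have key : ∀ a b : ℝ, a ≤ b → ∫ t : ℝ, f.1 (t + a * Complex.I) =
      ∫ t : ℝ, f.1 (t + b * Complex.I) := by
    intro a b hab
    obtain ⟨C, -, hC⟩ := exists_bound f (max |a| |b|) 1
    exact integral_strip_shift hab one_pos f.2.1.continuous.continuousOn
      f.2.1.differentiableOn fun z hz => hC z (abs_le_max_abs_abs hz.1 hz.2)
  rcases le_total 0 η with h | h
  · simpa using key 0 η h
  · simpa using (key η 0 h).symm

/-- The decay of the Fourier transform, from a shift of the contour by `±|N|/2π`. -/
theorem norm_fourierC_dom_le (f : Dom) (R N : ℝ) : ∃ C : ℝ, ∀ z : ℂ, |z.im| ≤ R →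
    ‖fourierC (fun t => f.1 t) z‖ * Real.exp (N * |z.re|) ≤ C := by
  have hπ : 0 < 2 * Real.pi := by positivity
  -- On the line `Im t = η` the kernel gains the factor `exp (2π η Re z)`.
  set M := |N| / (2 * Real.pi) with hM
  have hMN : 2 * Real.pi * M = |N| := by rw [hM]; field_simp
  have hM0 : 0 ≤ M := by positivity
  obtain ⟨C, hC, h'⟩ := exists_bound f M (2 * Real.pi * R + 1)
  have hline : ∀ z : ℂ, |z.im| ≤ R → ∀ η : ℝ, |η| ≤ M → ‖fourierC (fun t => f.1 t) z‖ ≤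
      Real.exp (2 * Real.pi * z.re * η) * ∫ t : ℝ, C * Real.exp (-1 * |t|) := by
    intro z hz η hη
    have h1 := integral_dom_shift (mulDom _ (tempered_exp (-(2 * Real.pi * Complex.I * z))) f) η
    simp only [mulDom_apply] at h1
    have h2 : fourierC (fun t => f.1 t) z =
        ∫ t : ℝ, Complex.exp (-(2 * Real.pi * Complex.I * z) * (t + η * Complex.I)) *
          f.1 (t + η * Complex.I) := by
      rw [← h1, fourierC]
      congr 1
      ext t
      ring_nf
    rw [h2, ← integral_const_mul]
    refine norm_integral_le_of_norm_le
      (((integrable_exp_neg_mul_abs one_pos).const_mul _).const_mul _)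
      (Eventually.of_forall fun t => ?_)
    have e1 := h' (t + η * Complex.I) (by simpa using hη)
    have e2 : ((t : ℂ) + η * Complex.I).re = t := by simp
    rw [e2] at e1
    have e3 : ‖Complex.exp (-(2 * Real.pi * Complex.I * z) * (t + η * Complex.I))‖ =
        Real.exp (2 * Real.pi * z.re * η) * Real.exp (2 * Real.pi * z.im * t) := by
      rw [Complex.norm_exp, ← Real.exp_add]
      congr 1
      simp
    have e4 : Real.exp (2 * Real.pi * z.im * t) ≤ Real.exp (2 * Real.pi * R * |t|) := by
      refine Real.exp_le_exp.2 ?_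
      calc 2 * Real.pi * z.im * t ≤ |2 * Real.pi * z.im * t| := le_abs_self _
        _ = 2 * Real.pi * |z.im| * |t| := by
            rw [abs_mul, abs_mul, abs_of_pos (by positivity : 0 < 2 * Real.pi)]
        _ ≤ _ := by gcongr
    rw [norm_mul, e3]
    calc _ ≤ Real.exp (2 * Real.pi * z.re * η) * Real.exp (2 * Real.pi * R * |t|) *
          (C * Real.exp (-(2 * Real.pi * R + 1) * |t|)) := by gcongr
      _ = Real.exp (2 * Real.pi * z.re * η) * (C * (Real.exp (2 * Real.pi * R * |t|) *
          Real.exp (-(2 * Real.pi * R + 1) * |t|))) := by ring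
      _ = _ := by rw [← Real.exp_add]; ring_nf
  have hI : 0 ≤ ∫ t : ℝ, C * Real.exp (-1 * |t|) := integral_nonneg fun t => by positivity
  refine ⟨∫ t : ℝ, C * Real.exp (-1 * |t|), fun z hz => ?_⟩
  have hη : ∃ η : ℝ, |η| ≤ M ∧ 2 * Real.pi * z.re * η = -|N| * |z.re| := by
    rcases abs_cases z.re with ⟨h, _⟩ | ⟨h, _⟩
    · exact ⟨-M, by rw [abs_neg, abs_of_nonneg hM0], by rw [h, ← hMN]; ring⟩
    · exact ⟨M, by rw [abs_of_nonneg hM0], by rw [h, ← hMN]; ring⟩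
  obtain ⟨η, hη1, hη2⟩ := hη
  have h1 := hline z hz η hη1
  rw [hη2] at h1
  calc _ ≤ Real.exp (-|N| * |z.re|) * (∫ t : ℝ, C * Real.exp (-1 * |t|)) *
        Real.exp (N * |z.re|) := by gcongr
    _ = Real.exp (-|N| * |z.re| + N * |z.re|) * ∫ t : ℝ, C * Real.exp (-1 * |t|) := by
        rw [Real.exp_add]; ring
    _ ≤ 1 * ∫ t : ℝ, C * Real.exp (-1 * |t|) := by
        gcongr
        rw [Real.exp_le_one_iff]
        nlinarith [mul_le_mul_of_nonneg_right (le_abs_self N) (abs_nonneg z.re)]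
    _ = _ := one_mul _

/-- On `L¹ ∩ L²` the Fourier transform of `L²(ℝ)` is given by the Fourier integral. -/
theorem F_toLp_ae_eq {h : ℝ → ℂ} (h2 : MemLp h 2) (h1 : Integrable h) :
    F (h2.toLp h) =ᵐ[volume] fun x : ℝ => fourierC h x := by
  have e : ∀ x : ℝ, fourierC h x = 𝓕 h x := fourierC_ofReal h
  simp only [e]
  have hcont : Continuous (𝓕 h) :=
    VectorFourier.fourierIntegral_continuous Real.continuous_fourierChar (by fun_prop) h1
  -- Against a test function, the left side is given by the Fourier transform of tempered
  -- distributions, and the right side by the self-adjointness of the Fourier integral.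
  refine ae_eq_of_integral_contDiff_smul_eq
    ((Lp.memLp (F (h2.toLp h))).locallyIntegrable (by norm_num)) hcont.locallyIntegrable ?_
  intro g hg hs
  have hg' : ContDiff ℝ ((⊤ : ℕ∞) : WithTop ℕ∞) fun x : ℝ => (g x : ℂ) :=
    Complex.ofRealCLM.contDiff.comp hg
  have hs' : HasCompactSupport fun x : ℝ => (g x : ℂ) :=
    hs.comp_left Complex.ofReal_zero
  set s : 𝓢(ℝ, ℂ) := hs'.toSchwartzMap hg' with hsdef
  have hsx : ∀ x, s x = g x := fun x => rfl
  have k1 := congrArg (fun T : 𝓢'(ℝ, ℂ) => T s)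
    (Lp.fourier_toTemperedDistribution_eq (h2.toLp h))
  simp only [TemperedDistribution.fourier_apply, Lp.toTemperedDistribution_apply] at k1
  have k2 : ∫ x : ℝ, g x • F (h2.toLp h) x = ∫ x : ℝ, (𝓕 s : 𝓢(ℝ, ℂ)) x • h x := by
    have : ∫ x : ℝ, g x • F (h2.toLp h) x = ∫ x : ℝ, s x • (F (h2.toLp h)) x := by
      congr 1
    rw [this]
    refine k1.symm.trans (integral_congr_ae ?_)
    filter_upwards [h2.coeFn_toLp] with x hx
    rw [hx]
  have k3 := VectorFourier.integral_fourierIntegral_smul_eq_flip (μ := volume) (ν := volume)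
    (L := innerₗ ℝ) Real.continuous_fourierChar (by fun_prop) s.integrable h1
  rw [k2]
  have k4 : ∫ x : ℝ, (𝓕 s : 𝓢(ℝ, ℂ)) x • h x = ∫ x : ℝ, s x • 𝓕 h x := by
    rw [SchwartzMap.fourier_coe]
    refine k3.trans ?_
    rw [flip_innerₗ]
    rfl
  rw [k4]
  congr 1

/-- The Fourier transform preserves `Dom`. -/
noncomputable def fourierDom (f : Dom) : Dom :=
  ⟨fourierC fun t => f.1 t,
    (tempered_fourierC (continuous_dom_ofReal f) (rapid_dom f)).1, norm_fourierC_dom_le f⟩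

theorem fourierDom_apply (f : Dom) (z : ℂ) :
    (fourierDom f).1 z = ∫ t : ℝ, Complex.exp (-(2 * Real.pi * Complex.I * z * t)) * f.1 t := rfl

theorem toH_ae_eq (f : Dom) : toH f =ᵐ[volume] fun x : ℝ => f.1 x := (memLp_dom f).coeFn_toLp

theorem F_toH (f : Dom) : F (toH f) = toH (fourierDom f) := by
  apply Lp.ext
  refine (F_toLp_ae_eq (memLp_dom f) ((rapid_dom f).integrable
    (continuous_dom_ofReal f).aestronglyMeasurable)).trans ?_
  exact (toH_ae_eq (fourierDom f)).symm

theorem ext_ofReal {f g : Dom} (h : ∀ x : ℝ, f.1 x = g.1 x) : f = g := by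
  apply toH_injective
  apply Lp.ext
  filter_upwards [toH_ae_eq f, toH_ae_eq g] with x h1 h2
  rw [h1, h2, h]

theorem fourierDom_surjective : Function.Surjective fourierDom := by
  intro g
  let f : Dom := ⟨fun z => (fourierDom g).1 (-z), by
    refine ⟨(fourierDom g).2.1.comp differentiable_neg, fun R N => ?_⟩
    obtain ⟨C, hC⟩ := (fourierDom g).2.2 R N
    exact ⟨C, fun z hz => by simpa using hC (-z) (by simpa using hz)⟩⟩
  have hf : (fun x : ℝ => f.1 x) = 𝓕⁻ (fun x : ℝ => g.1 x) := by
    ext x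
    rw [Real.fourierInv_eq_fourier_neg, ← fourierC_ofReal]
    change (fourierDom g).1 (-x) = _
    rw [Complex.ofReal_neg]
    rfl
  have hfi : Integrable fun x : ℝ => f.1 x :=
    (rapid_dom f).integrable (continuous_dom_ofReal f).aestronglyMeasurable
  have hgi : Integrable fun x : ℝ => g.1 x :=
    (rapid_dom g).integrable (continuous_dom_ofReal g).aestronglyMeasurable
  have hgF : Integrable (𝓕 fun x : ℝ => g.1 x) := by
    have h := (rapid_dom (fourierDom g)).integrable
      (continuous_dom_ofReal (fourierDom g)).aestronglyMeasurable
    refine h.congr (Eventually.of_forall fun x => ?_)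
    exact fourierC_ofReal _ x
  refine ⟨f, ext_ofReal fun x => ?_⟩
  change fourierC (fun t => f.1 t) x = _
  rw [fourierC_ofReal, hf, (continuous_dom_ofReal g).fourier_fourierInv_eq hgi hgF]

/-- The Fourier transform carries `U` to `V⁻¹`. -/
theorem fourierDom_U {τ : ℝ} (hτ : 0 < τ) (f : Dom) :
    fourierDom ((U τ : Module.End ℂ Dom) f) = (↑(V τ)⁻¹ : Module.End ℂ Dom) (fourierDom f) := by
  refine ext_ofReal fun x => ?_
  rw [V_inv_apply, fourierDom_apply, fourierDom_apply]
  congr 1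
  ext t
  rw [U_apply hτ, ← mul_assoc, ← Complex.exp_add]
  congr 2
  linear_combination (-(2 * Real.pi * t * Real.sqrt τ)) * Complex.I_sq

/-- The Fourier transform carries `V` to `U`. -/
theorem fourierDom_V {τ : ℝ} (hτ : 0 < τ) (f : Dom) :
    fourierDom ((V τ : Module.End ℂ Dom) f) = (U τ : Module.End ℂ Dom) (fourierDom f) := by
  refine ext_ofReal fun x => ?_
  rw [U_apply hτ, fourierDom_apply, fourierDom_apply]
  have h := integral_dom_shift (mulDom _ (tempered_exp (-(2 * Real.pi * Complex.I * x))) f)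
    (Real.sqrt τ)
  simp only [mulDom_apply] at h
  rw [show (∫ t : ℝ, Complex.exp (-(2 * Real.pi * Complex.I * x * t)) * f.1 t) =
    ∫ t : ℝ, Complex.exp (-(2 * Real.pi * Complex.I * x) * t) * f.1 t by
      congr 1; ext t; ring_nf, h, ← integral_const_mul]
  congr 1
  ext t
  rw [V_apply, ← mul_assoc, ← Complex.exp_add]
  congr 2
  linear_combination (2 * Real.pi * x * Real.sqrt τ) * Complex.I_sq

theorem fourierDom_add (f g : Dom) : fourierDom (f + g) = fourierDom f + fourierDom g := by
  apply toH_injective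
  rw [map_add, ← F_toH, ← F_toH, ← F_toH, map_add, map_add]

theorem fourierDom_smul (c : ℂ) (f : Dom) : fourierDom (c • f) = c • fourierDom f := by
  apply toH_injective
  rw [map_smul, ← F_toH, ← F_toH, map_smul, map_smul]

theorem fourierDom_U_inv {τ : ℝ} (hτ : 0 < τ) (f : Dom) :
    fourierDom ((↑(U τ)⁻¹ : Module.End ℂ Dom) f) = (V τ : Module.End ℂ Dom) (fourierDom f) := by
  have h := fourierDom_U hτ ((↑(U τ)⁻¹ : Module.End ℂ Dom) f)
  rw [← Module.End.mul_apply, Units.mul_inv, Module.End.one_apply] at h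
  rw [h, ← Module.End.mul_apply, Units.mul_inv, Module.End.one_apply]

theorem fourierDom_V_inv {τ : ℝ} (hτ : 0 < τ) (f : Dom) :
    fourierDom ((↑(V τ)⁻¹ : Module.End ℂ Dom) f) =
      (↑(U τ)⁻¹ : Module.End ℂ Dom) (fourierDom f) := by
  have h := fourierDom_V hτ ((↑(V τ)⁻¹ : Module.End ℂ Dom) f)
  rw [← Module.End.mul_apply, Units.mul_inv, Module.End.one_apply] at h
  rw [h, ← Module.End.mul_apply, Units.inv_mul, Module.End.one_apply]

end FourierTransform

section FirstOperator

open Filter Topology Set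

/-! ### The multiplication operator and its conjugates -/

theorem inner_eq_integral (f g : H) : (inner ℂ f g : ℂ) = ∫ x, (starRingEnd ℂ) (f x) * g x := by
  rw [L2.inner_def]
  congr 1
  ext x
  rw [RCLike.inner_apply, mul_comm]

theorem inner_toH (k : H) (f : Dom) :
    (inner ℂ k (toH f) : ℂ) = ∫ x : ℝ, (starRingEnd ℂ) (k x) * f.1 x := by
  rw [inner_eq_integral]
  refine integral_congr_ae ?_
  filter_upwards [toH_ae_eq f] with x hx
  rw [hx]

theorem K_ae_eq (τ : ℝ) (f : H) : K τ f =ᵐ[volume] fun x => gamma τ x * f x :=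
  (memLp_mul (measurable_gamma τ) (norm_gamma τ) f).coeFn_toLp

theorem S_toH_ae_eq (τ : ℝ) (f : Dom) :
    S τ (toH f) =ᵐ[volume] fun x : ℝ => gamma τ x * (fourierDom f).1 x := by
  change K τ (F (toH f)) =ᵐ[volume] _
  rw [F_toH]
  filter_upwards [K_ae_eq τ (toH (fourierDom f)), toH_ae_eq (fourierDom f)] with x h1 h2
  rw [h1, h2]

theorem inner_S_toH (τ : ℝ) (k : H) (f : Dom) : (inner ℂ k (S τ (toH f)) : ℂ) =
    ∫ x : ℝ, (starRingEnd ℂ) (k x) * (gamma τ x * (fourierDom f).1 x) := by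
  rw [inner_eq_integral]
  refine integral_congr_ae ?_
  filter_upwards [S_toH_ae_eq τ f] with x hx
  rw [hx]

/-- The multiples of `Dom` by a nowhere vanishing function `w` are total in `L²(ℝ)`. -/
theorem eq_zero_of_integral_eq_zero {k : H} {w : ℝ → ℂ}
    (hκ : ExpIntegrable fun x => (starRingEnd ℂ) (k x) * w x) (hw : ∀ x, w x ≠ 0)
    (h0 : ∀ f : Dom, ∫ x : ℝ, (starRingEnd ℂ) (k x) * w x * f.1 x = 0) : k = 0 := by
  apply Lp.ext
  filter_upwards [hκ.ae_eq_zero h0, Lp.coeFn_zero ℂ 2 (volume : Measure ℝ)] with x h1 h2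
  rw [h2]
  simpa [hw x] using h1

theorem dense_range_toH : Dense (LinearMap.range toH : Set H) := by
  rw [Submodule.dense_iff_topologicalClosure_eq_top, Submodule.topologicalClosure_eq_top_iff,
    Submodule.eq_bot_iff]
  intro k hk
  rw [Submodule.mem_orthogonal'] at hk
  refine eq_zero_of_integral_eq_zero (w := fun _ => 1) ?_ (fun _ => one_ne_zero) fun f => ?_
  · simpa using expIntegrable_conj k
  · rw [← hk _ ⟨f, rfl⟩, inner_toH]
    simp

/-- The multiplier of `U` on the real line. -/
noncomputable def weight (τ x : ℝ) : ℝ := Real.exp (-(2 * Real.pi * Real.sqrt τ * x))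

theorem weight_pos (τ x : ℝ) : 0 < weight τ x := Real.exp_pos _

theorem continuous_weight (τ : ℝ) : Continuous (weight τ) := by unfold weight; fun_prop

theorem weight_le (τ x : ℝ) : weight τ x ≤ Real.exp (2 * Real.pi * Real.sqrt τ * |x|) := by
  refine Real.exp_le_exp.2 ?_
  rw [← mul_neg]
  gcongr
  exact neg_le_abs x

theorem inv_weight_le (τ x : ℝ) :
    (weight τ x)⁻¹ ≤ Real.exp (2 * Real.pi * Real.sqrt τ * |x|) := by
  rw [weight, Real.exp_neg, inv_inv]
  refine Real.exp_le_exp.2 ?_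
  gcongr
  exact le_abs_self x

theorem U_apply_ofReal {τ : ℝ} (hτ : 0 < τ) (f : Dom) (x : ℝ) :
    ((U τ : Module.End ℂ Dom) f).1 x = weight τ x * f.1 x := by
  rw [U_apply hτ, weight]
  push_cast
  rfl

theorem U_inv_apply_ofReal {τ : ℝ} (hτ : 0 < τ) (f : Dom) (x : ℝ) :
    ((↑(U τ)⁻¹ : Module.End ℂ Dom) f).1 x = (weight τ x : ℂ)⁻¹ * f.1 x := by
  rw [U_inv_apply hτ, weight]
  push_cast
  rw [← Complex.exp_neg, neg_neg]

theorem one_add_weight_ne_zero (τ x : ℝ) : (1 : ℂ) + weight τ x ≠ 0 := by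
  have : (1 : ℝ) + weight τ x ≠ 0 := by linarith [weight_pos τ x]
  exact_mod_cast this

theorem expIntegrable_mul_one_add {τ : ℝ} {κ : ℝ → ℂ} (hκ : ExpIntegrable κ) (c : ℂ) :
    ExpIntegrable fun x => κ x * (1 + c * weight τ x) := by
  have := continuous_weight τ
  refine hκ.mul_of_le (by fun_prop) (C := 1 + ‖c‖) (M := 2 * Real.pi * Real.sqrt τ) fun x => ?_
  have h0 : 1 ≤ Real.exp (2 * Real.pi * Real.sqrt τ * |x|) := Real.one_le_exp (by positivity)
  calc _ ≤ ‖(1 : ℂ)‖ + ‖c * weight τ x‖ := norm_add_le _ _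
    _ = 1 + ‖c‖ * weight τ x := by
        rw [norm_one, norm_mul, Complex.norm_real, Real.norm_of_nonneg (weight_pos τ x).le]
    _ ≤ 1 * Real.exp (2 * Real.pi * Real.sqrt τ * |x|) +
        ‖c‖ * Real.exp (2 * Real.pi * Real.sqrt τ * |x|) := by
        gcongr
        · linarith
        · exact weight_le τ x
    _ = _ := by ring

theorem expIntegrable_mul_one_add_weight (τ : ℝ) {κ : ℝ → ℂ} (hκ : ExpIntegrable κ) :
    ExpIntegrable fun x => κ x * (1 + weight τ x) := by
  simpa only [one_mul] using expIntegrable_mul_one_add (τ := τ) hκ 1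

/-- The closure of a restriction `A` of a nonnegative self-adjoint operator `T` is `T`, provided
that `1 + A` has dense range. -/
theorem eq_closure_of_dense {A T : H →ₗ.[ℂ] H} (hd : Dense (A.domain : Set H))
    (hT : IsSelfAdjoint T) (hpos : ∀ p ∈ T.graph, 0 ≤ (inner ℂ p.1 p.2 : ℂ).re) (hle : A ≤ T)
    (hdense : ∀ k, (∀ p ∈ A.graph, inner ℂ k (p.1 + p.2) = (0 : ℂ)) → k = 0) : T = A.closure := by
  have hg := LinearPMap.le_graph_iff.2 hle
  refine eq_closure_of_le hT (isSelfAdjoint_closure hd (fun p hp r hr => ?_)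
    (fun p hp => hpos p (hg hp)) hdense).2 hle
  have h := hg hr
  rw [← graph_adjoint_eq_of_isSelfAdjoint hT, Submodule.mem_adjoint_iff] at h
  exact sub_eq_zero.1 (h p.1 p.2 (hg hp))

theorem closure_onH_U {τ : ℝ} (hτ : 0 < τ) :
    (onH (U τ)).IsClosable ∧ IsSelfAdjoint (onH (U τ)).closure := by
  have e : ∀ f g : Dom, (inner ℂ (toH f) (toH ((U τ : Module.End ℂ Dom) g)) : ℂ) =
      ∫ x : ℝ, weight τ x * ((starRingEnd ℂ) (f.1 x) * g.1 x) := by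
    intro f g
    rw [inner_toH]
    refine integral_congr_ae ?_
    filter_upwards [toH_ae_eq f] with x hx
    rw [hx, U_apply_ofReal hτ]
    ring
  refine isSelfAdjoint_closure dense_range_toH ?_ ?_ ?_
  · intro p hp r hr
    obtain ⟨f, rfl⟩ := (mem_graph_onH _ _).1 hp
    obtain ⟨g, rfl⟩ := (mem_graph_onH _ _).1 hr
    rw [← inner_conj_symm, e, e, ← integral_conj]
    congr 1
    ext x
    simp only [map_mul, Complex.conj_ofReal, Complex.conj_conj]
    ring
  · intro p hp
    obtain ⟨f, rfl⟩ := (mem_graph_onH _ _).1 hp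
    have : (inner ℂ (toH f) (toH ((U τ : Module.End ℂ Dom) f)) : ℂ) =
        ((∫ x : ℝ, weight τ x * ‖f.1 x‖ ^ 2 : ℝ) : ℂ) := by
      rw [e, ← integral_complex_ofReal]
      congr 1
      ext x
      rw [mul_comm ((starRingEnd ℂ) _), Complex.mul_conj, Complex.normSq_eq_norm_sq]
      push_cast
      rfl
    rw [this, Complex.ofReal_re]
    exact integral_nonneg fun x => mul_nonneg (weight_pos τ x).le (by positivity)
  · intro k hk
    refine eq_zero_of_integral_eq_zero (w := fun x => 1 + weight τ x)
      (expIntegrable_mul_one_add_weight τ (expIntegrable_conj k)) (one_add_weight_ne_zero τ)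
      fun f => ?_
    have h := hk _ ((mem_graph_onH _ _).2 ⟨f, rfl⟩)
    rw [← map_add, inner_toH] at h
    rw [← h]
    congr 1
    ext x
    change _ = _ * (f.1 x + ((U τ : Module.End ℂ Dom) f).1 x)
    rw [U_apply_ofReal hτ]
    ring

/-- The closure of `U` is the maximal multiplication operator. -/
theorem mem_graph_closure_onH_U {τ : ℝ} (hτ : 0 < τ) (x y : H) :
    (x, y) ∈ (onH (U τ)).closure.graph ↔ ∀ᵐ t, y t = weight τ t * x t := by
  rw [mem_graph_closure_iff (closure_onH_U hτ).2 (closure_onH_U hτ).1]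
  have e1 : ∀ f : Dom, (inner ℂ (toH ((U τ : Module.End ℂ Dom) f)) x : ℂ) =
      (starRingEnd ℂ) (∫ t : ℝ, (starRingEnd ℂ) (x t) * (weight τ t) * f.1 t) := by
    intro f
    rw [← inner_conj_symm, inner_toH]
    congr 2
    ext t
    rw [U_apply_ofReal hτ]
    ring
  have e2 : ∀ f : Dom, (inner ℂ (toH f) y : ℂ) =
      (starRingEnd ℂ) (∫ t : ℝ, (starRingEnd ℂ) (y t) * f.1 t) := by
    intro f
    rw [← inner_conj_symm, inner_toH]
  have hw := continuous_weight τ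
  have hk : ExpIntegrable fun t => (starRingEnd ℂ) (x t) * (weight τ t : ℂ) :=
    (expIntegrable_conj x).mul_of_le (by fun_prop) (C := 1) (M := 2 * Real.pi * Real.sqrt τ)
      fun t => by
        rw [Complex.norm_real, Real.norm_of_nonneg (weight_pos τ t).le, one_mul]
        exact weight_le τ t
  constructor
  · intro h
    have h0 := (hk.sub (expIntegrable_conj y)).ae_eq_zero fun f => by
      have h1 := h _ ((mem_graph_onH _ _).2 ⟨f, rfl⟩)
      dsimp only at h1
      rw [e1, e2] at h1
      simp only [sub_mul]
      rw [integral_sub (hk.integrable_mul (rapid_dom f)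
          (continuous_dom_ofReal f).aestronglyMeasurable)
        ((expIntegrable_conj y).integrable_mul (rapid_dom f)
          (continuous_dom_ofReal f).aestronglyMeasurable), sub_eq_zero]
      exact (starRingEnd ℂ).injective h1
    filter_upwards [h0] with t ht
    have := congrArg (starRingEnd ℂ) (sub_eq_zero.1 ht)
    rw [map_mul, Complex.conj_conj, Complex.conj_conj, Complex.conj_ofReal] at this
    rw [← this, mul_comm]
  · intro h p hp
    obtain ⟨f, rfl⟩ := (mem_graph_onH _ _).1 hp
    dsimp only
    rw [e1, e2]
    congr 1
    refine integral_congr_ae ?_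
    filter_upwards [h] with t ht
    rw [ht, map_mul, Complex.conj_ofReal]
    ring

/-- The operator `Tᵢ`: the closure of `U`, conjugated by the `(i-1)`-st power of `S`. -/
noncomputable def opT (τ : ℝ) (i : ℤ) : H →ₗ.[ℂ] H :=
  conjOp (S τ ^ (i - 1)) (onH (U τ)).closure

theorem opT_one (τ : ℝ) : opT τ 1 = (onH (U τ)).closure := by
  rw [opT, sub_self, zpow_zero, conjOp_one]

theorem opT_add_one (τ : ℝ) (i : ℤ) : opT τ (i + 1) = conjOp (S τ) (opT τ i) := by
  rw [opT, opT, conjOp_conjOp, ← zpow_add_one]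
  congr 2
  ring

theorem mem_graph_opT_add_one (τ : ℝ) (i : ℤ) (x y : H) :
    (x, y) ∈ (opT τ (i + 1)).graph ↔ (S τ x, S τ y) ∈ (opT τ i).graph := by
  rw [opT_add_one, mem_graph_conjOp]

theorem isSelfAdjoint_opT {τ : ℝ} (hτ : 0 < τ) (i : ℤ) : IsSelfAdjoint (opT τ i) :=
  isSelfAdjoint_conjOp _ (closure_onH_U hτ).2

/-- The operators `Tᵢ` are nonnegative, like `U`. -/
theorem re_inner_opT_nonneg {τ : ℝ} (hτ : 0 < τ) (i : ℤ) (p : H × H) (hp : p ∈ (opT τ i).graph) :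
    0 ≤ (inner ℂ p.1 p.2 : ℂ).re := by
  obtain ⟨x, y⟩ := p
  rw [opT, mem_graph_conjOp, mem_graph_closure_onH_U hτ] at hp
  rw [← (S τ ^ (i - 1)).inner_map_map]
  set u := (S τ ^ (i - 1)) x
  have : (inner ℂ u ((S τ ^ (i - 1)) y) : ℂ) = ((∫ t : ℝ, weight τ t * ‖u t‖ ^ 2 : ℝ) : ℂ) := by
    rw [inner_eq_integral, ← integral_complex_ofReal]
    refine integral_congr_ae ?_
    filter_upwards [hp] with t ht
    rw [ht, mul_left_comm, mul_comm ((starRingEnd ℂ) _), Complex.mul_conj,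
      Complex.normSq_eq_norm_sq]
    push_cast
    rfl
  rw [this, Complex.ofReal_re]
  exact integral_nonneg fun x => mul_nonneg (weight_pos τ x).le (by positivity)

/-- A restriction `A` of `Tᵢ` is essentially self-adjoint if only `k = 0` is orthogonal to the
range of `1 + A`. -/
theorem opT_eq_closure {τ : ℝ} (hτ : 0 < τ) {i : ℤ} {A : Module.End ℂ Dom} (hle : onH A ≤ opT τ i)
    (hdense : ∀ k : H, (∀ f : Dom, ∫ x : ℝ, (starRingEnd ℂ) (k x) * (f.1 x + (A f).1 x) = 0) →
      k = 0) : opT τ i = (onH A).closure := by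
  refine eq_closure_of_dense dense_range_toH (isSelfAdjoint_opT hτ i)
    (re_inner_opT_nonneg hτ i) hle fun k hk => hdense k fun f => ?_
  have h := hk _ ((mem_graph_onH _ _).2 ⟨f, rfl⟩)
  rwa [← map_add, inner_toH] at h

/-- If `Tᵢ` is the closure of `A`, membership in its graph can be tested by pairing with
`A f`. -/
theorem mem_graph_opT_iff {τ : ℝ} (hτ : 0 < τ) {i : ℤ} {A : Module.End ℂ Dom}
    (h : opT τ i = (onH A).closure) (hle : onH A ≤ opT τ i) (x y : H) :
    (x, y) ∈ (opT τ i).graph ↔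
      ∀ f : Dom, (inner ℂ x (toH (A f)) : ℂ) = inner ℂ y (toH f) := by
  have hs := isSelfAdjoint_opT hτ i
  have hc := isClosable_of_le hs hle
  rw [h] at hs ⊢
  rw [mem_graph_closure_iff hs hc]
  constructor
  · intro h1 f
    have h2 := h1 _ ((mem_graph_onH _ _).2 ⟨f, rfl⟩)
    rw [← inner_conj_symm, h2, inner_conj_symm]
  · intro h1 p hp
    obtain ⟨f, rfl⟩ := (mem_graph_onH _ _).1 hp
    rw [← inner_conj_symm, h1, inner_conj_symm]

theorem onH_U_le (τ : ℝ) : onH (U τ) ≤ opT τ 1 := by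
  rw [opT_one]
  exact LinearPMap.le_closure _

theorem onH_V_le {τ : ℝ} (hτ : 0 < τ) : onH (V τ) ≤ opT τ 2 := by
  rw [onH_le_iff]
  intro f
  rw [show (2 : ℤ) = 1 + 1 by rfl, mem_graph_opT_add_one, opT_one, mem_graph_closure_onH_U hτ]
  filter_upwards [S_toH_ae_eq τ f, S_toH_ae_eq τ ((V τ : Module.End ℂ Dom) f)] with x h1 h2
  rw [h1, h2, fourierDom_V hτ, U_apply_ofReal hτ]
  ring

/-- The operator `S` transforms `1 + V` into the multiplication by `1 + weight`, times `γ`. -/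
theorem dense_one_add_V {τ : ℝ} (hτ : 0 < τ) (k : H)
    (h : ∀ f : Dom, ∫ x : ℝ, (starRingEnd ℂ) (k x) *
      (f.1 x + ((V τ : Module.End ℂ Dom) f).1 x) = 0) : k = 0 := by
  have hk : S τ k = 0 := by
    have hγ := continuous_gamma hτ
    have e1 : ExpIntegrable fun x => (starRingEnd ℂ) (S τ k x) * gamma τ x :=
      (expIntegrable_conj _).mul_of_le hγ (C := 1) (M := 0) fun x => by simp [norm_gamma]
    refine eq_zero_of_integral_eq_zero (w := fun x => gamma τ x * (1 + weight τ x)) ?_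
      (fun x => mul_ne_zero (gamma_ne_zero τ x) (one_add_weight_ne_zero τ x)) fun g => ?_
    · simpa [mul_assoc] using expIntegrable_mul_one_add_weight τ e1
    · obtain ⟨f, rfl⟩ := fourierDom_surjective g
      have h1 := h f
      change ∫ x : ℝ, (starRingEnd ℂ) (k x) * (f + (V τ : Module.End ℂ Dom) f).1 x = 0 at h1
      rw [← inner_toH, ← (S τ).inner_map_map, inner_S_toH, fourierDom_add, fourierDom_V hτ] at h1
      rw [← h1]
      congr 1
      ext x
      change _ = _ * (_ * ((fourierDom f).1 x + ((U τ : Module.End ℂ Dom) (fourierDom f)).1 x))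
      rw [U_apply_ofReal hτ]
      ring
  exact (S τ).map_eq_zero_iff.1 hk

theorem opT_two {τ : ℝ} (hτ : 0 < τ) : opT τ 2 = (onH (V τ)).closure :=
  opT_eq_closure hτ (onH_V_le hτ) (dense_one_add_V hτ)

end FirstOperator

section Extensions

open Filter Topology Set

/-! ### The operators `Tᵢ` extend `Xᵢ` -/

theorem q_sq (τ : ℝ) : q τ ^ 2 = Complex.exp (2 * Real.pi * τ * Complex.I) := by
  rw [q, ← Complex.exp_nat_mul]
  congr 1
  push_cast
  ring

/-- The relation `V U = q⁻² U V` for the multipliers. -/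
theorem exp_weight_add {τ : ℝ} (hτ : 0 < τ) (x : ℝ) :
    Complex.exp (-(2 * Real.pi * Real.sqrt τ * (x + Real.sqrt τ * Complex.I))) =
      (q τ ^ 2)⁻¹ * weight τ x := by
  have h2 : (Real.sqrt τ : ℂ) ^ 2 = τ := by exact_mod_cast Real.sq_sqrt hτ.le
  rw [q_sq, ← Complex.exp_neg, weight, Complex.ofReal_exp, ← Complex.exp_add]
  congr 1
  push_cast
  linear_combination (-2 * Real.pi * Complex.I) * h2

theorem exp_weight_sub {τ : ℝ} (hτ : 0 < τ) (x : ℝ) :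
    Complex.exp (-(2 * Real.pi * Real.sqrt τ * (x - Real.sqrt τ * Complex.I))) =
      q τ ^ 2 * weight τ x := by
  have h2 : (Real.sqrt τ : ℂ) ^ 2 = τ := by exact_mod_cast Real.sq_sqrt hτ.le
  rw [q_sq, weight, Complex.ofReal_exp, ← Complex.exp_add]
  congr 1
  push_cast
  linear_combination (2 * Real.pi * Complex.I) * h2

theorem one_add_smul_U_apply_ofReal {τ : ℝ} (hτ : 0 < τ) (c : ℂ) (f : Dom) (x : ℝ) :
    ((1 + c • (U τ : Module.End ℂ Dom)) f).1 x = (1 + c * weight τ x) * f.1 x := by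
  rw [one_add_smul_U_apply hτ, weight]
  push_cast
  rfl

theorem X3_apply {τ : ℝ} (hτ : 0 < τ) (f : Dom) (x : ℝ) : (X3 τ f).1 x =
    (weight τ x : ℂ)⁻¹ * (f.1 x + q τ * f.1 (x + Real.sqrt τ * Complex.I)) := by
  rw [X3, Module.End.mul_apply, U_inv_apply_ofReal hτ]
  change _ * (f.1 x + q τ * ((V τ : Module.End ℂ Dom) f).1 x) = _
  rw [V_apply]

theorem X4_apply {τ : ℝ} (hτ : 0 < τ) (f : Dom) (x : ℝ) : (X4 τ f).1 x =
    (weight τ x : ℂ)⁻¹ * (f.1 x +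
      (q τ)⁻¹ * ((1 + q τ * weight τ x) * f.1 (x - Real.sqrt τ * Complex.I))) := by
  rw [X4, Module.End.mul_apply, Module.End.mul_apply, U_inv_apply_ofReal hτ]
  set g := (↑(V τ)⁻¹ : Module.End ℂ Dom) f with hg
  change _ * ((q τ)⁻¹ * g.1 x + ((U τ : Module.End ℂ Dom) g).1 x +
    ((V τ : Module.End ℂ Dom) g).1 x) = _
  rw [U_apply_ofReal hτ, V_apply, hg, V_inv_apply, V_inv_apply, add_sub_cancel_right]
  have := q_ne_zero τ
  field_simp
  ring

theorem X5_apply {τ : ℝ} (hτ : 0 < τ) (f : Dom) (x : ℝ) : (X5 τ f).1 x =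
    (1 + q τ * weight τ x) * f.1 (x - Real.sqrt τ * Complex.I) := by
  rw [X5, Module.End.mul_apply, one_add_smul_U_apply_ofReal hτ, V_inv_apply]

/-- The Fourier transform carries `X₃` to `(1 + q⁻¹U) V`. -/
theorem fourierDom_X3_apply {τ : ℝ} (hτ : 0 < τ) (f : Dom) (x : ℝ) : (fourierDom (X3 τ f)).1 x =
    (1 + (q τ)⁻¹ * weight τ x) * (fourierDom f).1 (x + Real.sqrt τ * Complex.I) := by
  rw [X3, Module.End.mul_apply, fourierDom_U_inv hτ, V_apply]
  change (fourierDom (f + q τ • (V τ : Module.End ℂ Dom) f)).1 _ = _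
  rw [fourierDom_add, fourierDom_smul, fourierDom_V hτ]
  change (fourierDom f).1 _ + q τ * ((U τ : Module.End ℂ Dom) (fourierDom f)).1 _ = _
  rw [U_apply hτ, exp_weight_add hτ]
  have := q_ne_zero τ
  field_simp

/-- The Fourier transform carries `X₄` to `U⁻¹ + q U⁻¹ (1 + q⁻¹U) V`. -/
theorem fourierDom_X4_apply {τ : ℝ} (hτ : 0 < τ) (f : Dom) (x : ℝ) : (fourierDom (X4 τ f)).1 x =
    (weight τ x : ℂ)⁻¹ * ((fourierDom f).1 x + q τ * ((1 + (q τ)⁻¹ * weight τ x) *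
      (fourierDom f).1 (x + Real.sqrt τ * Complex.I))) := by
  have hw : (weight τ x : ℂ) ≠ 0 := by exact_mod_cast (weight_pos τ x).ne'
  have hq := q_ne_zero τ
  rw [X4, Module.End.mul_apply, Module.End.mul_apply, fourierDom_U_inv hτ, V_apply]
  set g := (↑(V τ)⁻¹ : Module.End ℂ Dom) f with hg
  change (fourierDom ((q τ)⁻¹ • g + (U τ : Module.End ℂ Dom) g +
    (V τ : Module.End ℂ Dom) g)).1 _ = _
  rw [fourierDom_add, fourierDom_add, fourierDom_smul, fourierDom_U hτ, fourierDom_V hτ, hg,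
    fourierDom_V_inv hτ]
  change (q τ)⁻¹ * ((↑(U τ)⁻¹ : Module.End ℂ Dom) (fourierDom f)).1 _ +
    ((↑(V τ)⁻¹ : Module.End ℂ Dom) ((↑(U τ)⁻¹ : Module.End ℂ Dom) (fourierDom f))).1 _ +
    ((U τ : Module.End ℂ Dom) ((↑(U τ)⁻¹ : Module.End ℂ Dom) (fourierDom f))).1 _ = _
  rw [V_inv_apply, add_sub_cancel_right, U_apply hτ, U_inv_apply hτ, U_inv_apply_ofReal hτ,
    exp_weight_add hτ, ← neg_neg (2 * Real.pi * Real.sqrt τ * (x + Real.sqrt τ * Complex.I)),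
    Complex.exp_neg, exp_weight_add hτ]
  field_simp
  ring

theorem inner_S_toH_left (τ : ℝ) (f g : Dom) : (inner ℂ (S τ (toH f)) (toH g) : ℂ) =
    ∫ x : ℝ, (gamma τ x)⁻¹ * ((starRingEnd ℂ) ((fourierDom f).1 x) * g.1 x) := by
  rw [inner_toH]
  refine integral_congr_ae ?_
  filter_upwards [S_toH_ae_eq τ f] with x hx
  rw [hx, map_mul, conj_gamma]
  ring

theorem conj_one_add (τ x : ℝ) :
    (starRingEnd ℂ) (1 + (q τ)⁻¹ * weight τ x) = 1 + q τ * weight τ x := by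
  rw [map_add, map_mul, map_inv₀, conj_q, inv_inv, Complex.conj_ofReal, map_one]

/-- The symmetry relation between `S X₃ f` and the closure `T₂` of `V` is
`integral_inv_gamma_mul` for the product of `V⁻¹` of the conjugate of `f̂` with the test
function. -/
theorem onH_X3_le {τ : ℝ} (hτ : 0 < τ) : onH (X3 τ) ≤ opT τ 3 := by
  rw [onH_le_iff]
  intro f
  rw [show (3 : ℤ) = 2 + 1 by rfl, mem_graph_opT_add_one,
    mem_graph_opT_iff hτ (opT_two hτ) (onH_V_le hτ)]
  intro φ
  rw [inner_S_toH_left, inner_S_toH_left]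
  have h := integral_inv_gamma_mul hτ (mulDom _ (tempered_dom
    ((↑(V τ)⁻¹ : Module.End ℂ Dom) (conjDom (fourierDom f)))) φ)
  refine Eq.trans ?_ (h.symm.trans ?_)
  · congr 1
    ext x
    rw [V_apply, V_apply, mulDom_apply, V_inv_apply, add_sub_cancel_right, conjDom_ofReal]
  · congr 1
    ext x
    rw [one_add_smul_U_apply_ofReal hτ, mulDom_apply, V_inv_apply, conjDom_apply,
      fourierDom_X3_apply hτ, map_mul, conj_one_add]
    simp [mul_assoc]

/-- The relation between `T₀` and `T₁` is read backwards: the preimages under `S` of `f` and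
`X₅ f` are tested on the closure `T₁` of `U`. -/
theorem onH_X5_le {τ : ℝ} (hτ : 0 < τ) : onH (X5 τ) ≤ opT τ 0 := by
  rw [onH_le_iff]
  intro f
  have h0 : ((S τ).symm (toH f), (S τ).symm (toH (X5 τ f))) ∈ (opT τ (0 + 1)).graph := by
    rw [zero_add, mem_graph_opT_iff hτ (opT_one τ) (onH_U_le τ)]
    intro φ
    rw [← (S τ).inner_map_map, ← (S τ).inner_map_map ((S τ).symm (toH (X5 τ f))),
      (S τ).apply_symm_apply, (S τ).apply_symm_apply, inner_S_toH, inner_S_toH, fourierDom_U hτ]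
    have h := integral_gamma_mul hτ (mulDom _ (tempered_dom
      ((↑(V τ) : Module.End ℂ Dom) (conjDom f))) (fourierDom φ))
    refine Eq.trans ?_ (h.symm.trans ?_)
    · refine integral_congr_ae ?_
      filter_upwards [toH_ae_eq f] with x hx
      rw [hx, V_inv_apply, V_inv_apply, mulDom_apply, V_apply, sub_add_cancel, conjDom_ofReal]
      ring
    · refine integral_congr_ae ?_
      filter_upwards [toH_ae_eq (X5 τ f)] with x hx
      rw [hx, one_add_smul_U_apply_ofReal hτ, mulDom_apply, V_apply, conjDom_apply,
        X5_apply hτ, map_mul, ← conj_one_add, Complex.conj_conj]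
      simp [sub_eq_add_neg]
      ring
  rw [mem_graph_opT_add_one, (S τ).apply_symm_apply, (S τ).apply_symm_apply] at h0
  exact h0

theorem rapid_gamma_mul (τ : ℝ) (g : Dom) : Rapid fun x => gamma τ x * g.1 x := by
  refine (rapid_dom g).mul_of_le zero_le_one (M := 0) fun x => ?_
  simp [norm_gamma]

theorem continuous_gamma_mul {τ : ℝ} (hτ : 0 < τ) (g : Dom) :
    Continuous fun x : ℝ => gamma τ x * g.1 x :=
  (continuous_gamma hτ).mul (continuous_dom_ofReal g)

theorem S_S_toH_ae_eq {τ : ℝ} (hτ : 0 < τ) (f : Dom) : S τ (S τ (toH f)) =ᵐ[volume]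
    fun x : ℝ => gamma τ x * fourierC (fun t => gamma τ t * (fourierDom f).1 t) x := by
  have h2 : MemLp (fun x : ℝ => gamma τ x * (fourierDom f).1 x) 2 :=
    (memLp_congr_ae (S_toH_ae_eq τ f)).1 (Lp.memLp _)
  have e : S τ (toH f) = h2.toLp _ := by
    apply Lp.ext
    exact (S_toH_ae_eq τ f).trans h2.coeFn_toLp.symm
  change K τ (F (S τ (toH f))) =ᵐ[volume] _
  rw [e]
  filter_upwards [K_ae_eq τ (F (h2.toLp _)), F_toLp_ae_eq h2 ((rapid_gamma_mul τ _).integrable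
    (continuous_gamma_mul hτ _).aestronglyMeasurable)] with x h3 h4
  rw [h3, h4]

/-- The Fourier transform of `γ g` satisfies the difference equation dual to that of `γ`. -/
theorem fourierC_gamma_mul_add {τ : ℝ} (hτ : 0 < τ) (f : Dom) (x : ℝ) :
    (1 + (q τ)⁻¹ * weight τ x) *
        fourierC (fun t => gamma τ t * (fourierDom f).1 t) (x + Real.sqrt τ * Complex.I) =
      fourierC (fun t => gamma τ t * (fourierDom (X4 τ f)).1 t) x := by
  set g := fourierDom f with hg
  have hq := q_ne_zero τ
  have hexp := tempered_exp (-(2 * Real.pi * Complex.I * x))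
  set h1 := mulDom _ hexp ((↑(U τ)⁻¹ : Module.End ℂ Dom) g) with hh1
  set ψ := mulDom _ hexp ((↑(U τ)⁻¹ : Module.End ℂ Dom) ((V τ : Module.End ℂ Dom) g)) with hψ
  have key := integral_gamma_mul hτ ψ
  have hi : ∀ k : Dom, Integrable fun t : ℝ => gamma τ t * k.1 t := fun k =>
    (rapid_gamma_mul τ k).integrable (continuous_gamma_mul hτ k).aestronglyMeasurable
  have e0 : fourierC (fun t => gamma τ t * g.1 t) (x + Real.sqrt τ * Complex.I) =
      ∫ t : ℝ, gamma τ t * h1.1 t := by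
    rw [fourierC]
    congr 1
    ext t
    rw [hh1, mulDom_apply, U_inv_apply hτ, ← mul_assoc (Complex.exp _) (Complex.exp _),
      ← Complex.exp_add, mul_left_comm]
    congr 3
    linear_combination (-(2 * Real.pi * t * Real.sqrt τ)) * Complex.I_sq
  have e1 : fourierC (fun t => gamma τ t * (fourierDom (X4 τ f)).1 t) x =
      (∫ t : ℝ, gamma τ t * h1.1 t) + q τ *
        ∫ t : ℝ, gamma τ t * ((1 + (q τ)⁻¹ • (U τ : Module.End ℂ Dom)) ψ).1 t := by
    rw [← integral_const_mul, ← integral_add (hi h1) ((hi _).const_mul _), fourierC]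
    congr 1
    ext t
    rw [fourierDom_X4_apply hτ, one_add_smul_U_apply_ofReal hτ, hh1, hψ, mulDom_apply,
      mulDom_apply, U_inv_apply_ofReal hτ, U_inv_apply_ofReal hτ, V_apply, ← hg]
    ring_nf
  have e2 : ∫ t : ℝ, gamma τ t * ((↑(V τ)⁻¹ : Module.End ℂ Dom) ψ).1 t =
      (q τ ^ 2)⁻¹ * weight τ x * ∫ t : ℝ, gamma τ t * h1.1 t := by
    rw [← integral_const_mul]
    congr 1
    ext t
    rw [V_inv_apply, hψ, hh1, mulDom_apply, mulDom_apply, U_inv_apply hτ, V_apply, sub_add_cancel,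
      U_inv_apply_ofReal hτ]
    have e3 : Complex.exp (2 * Real.pi * Real.sqrt τ * (t - Real.sqrt τ * Complex.I)) =
        (q τ ^ 2)⁻¹ * (weight τ t : ℂ)⁻¹ := by
      rw [← neg_neg (2 * Real.pi * Real.sqrt τ * (t - Real.sqrt τ * Complex.I)),
        Complex.exp_neg, exp_weight_sub hτ, mul_inv]
    have e4 : Complex.exp (-(2 * Real.pi * Complex.I * x) * (t - Real.sqrt τ * Complex.I)) =
        weight τ x * Complex.exp (-(2 * Real.pi * Complex.I * x) * t) := by
      rw [weight, Complex.ofReal_exp, ← Complex.exp_add]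
      congr 1
      push_cast
      linear_combination (2 * Real.pi * x * Real.sqrt τ) * Complex.I_sq
    rw [e3, e4]
    ring
  rw [e1, key, e2, e0]
  field_simp

/-- The relation is tested on `T₂`, the closure of `V`, as `T₃` need not be the closure of `X₃`. The
Fourier transform of `γ f̂` is not in `Dom`, but it is entire and bounded on strips, and its
product with a function in `Dom` is an admissible test function. -/
theorem onH_X4_le {τ : ℝ} (hτ : 0 < τ) : onH (X4 τ) ≤ opT τ 4 := by
  rw [onH_le_iff]
  intro f
  rw [show (4 : ℤ) = 2 + 1 + 1 by rfl, mem_graph_opT_add_one, mem_graph_opT_add_one,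
    mem_graph_opT_iff hτ (opT_two hτ) (onH_V_le hτ)]
  intro φ
  have e : ∀ f φ : Dom, (inner ℂ (S τ (S τ (toH f))) (toH φ) : ℂ) = ∫ x : ℝ, (gamma τ x)⁻¹ *
      ((starRingEnd ℂ) (fourierC (fun t => gamma τ t * (fourierDom f).1 t) x) * φ.1 x) := by
    intro f φ
    rw [inner_toH]
    refine integral_congr_ae ?_
    filter_upwards [S_S_toH_ae_eq hτ f] with x hx
    rw [hx, map_mul, conj_gamma]
    ring
  rw [e, e]
  have ht := ((tempered_fourierC (continuous_gamma_mul hτ (fourierDom f))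
    (rapid_gamma_mul τ _)).conj).comp_add (-(Real.sqrt τ * Complex.I))
  have h := integral_inv_gamma_mul hτ (mulDom _ ht φ)
  refine Eq.trans ?_ (h.symm.trans ?_)
  · congr 1
    ext x
    rw [V_apply, V_apply, mulDom_apply, add_neg_cancel_right, Complex.conj_ofReal]
  · congr 1
    ext x
    rw [one_add_smul_U_apply_ofReal hτ, mulDom_apply, ← fourierC_gamma_mul_add hτ, map_mul,
      conj_one_add]
    simp [mul_assoc]

end Extensions

section Density

open Filter Topology Set

/-! ### Approximation in `Dom` -/

theorem expIntegrable_mul_inv_weight {τ : ℝ} {κ : ℝ → ℂ} (hκ : ExpIntegrable κ) (c d : ℂ) :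
    ExpIntegrable fun x => κ x * (c + d * (weight τ x : ℂ)⁻¹) := by
  have h := continuous_weight τ
  have hw : ∀ x, (weight τ x : ℂ) ≠ 0 := fun x => by exact_mod_cast (weight_pos τ x).ne'
  refine hκ.mul_of_le (by fun_prop (disch := assumption)) (C := ‖c‖ + ‖d‖)
    (M := 2 * Real.pi * Real.sqrt τ) fun x => ?_
  have h0 : 1 ≤ Real.exp (2 * Real.pi * Real.sqrt τ * |x|) := Real.one_le_exp (by positivity)
  calc _ ≤ ‖c‖ + ‖d * (weight τ x : ℂ)⁻¹‖ := norm_add_le _ _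
    _ = ‖c‖ * 1 + ‖d‖ * (weight τ x)⁻¹ := by
        rw [norm_mul, norm_inv, Complex.norm_real, Real.norm_of_nonneg (weight_pos τ x).le, mul_one]
    _ ≤ ‖c‖ * Real.exp (2 * Real.pi * Real.sqrt τ * |x|) +
        ‖d‖ * Real.exp (2 * Real.pi * Real.sqrt τ * |x|) := by
        gcongr
        exact inv_weight_le τ x
    _ = _ := by ring

/-- Functions holomorphic in a strip of width `√τ` and rapidly decreasing there are limits of
functions in `Dom`, together with their shifts by `i√τ`. -/
theorem integral_add_integral_eq_zero_of_strip {τ : ℝ} {κ₀ κ₁ : ℝ → ℂ}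
    (h₀ : ExpIntegrable κ₀) (h₁ : ExpIntegrable κ₁)
    (hz : ∀ f : Dom, (∫ x : ℝ, κ₀ x * f.1 x) +
      ∫ x : ℝ, κ₁ x * f.1 (x + Real.sqrt τ * Complex.I) = 0)
    {h : ℂ → ℂ} (hc : ContinuousOn h (Complex.im ⁻¹' Icc 0 (Real.sqrt τ)))
    (hd : DifferentiableOn ℂ h (Complex.im ⁻¹' Ioo 0 (Real.sqrt τ)))
    (hb : ∀ N : ℝ, ∃ C : ℝ, 0 ≤ C ∧ ∀ z : ℂ, z.im ∈ Icc 0 (Real.sqrt τ) →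
      ‖h z‖ ≤ C * Real.exp (-N * |z.re|)) :
    (∫ x : ℝ, κ₀ x * h x) + ∫ x : ℝ, κ₁ x * h (x + Real.sqrt τ * Complex.I) = 0 := by
  set b := Real.sqrt τ with hbdef
  have hb0 : 0 ≤ b := Real.sqrt_nonneg τ
  have hc0 : Continuous fun x : ℝ => h x :=
    hc.comp_continuous Complex.continuous_ofReal fun x => by simp [hb0]
  have hc1 : Continuous fun x : ℝ => h (x + b * Complex.I) :=
    hc.comp_continuous (by fun_prop) fun x => by simp [hb0]
  have hr0 : Rapid fun x : ℝ => h x := by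
    intro N
    obtain ⟨C, hC, h'⟩ := hb N
    exact ⟨C, hC, fun x => by simpa using h' x (by simp [hb0])⟩
  have hr1 : Rapid fun x : ℝ => h (x + b * Complex.I) := by
    intro N
    obtain ⟨C, hC, h'⟩ := hb N
    exact ⟨C, hC, fun x => by simpa using h' (x + b * Complex.I) (by simp [hb0])⟩
  have hshift : ∀ (n : ℕ) (x : ℝ),
      (gaussConv n _ hc0 hr0).1 (x + b * Complex.I) =
        ∫ t : ℝ, gauss n (x - t) * h (t + b * Complex.I) := by
    intro n x
    rw [gaussConv_apply]
    obtain ⟨ha1, ha2⟩ := tempered_gauss_sub n (x + b * Complex.I)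
    obtain ⟨C, N, hC, h'⟩ := ha2 b
    obtain ⟨C', hC', h''⟩ := hb (N + 1)
    have hs := integral_strip_shift (f := fun z => gauss n (x + b * Complex.I - z) * h z) hb0
      one_pos (ha1.continuous.continuousOn.mul hc) (ha1.differentiableOn.mul hd) (C := C * C')
      fun z hz => by
        rw [norm_mul]
        calc _ ≤ C * Real.exp (N * |z.re|) * (C' * Real.exp (-(N + 1) * |z.re|)) := by
              gcongr
              · exact h' z (by rw [abs_of_nonneg hz.1]; exact hz.2)
              · exact h'' z hz
          _ = C * C' * (Real.exp (N * |z.re|) * Real.exp (-(N + 1) * |z.re|)) := by ring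
          _ = _ := by rw [← Real.exp_add]; ring_nf
    simp only [Complex.ofReal_zero, zero_mul, add_zero, add_sub_add_right_eq_sub] at hs
    exact hs
  have l0 := h₀.tendsto_integral (A := fun n x => ∫ t : ℝ, gauss n (x - t) * h t)
    (B := fun x => h x)
    (fun n => (continuous_dom_ofReal (gaussConv n _ hc0 hr0)).aestronglyMeasurable)
    (norm_integral_gauss_mul_le hr0)
    (Eventually.of_forall fun x => tendsto_integral_gauss_mul hc0 hr0 x)
  have l1 := h₁.tendsto_integral
    (A := fun n x => ∫ t : ℝ, gauss n (x - t) * h (t + b * Complex.I))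
    (B := fun x => h (x + b * Complex.I))
    (fun n => (continuous_dom_ofReal (gaussConv n _ hc1 hr1)).aestronglyMeasurable)
    (norm_integral_gauss_mul_le hr1)
    (Eventually.of_forall fun x => tendsto_integral_gauss_mul hc1 hr1 x)
  refine tendsto_nhds_unique ((l0.add l1).congr fun n => ?_) tendsto_const_nhds
  have h2 := hz (gaussConv n _ hc0 hr0)
  simp only [hshift] at h2
  exact h2

theorem norm_one_add_exp_sq (ζ : ℂ) : ‖1 + Complex.exp ζ‖ ^ 2 =
    (1 - Real.exp ζ.re) ^ 2 + 4 * Real.exp ζ.re * Real.cos (ζ.im / 2) ^ 2 := by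
  rw [← Complex.normSq_eq_norm_sq, Complex.normSq_apply, Complex.add_re, Complex.add_im,
    Complex.exp_re, Complex.exp_im, Complex.one_re, Complex.one_im]
  have h1 : Real.cos ζ.im = 2 * Real.cos (ζ.im / 2) ^ 2 - 1 := by
    rw [← Real.cos_two_mul]; ring_nf
  have h2 := Real.sin_sq_add_cos_sq ζ.im
  have h3 : Real.cos (ζ.im / 2) ^ 2 = (1 + Real.cos ζ.im) / 2 := by linarith
  rw [h3]
  linear_combination Real.exp ζ.re ^ 2 * h2

theorem cos_half_le_cos_half_mul {α θ : ℝ} (hα : |α| ≤ Real.pi) (h0 : 0 ≤ θ) (h1 : θ ≤ 1) :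
    0 ≤ Real.cos (α / 2) ∧ Real.cos (α / 2) ≤ Real.cos (θ * α / 2) := by
  have ha := abs_le.1 hα
  refine ⟨Real.cos_nonneg_of_mem_Icc ⟨by linarith, by linarith⟩, ?_⟩
  rw [← Real.cos_abs (α / 2), ← Real.cos_abs (θ * α / 2)]
  have e : |θ * α / 2| ≤ |α / 2| := by
    rw [abs_div, abs_div, abs_mul, abs_of_nonneg h0]
    gcongr
    exact mul_le_of_le_one_left (abs_nonneg _) h1
  refine Real.cos_le_cos_of_nonneg_of_le_pi (abs_nonneg _) ?_ e
  rw [abs_div, abs_two]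
  linarith [Real.pi_pos]

/-- A bound, uniform in `θ`, for the quotient of `1 + e^ζ` by its regularization `1 + e^{θζ}`, which
has no zeros for `|Im ζ| ≤ π` and `θ < 1`. -/
theorem norm_one_add_exp_le {ζ : ℂ} (hζ : |ζ.im| ≤ Real.pi) {θ : ℝ} (h0 : 1 / 2 ≤ θ) (h1 : θ ≤ 1) :
    ‖1 + Complex.exp ζ‖ ≤ 2 * Real.exp |ζ.re| * ‖1 + Complex.exp (θ * ζ)‖ := by
  refine le_of_sq_le_sq ?_ (by positivity)
  rw [mul_pow, norm_one_add_exp_sq, norm_one_add_exp_sq, Complex.re_ofReal_mul,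
    Complex.im_ofReal_mul]
  set s := ζ.re
  obtain ⟨c0, c1⟩ := cos_half_le_cos_half_mul hζ (by linarith) h1
  have hE : 1 ≤ Real.exp |s| := Real.one_le_exp (abs_nonneg s)
  have k1 : (1 - Real.exp s) ^ 2 ≤ 4 * Real.exp |s| * (1 - Real.exp (θ * s)) ^ 2 := by
    have e1 : Real.exp s = Real.exp (s / 2) ^ 2 := by rw [← Real.exp_nat_mul]; ring_nf
    have e2 : (1 + Real.exp (s / 2)) ^ 2 ≤ 4 * Real.exp |s| := by
      have : Real.exp (s / 2) ≤ Real.exp (|s| / 2) := by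
        gcongr
        exact le_abs_self s
      have h3 : Real.exp |s| = Real.exp (|s| / 2) ^ 2 := by rw [← Real.exp_nat_mul]; ring_nf
      have h4 : 1 ≤ Real.exp (|s| / 2) := Real.one_le_exp (by positivity)
      rw [h3]
      nlinarith [Real.exp_pos (s / 2)]
    have e3 : (1 - Real.exp (s / 2)) ^ 2 ≤ (1 - Real.exp (θ * s)) ^ 2 := by
      rcases le_total 0 s with hs | hs
      · have h5 : 1 ≤ Real.exp (s / 2) := Real.one_le_exp (by positivity)
        have h6 : Real.exp (s / 2) ≤ Real.exp (θ * s) := Real.exp_le_exp.2 (by nlinarith)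
        nlinarith
      · have h5 : Real.exp (s / 2) ≤ 1 := Real.exp_le_one_iff.2 (by linarith)
        have h6 : Real.exp (θ * s) ≤ Real.exp (s / 2) := Real.exp_le_exp.2 (by nlinarith)
        nlinarith
    calc (1 - Real.exp s) ^ 2 = (1 + Real.exp (s / 2)) ^ 2 * (1 - Real.exp (s / 2)) ^ 2 := by
          rw [e1]; ring
      _ ≤ _ := by gcongr
  have k2 : Real.exp s ≤ Real.exp |s| * Real.exp (θ * s) := by
    rw [← Real.exp_add]
    refine Real.exp_le_exp.2 ?_
    rcases abs_cases s with ⟨h, _⟩ | ⟨h, _⟩ <;> rw [h] <;> nlinarith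
  have k3 : Real.cos (ζ.im / 2) ^ 2 ≤ Real.cos (θ * ζ.im / 2) ^ 2 := by gcongr
  calc _ ≤ 4 * Real.exp |s| * (1 - Real.exp (θ * s)) ^ 2 +
        4 * (Real.exp |s| * Real.exp (θ * s)) * Real.cos (θ * ζ.im / 2) ^ 2 := by gcongr
    _ ≤ 4 * Real.exp |s| * (1 - Real.exp (θ * s)) ^ 2 +
        4 * Real.exp |s| * (4 * Real.exp (θ * s) * Real.cos (θ * ζ.im / 2) ^ 2) := by
        have : 0 ≤ Real.exp |s| * Real.exp (θ * s) * Real.cos (θ * ζ.im / 2) ^ 2 := by positivity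
        nlinarith
    _ = 4 * Real.exp |s| * ((1 - Real.exp (θ * s)) ^ 2 +
        4 * Real.exp (θ * s) * Real.cos (θ * ζ.im / 2) ^ 2) := by ring
    _ ≤ _ := by
        gcongr
        nlinarith

theorem cos_le_norm_one_add_exp {ζ : ℂ} (hζ : |ζ.im| ≤ Real.pi) {θ : ℝ} (h0 : 0 ≤ θ)
    (h1 : θ ≤ 1) : Real.cos (θ * Real.pi / 2) ≤ ‖1 + Complex.exp (θ * ζ)‖ := by
  have hπ := Real.pi_pos
  have hc0 : 0 ≤ Real.cos (θ * Real.pi / 2) :=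
    Real.cos_nonneg_of_mem_Icc ⟨by nlinarith, by nlinarith⟩
  have hc : Real.cos (θ * Real.pi / 2) ≤ Real.cos (θ * ζ.im / 2) := by
    rw [← Real.cos_abs (θ * ζ.im / 2), abs_div, abs_mul, abs_of_nonneg h0, abs_two]
    refine Real.cos_le_cos_of_nonneg_of_le_pi (by positivity) (by nlinarith) ?_
    gcongr
  refine le_of_sq_le_sq ?_ (norm_nonneg _)
  rw [norm_one_add_exp_sq, Complex.re_ofReal_mul, Complex.im_ofReal_mul]
  have hc1 : Real.cos (θ * Real.pi / 2) ^ 2 ≤ Real.cos (θ * ζ.im / 2) ^ 2 := by gcongr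
  have hc2 := Real.cos_sq_le_one (θ * ζ.im / 2)
  have he := Real.exp_pos (θ * ζ.re)
  nlinarith [mul_nonneg (sq_nonneg (1 - Real.exp (θ * ζ.re))) (sub_nonneg.2 hc2),
    mul_nonneg (mul_nonneg he.le he.le) (sq_nonneg (Real.cos (θ * ζ.im / 2))),
    mul_nonneg he.le (sq_nonneg (Real.cos (θ * ζ.im / 2)))]

theorem one_add_mul_weight_ne_zero {τ : ℝ} (hτ : 0 < τ) {c : ℂ} (hc : ‖c‖ = 1) {x : ℝ}
    (hx : x ≠ 0) : 1 + c * weight τ x ≠ 0 := by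
  intro h
  have h1 : ‖c * weight τ x‖ = 1 := by rw [← neg_eq_of_add_eq_zero_right h, norm_neg, norm_one]
  rw [norm_mul, hc, one_mul, Complex.norm_real, Real.norm_of_nonneg (weight_pos τ x).le, weight,
    Real.exp_eq_one_iff] at h1
  have := Real.sqrt_pos.2 hτ
  have := Real.pi_pos
  simp_all [ne_of_gt]

theorem norm_q (τ : ℝ) : ‖q τ‖ = 1 := by
  rw [q, Complex.norm_exp]
  simp

/-- For `τ ≤ 1` the functions `(1 + qU) g` with `g ∈ Dom` are dense for the graph topology of `V`:
the zeros of `1 + q e^{-2π√τ z}` then lie at most on the boundary of the strip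
`0 < Im z < √τ`, and `1 / (1 + q e^{-2π√τ z})` is approximated by functions holomorphic in a
larger strip. -/
theorem integral_add_integral_V_eq_zero {τ : ℝ} (hτ : 0 < τ) (hτ1 : τ ≤ 1) {κ₀ κ₁ : ℝ → ℂ}
    (h₀ : ExpIntegrable κ₀) (h₁ : ExpIntegrable κ₁)
    (hz : ∀ f : Dom, (∫ x : ℝ, κ₀ x * ((1 + q τ * weight τ x) * f.1 x)) +
      ∫ x : ℝ, κ₁ x * ((1 + (q τ)⁻¹ * weight τ x) * f.1 (x + Real.sqrt τ * Complex.I)) = 0)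
    (f : Dom) :
    (∫ x : ℝ, κ₀ x * f.1 x) + ∫ x : ℝ, κ₁ x * f.1 (x + Real.sqrt τ * Complex.I) = 0 := by
  set b := Real.sqrt τ with hbdef
  have hb0 : 0 < b := Real.sqrt_pos.2 hτ
  have hb2 : b ^ 2 = τ := Real.sq_sqrt hτ.le
  have hb2' : (b : ℂ) ^ 2 = τ := by exact_mod_cast hb2
  have hπ := Real.pi_pos
  -- The multiplier `1 + q e^{-2πbz}` is `1 + exp (ζ z)`, and `|Im ζ| ≤ πτ ≤ π` in the strip.
  set ζ : ℂ → ℂ := fun z => -(2 * Real.pi * b * (z - b / 2 * Complex.I)) with hζdef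
  have hre : ∀ z, (ζ z).re = -(2 * Real.pi * b * z.re) := fun z => by simp [hζdef]
  have him : ∀ z, (ζ z).im = -(2 * Real.pi * b * (z.im - b / 2)) := fun z => by
    simp [hζdef]
  have hζim : ∀ z : ℂ, z.im ∈ Icc 0 b → |(ζ z).im| ≤ Real.pi := by
    intro z hz
    rw [him, abs_neg, abs_mul, abs_of_pos (by positivity)]
    have : |z.im - b / 2| ≤ b / 2 := abs_le.2 ⟨by linarith [hz.1], by linarith [hz.2]⟩
    calc 2 * Real.pi * b * |z.im - b / 2| ≤ 2 * Real.pi * b * (b / 2) := by gcongr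
      _ = Real.pi * τ := by rw [← hb2]; ring
      _ ≤ _ := mul_le_of_le_one_right hπ.le hτ1
  have e0 : ∀ x : ℝ, Complex.exp (ζ x) = q τ * weight τ x := by
    intro x
    rw [hζdef, q, weight, Complex.ofReal_exp, ← Complex.exp_add]
    congr 1
    push_cast
    rw [← hbdef]
    linear_combination (Real.pi * Complex.I) * hb2'
  have e1 : ∀ x : ℝ, Complex.exp (ζ (x + b * Complex.I)) = (q τ)⁻¹ * weight τ x := by
    intro x
    rw [hζdef, q, weight, Complex.ofReal_exp, ← Complex.exp_neg, ← Complex.exp_add]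
    congr 1
    push_cast
    rw [← hbdef]
    linear_combination (-Real.pi * Complex.I) * hb2'
  have him0 : ∀ x : ℝ, (x : ℂ).im ∈ Icc 0 b := fun x => by simp [hb0.le]
  have him1 : ∀ x : ℝ, ((x : ℂ) + b * Complex.I).im ∈ Icc 0 b := fun x => by simp [hb0.le]
  set θ : ℕ → ℝ := fun n => 1 - 1 / ((n : ℝ) + 2) with hθ
  have hθ0 : ∀ n, 1 / 2 ≤ θ n := by
    intro n
    have : 1 / ((n : ℝ) + 2) ≤ 1 / 2 := by gcongr; linarith [(Nat.cast_nonneg n : (0 : ℝ) ≤ n)]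
    simp only [hθ]
    linarith
  have hθ1 : ∀ n, θ n < 1 := fun n => by
    have : 0 < 1 / ((n : ℝ) + 2) := by positivity
    simp only [hθ]
    linarith
  have hθl : Tendsto (fun n => (θ n : ℂ)) atTop (𝓝 1) := by
    have h1 : Tendsto θ atTop (𝓝 (1 - 0)) :=
      tendsto_const_nhds.sub ((tendsto_const_nhds (x := (1 : ℝ))).div_atTop
        (tendsto_atTop_add_const_right _ _ tendsto_natCast_atTop_atTop))
    rw [sub_zero] at h1
    exact_mod_cast (Complex.continuous_ofReal.tendsto 1).comp h1
  set D : ℕ → ℂ → ℂ := fun n z => 1 + Complex.exp (θ n * ζ z) with hD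
  have hDd : ∀ n, Differentiable ℂ (D n) := fun n => by simp only [hD, hζdef]; fun_prop
  have hcos : ∀ n, 0 < Real.cos (θ n * Real.pi / 2) := fun n =>
    Real.cos_pos_of_mem_Ioo ⟨by nlinarith [hθ0 n], by nlinarith [hθ1 n]⟩
  have hDb : ∀ n z, z.im ∈ Icc 0 b → Real.cos (θ n * Real.pi / 2) ≤ ‖D n z‖ := fun n z hz =>
    cos_le_norm_one_add_exp (hζim z hz) (by linarith [hθ0 n]) (hθ1 n).le
  have hD0 : ∀ n z, z.im ∈ Icc 0 b → D n z ≠ 0 := fun n z hz =>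
    norm_pos_iff.1 ((hcos n).trans_le (hDb n z hz))
  -- For fixed `n` the quotient `f / D n` is rapidly decreasing in the strip.
  have hstep : ∀ n, (∫ x : ℝ, κ₀ x * ((1 + q τ * weight τ x) * (f.1 x / D n x))) +
      ∫ x : ℝ, κ₁ x * ((1 + (q τ)⁻¹ * weight τ x) *
        (f.1 (x + b * Complex.I) / D n (x + b * Complex.I))) = 0 := by
    intro n
    have h := integral_add_integral_eq_zero_of_strip (τ := τ)
      (expIntegrable_mul_one_add (τ := τ) h₀ (q τ))
      (expIntegrable_mul_one_add (τ := τ) h₁ (q τ)⁻¹)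
      (h := fun z => f.1 z / D n z) (fun g => by simpa only [mul_assoc] using hz g)
      (f.2.1.continuous.continuousOn.div (hDd n).continuous.continuousOn fun z hz => hD0 n z hz)
      (f.2.1.differentiableOn.div (hDd n).differentiableOn fun z hz =>
        hD0 n z (Ioo_subset_Icc_self hz))
      (fun N => by
        obtain ⟨C, hC, h'⟩ := exists_bound f b N
        refine ⟨C / Real.cos (θ n * Real.pi / 2), by have := hcos n; positivity, fun z hz => ?_⟩
        rw [norm_div, div_mul_eq_mul_div]
        have := hcos n
        gcongr
        · exact h' z (by rw [abs_of_nonneg hz.1]; exact hz.2)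
        · exact hDb n z hz)
    simpa only [mul_assoc] using h
  have hbound : ∀ N : ℝ, ∃ C : ℝ, 0 ≤ C ∧ ∀ (n : ℕ) (z : ℂ), z.im ∈ Icc 0 b →
      ‖(1 + Complex.exp (ζ z)) * (f.1 z / D n z)‖ ≤ C * Real.exp (-N * |z.re|) := by
    intro N
    obtain ⟨C, hC, h'⟩ := exists_bound f b (2 * Real.pi * b + N)
    refine ⟨2 * C, by positivity, fun n z hz => ?_⟩
    have hp : 0 < ‖D n z‖ := (hcos n).trans_le (hDb n z hz)
    have h3 := norm_one_add_exp_le (hζim z hz) (hθ0 n) (hθ1 n).le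
    rw [hre, abs_neg, abs_mul, abs_of_pos (by positivity)] at h3
    rw [norm_mul, norm_div]
    calc _ ≤ 2 * Real.exp (2 * Real.pi * b * |z.re|) * ‖D n z‖ *
          (C * Real.exp (-(2 * Real.pi * b + N) * |z.re|) / ‖D n z‖) := by
          gcongr
          exact h' z (by rw [abs_of_nonneg hz.1]; exact hz.2)
      _ = 2 * C * (Real.exp (2 * Real.pi * b * |z.re|) *
          Real.exp (-(2 * Real.pi * b + N) * |z.re|)) := by field_simp
      _ = _ := by rw [← Real.exp_add]; ring_nf
  have hlim : ∀ z, 1 + Complex.exp (ζ z) ≠ 0 →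
      Tendsto (fun n => (1 + Complex.exp (ζ z)) * (f.1 z / D n z)) atTop (𝓝 (f.1 z)) := by
    intro z hz
    have h4 : Tendsto (fun n => D n z) atTop (𝓝 (1 + Complex.exp (ζ z))) := by
      have h5 : Tendsto (fun n => (θ n : ℂ) * ζ z) atTop (𝓝 (1 * ζ z)) := hθl.mul_const _
      rw [one_mul] at h5
      exact ((Complex.continuous_exp.tendsto _).comp h5).const_add 1
    have h6 := (tendsto_const_nhds (x := f.1 z)).div h4 hz
    have h7 := h6.const_mul (1 + Complex.exp (ζ z))
    rwa [mul_div_cancel₀ _ hz] at h7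
  have hae : ∀ᵐ x : ℝ, x ≠ 0 := by
    rw [ae_iff]
    simp
  have hcD : ∀ n, ∀ a : ℝ → ℂ, Continuous a → (∀ x, (a x).im ∈ Icc 0 b) →
      AEStronglyMeasurable fun x => (1 + Complex.exp (ζ (a x))) * (f.1 (a x) / D n (a x)) := by
    intro n a ha ha'
    have hf := f.2.1.continuous
    have hDc := (hDd n).continuous
    refine Continuous.aestronglyMeasurable (Continuous.mul (by fun_prop)
      ((hf.comp ha).div (hDc.comp ha) fun x => hD0 n _ (ha' x)))
  have l0 := h₀.tendsto_integral
    (A := fun n x => (1 + Complex.exp (ζ (x : ℂ))) * (f.1 x / D n x)) (B := fun x => f.1 x)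
    (fun n => hcD n _ Complex.continuous_ofReal him0)
    (fun N => by
      obtain ⟨C, hC, h'⟩ := hbound N
      exact ⟨C, hC, fun n x => by simpa using h' n x (him0 x)⟩)
    (by
      filter_upwards [hae] with x hx
      refine hlim x ?_
      rw [e0]
      exact one_add_mul_weight_ne_zero hτ (norm_q τ) hx)
  have l1 := h₁.tendsto_integral
    (A := fun n x => (1 + Complex.exp (ζ (x + b * Complex.I))) *
      (f.1 (x + b * Complex.I) / D n (x + b * Complex.I)))
    (B := fun x => f.1 (x + b * Complex.I))
    (fun n => hcD n _ (by fun_prop) him1)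
    (fun N => by
      obtain ⟨C, hC, h'⟩ := hbound N
      exact ⟨C, hC, fun n x => by simpa using h' n (x + b * Complex.I) (him1 x)⟩)
    (by
      filter_upwards [hae] with x hx
      refine hlim _ ?_
      rw [e1]
      exact one_add_mul_weight_ne_zero hτ (by rw [norm_inv, norm_q, inv_one]) hx)
  simp only [e0, e1] at l0 l1
  exact tendsto_nhds_unique ((l0.add l1).congr hstep) tendsto_const_nhds

end Density

section EssentialSelfAdjointness

open Filter Topology Set

/-! ### Density of the ranges of `1 + Xᵢ` -/

theorem rapid_inv_gamma_mul (τ : ℝ) (g : Dom) : Rapid fun x => (gamma τ x)⁻¹ * g.1 x := by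
  refine (rapid_dom g).mul_of_le zero_le_one (M := 0) fun x => ?_
  simp [norm_gamma]

theorem continuous_inv_gamma_mul {τ : ℝ} (hτ : 0 < τ) (g : Dom) :
    Continuous fun x : ℝ => (gamma τ x)⁻¹ * g.1 x :=
  ((continuous_gamma hτ).inv₀ (gamma_ne_zero τ)).mul (continuous_dom_ofReal g)

/-- For `ψ ∈ Dom`, the Gaussian regularizations of `ψ/γ`, multiplied by `γ`, tend to `ψ`. -/
theorem ExpIntegrable.tendsto_integral_gamma_gauss {τ : ℝ} (hτ : 0 < τ) {κ : ℝ → ℂ}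
    (hκ : ExpIntegrable κ) (ψ : Dom) :
    Tendsto (fun n : ℕ => ∫ x : ℝ, κ x *
      (gamma τ x * ∫ t : ℝ, gauss n (x - t) * ((gamma τ t)⁻¹ * ψ.1 t))) atTop
      (𝓝 (∫ x : ℝ, κ x * ψ.1 x)) := by
  have hc := continuous_inv_gamma_mul hτ ψ
  have hr := rapid_inv_gamma_mul τ ψ
  refine hκ.tendsto_integral (A := fun n x => gamma τ x * ∫ t : ℝ, gauss n (x - t) *
    ((gamma τ t)⁻¹ * ψ.1 t)) (B := fun x => ψ.1 x) (fun n => ?_) (fun N => ?_)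
    (Eventually.of_forall fun x => ?_)
  · exact ((continuous_gamma hτ).mul
      (continuous_dom_ofReal (gaussConv n _ hc hr))).aestronglyMeasurable
  · obtain ⟨C, hC, h⟩ := norm_integral_gauss_mul_le hr N
    exact ⟨C, hC, fun n x => by rw [norm_mul, norm_gamma, one_mul]; exact h n x⟩
  · have h := (tendsto_integral_gauss_mul hc hr x).const_mul (gamma τ x)
    rwa [mul_inv_cancel_left₀ (gamma_ne_zero τ x)] at h

/-- If `τ ≤ 1`, then `γ g` and `γ (1 + q⁻¹U) V g` with `g ∈ Dom` approximate `f` and `V f` for all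
`f ∈ Dom`. -/
theorem integral_add_integral_V_eq_zero_of_gamma {τ : ℝ} (hτ : 0 < τ) (hτ1 : τ ≤ 1) {κ₀ κ₁ : ℝ → ℂ}
    (h₀ : ExpIntegrable κ₀) (h₁ : ExpIntegrable κ₁)
    (hz : ∀ g : Dom, (∫ x : ℝ, κ₀ x * (gamma τ x * g.1 x)) +
      ∫ x : ℝ, κ₁ x * (gamma τ x * ((1 + (q τ)⁻¹ * weight τ x) *
        g.1 (x + Real.sqrt τ * Complex.I))) = 0) (f : Dom) :
    (∫ x : ℝ, κ₀ x * f.1 x) + ∫ x : ℝ, κ₁ x * f.1 (x + Real.sqrt τ * Complex.I) = 0 := by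
  refine integral_add_integral_V_eq_zero hτ hτ1 h₀ h₁ (fun f => ?_) f
  -- The regularizations of `(1 + qU) f / γ` are shifted by the integral identity for the test
  -- function `gauss n (x + ib - t) f(t)`.
  set φ := (1 + q τ • (U τ : Module.End ℂ Dom)) f with hφ
  have hc := continuous_inv_gamma_mul hτ φ
  have hr := rapid_inv_gamma_mul τ φ
  have hshift : ∀ (n : ℕ) (x : ℝ),
      (gaussConv n _ hc hr).1 (x + Real.sqrt τ * Complex.I) =
        ∫ t : ℝ, gauss n (x - t) * ((gamma τ t)⁻¹ * ((V τ : Module.End ℂ Dom) f).1 t) := by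
    intro n x
    have h := integral_inv_gamma_mul hτ
      (mulDom _ (tempered_gauss_sub n (x + Real.sqrt τ * Complex.I)) f)
    rw [gaussConv_apply]
    refine Eq.trans ?_ (h.trans ?_)
    · congr 1
      ext t
      rw [hφ, one_add_smul_U_apply_ofReal hτ, one_add_smul_U_apply_ofReal hτ, mulDom_apply]
      ring
    · congr 1
      ext t
      rw [V_apply, V_apply, mulDom_apply, add_sub_add_right_eq_sub]
      ring
  have l0 := h₀.tendsto_integral_gamma_gauss hτ φ
  have l1 := (expIntegrable_mul_one_add (τ := τ) h₁ (q τ)⁻¹).tendsto_integral_gamma_gauss hτ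
    ((V τ : Module.End ℂ Dom) f)
  have l2 := tendsto_nhds_unique ((l0.add l1).congr fun n => ?_) (tendsto_const_nhds (x := (0 : ℂ)))
  · rw [← l2]
    congr 2
    · ext x
      rw [hφ, one_add_smul_U_apply_ofReal hτ]
    · ext x
      rw [V_apply, mul_assoc]
  · rw [← hz (gaussConv n _ hc hr)]
    congr 2
    ext x
    rw [hshift]
    ring

/-- The functions `γ g` and `γ V⁻¹ g` with `g ∈ Dom` approximate `f` and `(1 + qU) V⁻¹ f` for all
`f ∈ Dom`. -/
theorem integral_add_integral_V_inv_eq_zero {τ : ℝ} (hτ : 0 < τ) {κ₀ κ₁ : ℝ → ℂ}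
    (h₀ : ExpIntegrable κ₀) (h₁ : ExpIntegrable κ₁)
    (hz : ∀ g : Dom, (∫ x : ℝ, κ₀ x * (gamma τ x * g.1 x)) +
      ∫ x : ℝ, κ₁ x * (gamma τ x * g.1 (x - Real.sqrt τ * Complex.I)) = 0) (f : Dom) :
    (∫ x : ℝ, κ₀ x * f.1 x) + ∫ x : ℝ, κ₁ x *
      ((1 + q τ * weight τ x) * f.1 (x - Real.sqrt τ * Complex.I)) = 0 := by
  -- The test function `gauss n (x - t) f(t - ib)` has `V` equal to `gauss n (x - ib - t) f(t)`.
  set f' := (↑(V τ)⁻¹ : Module.End ℂ Dom) f with hf'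
  set φ := (1 + q τ • (U τ : Module.End ℂ Dom)) f' with hφ
  have hc := continuous_inv_gamma_mul hτ f
  have hr := rapid_inv_gamma_mul τ f
  have hshift : ∀ (n : ℕ) (x : ℝ),
      (gaussConv n _ hc hr).1 (x - Real.sqrt τ * Complex.I) =
        ∫ t : ℝ, gauss n (x - t) * ((gamma τ t)⁻¹ * φ.1 t) := by
    intro n x
    have h := integral_inv_gamma_mul hτ (mulDom _ (tempered_gauss_sub n x) f')
    rw [gaussConv_apply]
    refine Eq.trans ?_ (h.symm.trans ?_)
    · congr 1
      ext t
      rw [V_apply, mulDom_apply, hf', V_inv_apply, add_sub_cancel_right,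
        sub_add_eq_sub_sub_swap]
      ring
    · congr 1
      ext t
      rw [hφ, one_add_smul_U_apply_ofReal hτ, one_add_smul_U_apply_ofReal hτ, mulDom_apply]
      ring
  have l0 := h₀.tendsto_integral_gamma_gauss hτ f
  have l1 := h₁.tendsto_integral_gamma_gauss hτ φ
  have l2 := tendsto_nhds_unique ((l0.add l1).congr fun n => ?_) (tendsto_const_nhds (x := (0 : ℂ)))
  · rw [← l2]
    congr 2
    ext x
    rw [hφ, one_add_smul_U_apply_ofReal hτ, hf', V_inv_apply]
  · rw [← hz (gaussConv n _ hc hr)]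
    congr 2
    ext x
    rw [hshift]

/-- The orthogonality relations for the range of `1 + A`, transported by `S`. -/
theorem integral_S_mul_eq_zero (τ : ℝ) {A : Module.End ℂ Dom} {k : H}
    (h : ∀ f : Dom, ∫ x : ℝ, (starRingEnd ℂ) (k x) * (f.1 x + (A f).1 x) = 0) (f : Dom) :
    ∫ x : ℝ, (starRingEnd ℂ) (S τ k x) *
      (gamma τ x * ((fourierDom f).1 x + (fourierDom (A f)).1 x)) = 0 := by
  have h1 := h f
  change ∫ x : ℝ, (starRingEnd ℂ) (k x) * (f + A f).1 x = 0 at h1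
  rw [← inner_toH, ← (S τ).inner_map_map, inner_S_toH, fourierDom_add] at h1
  exact h1

theorem integrable_mul_gamma_mul {τ : ℝ} (hτ : 0 < τ) {κ : ℝ → ℂ} (hκ : ExpIntegrable κ) (g : Dom) :
    Integrable fun x : ℝ => κ x * (gamma τ x * g.1 x) :=
  hκ.integrable_mul (rapid_gamma_mul τ g) (continuous_gamma_mul hτ g).aestronglyMeasurable

theorem integrable_mul_dom {κ : ℝ → ℂ} (hκ : ExpIntegrable κ) (g : Dom) :
    Integrable fun x : ℝ => κ x * g.1 x :=
  hκ.integrable_mul (rapid_dom g) (continuous_dom_ofReal g).aestronglyMeasurable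

/-- A vector `k` orthogonal to the range of `1 + X₃` yields `S k` orthogonal to that of
`1 + V`. -/
theorem dense_one_add_X3 {τ : ℝ} (hτ : 0 < τ) (hτ1 : τ ≤ 1) (k : H)
    (h : ∀ f : Dom, ∫ x : ℝ, (starRingEnd ℂ) (k x) * (f.1 x + (X3 τ f).1 x) = 0) : k = 0 := by
  refine (S τ).map_eq_zero_iff.1 (dense_one_add_V hτ _ fun f => ?_)
  have hk := expIntegrable_conj (S τ k)
  have key := integral_add_integral_V_eq_zero_of_gamma hτ hτ1 hk hk (fun g => ?_) f
  · rw [← integral_add (integrable_mul_dom hk f) (by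
      simpa only [V_apply] using integrable_mul_dom hk ((V τ : Module.End ℂ Dom) f))] at key
    rw [← key]
    congr 1
    ext x
    rw [V_apply]
    ring
  · obtain ⟨f, rfl⟩ := fourierDom_surjective g
    have hi := integrable_mul_gamma_mul hτ hk (fourierDom (X3 τ f))
    simp only [fourierDom_X3_apply hτ] at hi
    refine Eq.trans ?_ (integral_S_mul_eq_zero τ h f)
    rw [← integral_add (integrable_mul_gamma_mul hτ hk _) hi]
    congr 1
    ext x
    rw [fourierDom_X3_apply hτ]
    ring

/-- A vector `k` orthogonal to the range of `1 + X₄` yields `S k` orthogonal to that of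
`1 + X₃`. -/
theorem dense_one_add_X4 {τ : ℝ} (hτ : 0 < τ) (hτ1 : τ ≤ 1) (k : H)
    (h : ∀ f : Dom, ∫ x : ℝ, (starRingEnd ℂ) (k x) * (f.1 x + (X4 τ f).1 x) = 0) : k = 0 := by
  refine (S τ).map_eq_zero_iff.1 (dense_one_add_X3 hτ hτ1 _ fun f => ?_)
  have h₀ := expIntegrable_mul_inv_weight (τ := τ) (expIntegrable_conj (S τ k)) 1 1
  have h₁ := expIntegrable_mul_inv_weight (τ := τ) (expIntegrable_conj (S τ k)) 0 (q τ)
  have key := integral_add_integral_V_eq_zero_of_gamma hτ hτ1 h₀ h₁ (fun g => ?_) f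
  · rw [← integral_add (integrable_mul_dom h₀ f) (by
      simpa only [V_apply] using integrable_mul_dom h₁ ((V τ : Module.End ℂ Dom) f))] at key
    rw [← key]
    congr 1
    ext x
    rw [X3_apply hτ]
    ring
  · obtain ⟨f, rfl⟩ := fourierDom_surjective g
    have hi := integrable_mul_gamma_mul hτ h₁
      ((1 + (q τ)⁻¹ • (U τ : Module.End ℂ Dom)) ((V τ : Module.End ℂ Dom) (fourierDom f)))
    simp only [one_add_smul_U_apply_ofReal hτ, V_apply] at hi
    refine Eq.trans ?_ (integral_S_mul_eq_zero τ h f)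
    rw [← integral_add (integrable_mul_gamma_mul hτ h₀ _) hi]
    congr 1
    ext x
    rw [fourierDom_X4_apply hτ]
    ring

/-- The Fourier transform carries `X₅` to `U⁻¹ + q⁻¹ U⁻¹ V⁻¹`. -/
theorem fourierDom_X5_apply {τ : ℝ} (hτ : 0 < τ) (f : Dom) (x : ℝ) : (fourierDom (X5 τ f)).1 x =
    (weight τ x : ℂ)⁻¹ * ((fourierDom f).1 x +
      (q τ)⁻¹ * (fourierDom f).1 (x - Real.sqrt τ * Complex.I)) := by
  have hq := q_ne_zero τ
  rw [X5, Module.End.mul_apply]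
  set g := (↑(V τ)⁻¹ : Module.End ℂ Dom) f with hg
  change (fourierDom (g + q τ • (U τ : Module.End ℂ Dom) g)).1 _ = _
  rw [fourierDom_add, fourierDom_smul, fourierDom_U hτ, hg, fourierDom_V_inv hτ]
  change ((↑(U τ)⁻¹ : Module.End ℂ Dom) (fourierDom f)).1 _ + q τ *
    ((↑(V τ)⁻¹ : Module.End ℂ Dom) ((↑(U τ)⁻¹ : Module.End ℂ Dom) (fourierDom f))).1 _ = _
  rw [U_inv_apply_ofReal hτ, V_inv_apply, U_inv_apply hτ,
    ← neg_neg (2 * Real.pi * Real.sqrt τ * (x - Real.sqrt τ * Complex.I)),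
    Complex.exp_neg, exp_weight_sub hτ]
  field_simp

/-- A vector `k` orthogonal to the range of `1 + X₅` yields `S k` orthogonal to that of
`1 + X₄`. -/
theorem dense_one_add_X5 {τ : ℝ} (hτ : 0 < τ) (hτ1 : τ ≤ 1) (k : H)
    (h : ∀ f : Dom, ∫ x : ℝ, (starRingEnd ℂ) (k x) * (f.1 x + (X5 τ f).1 x) = 0) : k = 0 := by
  refine (S τ).map_eq_zero_iff.1 (dense_one_add_X4 hτ hτ1 _ fun f => ?_)
  have h₀ := expIntegrable_mul_inv_weight (τ := τ) (expIntegrable_conj (S τ k)) 1 1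
  have h₁ := expIntegrable_mul_inv_weight (τ := τ) (expIntegrable_conj (S τ k)) 0 (q τ)⁻¹
  have key := integral_add_integral_V_inv_eq_zero hτ h₀ h₁ (fun g => ?_) f
  · have hi := integrable_mul_dom h₁
      ((1 + q τ • (U τ : Module.End ℂ Dom)) ((↑(V τ)⁻¹ : Module.End ℂ Dom) f))
    simp only [one_add_smul_U_apply_ofReal hτ, V_inv_apply] at hi
    rw [← integral_add (integrable_mul_dom h₀ f) hi] at key
    rw [← key]
    congr 1
    ext x
    rw [X4_apply hτ]
    ring
  · obtain ⟨f, rfl⟩ := fourierDom_surjective g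
    have hi := integrable_mul_gamma_mul hτ h₁
      ((↑(V τ)⁻¹ : Module.End ℂ Dom) (fourierDom f))
    simp only [V_inv_apply] at hi
    refine Eq.trans ?_ (integral_S_mul_eq_zero τ h f)
    rw [← integral_add (integrable_mul_gamma_mul hτ h₀ _) hi]
    congr 1
    ext x
    rw [fourierDom_X5_apply hτ]
    ring

/-! ### Periodicity for `τ ≤ 1` -/

theorem opT_three {τ : ℝ} (hτ : 0 < τ) (hτ1 : τ ≤ 1) : opT τ 3 = (onH (X3 τ)).closure :=
  opT_eq_closure hτ (onH_X3_le hτ) (dense_one_add_X3 hτ hτ1)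

theorem opT_four {τ : ℝ} (hτ : 0 < τ) (hτ1 : τ ≤ 1) : opT τ 4 = (onH (X4 τ)).closure :=
  opT_eq_closure hτ (onH_X4_le hτ) (dense_one_add_X4 hτ hτ1)

theorem opT_zero {τ : ℝ} (hτ : 0 < τ) (hτ1 : τ ≤ 1) : opT τ 0 = (onH (X5 τ)).closure :=
  opT_eq_closure hτ (onH_X5_le hτ) (dense_one_add_X5 hτ hτ1)

/-- The relation is tested on `T₄`, which is possible because `T₄` is known to be the closure of
`X₄`. -/
theorem onH_X5_le_opT_five {τ : ℝ} (hτ : 0 < τ) (hτ1 : τ ≤ 1) : onH (X5 τ) ≤ opT τ 5 := by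
  rw [onH_le_iff]
  intro f
  rw [show (5 : ℤ) = 4 + 1 by rfl, mem_graph_opT_add_one,
    mem_graph_opT_iff hτ (opT_four hτ hτ1) (onH_X4_le hτ)]
  intro φ
  have hq := q_ne_zero τ
  rw [inner_S_toH_left, inner_S_toH_left]
  set g := conjDom (fourierDom f) with hg
  set k := (↑(V τ)⁻¹ : Module.End ℂ Dom) φ with hk
  set ψ := mulDom _ (tempered_dom g) ((↑(U τ)⁻¹ : Module.End ℂ Dom) k) with hψ
  have h := integral_inv_gamma_mul hτ ψ
  have hi : ∀ ψ : Dom, Integrable fun x : ℝ => (gamma τ x)⁻¹ * ψ.1 x := fun ψ =>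
    (rapid_inv_gamma_mul τ ψ).integrable (continuous_inv_gamma_mul hτ ψ).aestronglyMeasurable
  have hc := hi (mulDom _ (tempered_dom g) ((↑(U τ)⁻¹ : Module.End ℂ Dom) φ))
  have e1 : ∫ x : ℝ, (gamma τ x)⁻¹ * ((starRingEnd ℂ) ((fourierDom f).1 x) * (X4 τ φ).1 x) =
      (∫ x : ℝ, (gamma τ x)⁻¹ *
        (mulDom _ (tempered_dom g) ((↑(U τ)⁻¹ : Module.End ℂ Dom) φ)).1 x) + (q τ)⁻¹ *
        ∫ x : ℝ, (gamma τ x)⁻¹ * ((1 + q τ • (U τ : Module.End ℂ Dom)) ψ).1 x := by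
    rw [← integral_const_mul, ← integral_add hc ((hi _).const_mul _)]
    congr 1
    ext x
    rw [one_add_smul_U_apply_ofReal hτ, hψ, mulDom_apply, mulDom_apply, U_inv_apply_ofReal hτ,
      U_inv_apply_ofReal hτ, hg, conjDom_ofReal, hk, V_inv_apply, X4_apply hτ]
    ring
  have e2 : ∫ x : ℝ, (gamma τ x)⁻¹ * ((starRingEnd ℂ) ((fourierDom (X5 τ f)).1 x) * φ.1 x) =
      (∫ x : ℝ, (gamma τ x)⁻¹ *
        (mulDom _ (tempered_dom g) ((↑(U τ)⁻¹ : Module.End ℂ Dom) φ)).1 x) + (q τ)⁻¹ *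
        ∫ x : ℝ, (gamma τ x)⁻¹ * ((V τ : Module.End ℂ Dom) ψ).1 x := by
    rw [← integral_const_mul, ← integral_add hc ((hi _).const_mul _)]
    congr 1
    ext x
    have e3 : Complex.exp (2 * Real.pi * Real.sqrt τ * (x + Real.sqrt τ * Complex.I)) =
        q τ ^ 2 * (weight τ x : ℂ)⁻¹ := by
      rw [← neg_neg (2 * Real.pi * Real.sqrt τ * (x + Real.sqrt τ * Complex.I)),
        Complex.exp_neg, exp_weight_add hτ, mul_inv, inv_inv]
    rw [V_apply, hψ, mulDom_apply, mulDom_apply, U_inv_apply_ofReal hτ, U_inv_apply hτ, e3,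
      hg, conjDom_ofReal, conjDom_apply, hk, V_inv_apply, add_sub_cancel_right,
      fourierDom_X5_apply hτ, map_mul, map_add, map_mul, map_inv₀, map_inv₀, conj_q,
      Complex.conj_ofReal, inv_inv]
    simp only [map_add, map_mul, Complex.conj_ofReal, Complex.conj_I, mul_neg, ← sub_eq_add_neg]
    field_simp
  rw [e1, e2, h]

/-- Both operators are the closure of `X₅`. -/
theorem opT_five_of_le_one {τ : ℝ} (hτ : 0 < τ) (hτ1 : τ ≤ 1) : opT τ 5 = opT τ 0 := by
  rw [opT_zero hτ hτ1]
  exact opT_eq_closure hτ (onH_X5_le_opT_five hτ hτ1) (dense_one_add_X5 hτ hτ1)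

theorem opT_add (τ : ℝ) (i j : ℤ) : opT τ (i + j) = conjOp (S τ ^ j) (opT τ i) := by
  rw [opT, opT, conjOp_conjOp, ← zpow_add]
  congr 2
  ring

theorem opT_add_five_of_eq {τ : ℝ} {j : ℤ} (h : opT τ (j + 5) = opT τ j) (i : ℤ) :
    opT τ (i + 5) = opT τ i := by
  rw [show i + 5 = j + 5 + (i - j) by ring, opT_add, h, ← opT_add]
  congr 1
  ring

end EssentialSelfAdjointness

section Duality

open Filter Topology Set

/-! ### Modular duality and periodicity -/

theorem omega_inv (τ : ℝ) : omega τ⁻¹ = omega' τ := by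
  rw [omega, omega', Real.sqrt_inv]
  push_cast
  simp [div_eq_mul_inv, mul_assoc]

theorem gammaIntegrand_inv (τ x s : ℝ) : gammaIntegrand τ⁻¹ x s = gammaIntegrand τ x s := by
  have h : contour τ⁻¹ s = contour τ s := by
    rw [contour, contour, Real.sqrt_inv, min_comm]
    simp
  have h2 : omega' τ⁻¹ = omega τ := by rw [← omega_inv, inv_inv]
  rw [gammaIntegrand, gammaIntegrand, h, omega_inv, h2,
    mul_comm (Complex.sin (omega' τ * contour τ s))]

/-- The modular duality: `S` is invariant under `τ ↦ 1/τ`, which interchanges `ω` and `ω'`. -/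
theorem S_inv (τ : ℝ) : S τ⁻¹ = S τ := by
  have h : gamma τ⁻¹ = gamma τ := by
    ext x
    simp only [gamma, gammaIntegrand_inv]
  simp only [S, K, h]

theorem exists_ae_eq_mul {g : ℝ → ℝ} (hg : Continuous g) {C : ℝ} (hC : ∀ t, |g t| ≤ C) (x : H) :
    ∃ u : H, u =ᵐ[volume] fun t => (g t : ℂ) * x t := by
  have h : MemLp (fun t => (g t : ℂ) * x t) 2 := by
    refine (Lp.memLp x).of_le_mul (c := C)
      ((Complex.continuous_ofReal.comp hg).aestronglyMeasurable.mul (Lp.aestronglyMeasurable x))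
      (Eventually.of_forall fun t => ?_)
    rw [norm_mul, Complex.norm_real]
    gcongr
    exact hC t
  exact ⟨h.toLp _, h.coeFn_toLp⟩

/-- The operator `W` commutes with the multiplication by `g`. -/
def CommutesMul (W : H ≃ₗᵢ[ℂ] H) (g : ℝ → ℝ) : Prop :=
  ∀ x u : H, (u =ᵐ[volume] fun t => (g t : ℂ) * x t) →
    W u =ᵐ[volume] fun t => (g t : ℂ) * W x t

/-- The multiplications by polynomials in `r` are generated by the multiplication by `r`. -/
theorem CommutesMul.polynomial {W : H ≃ₗᵢ[ℂ] H} {r : ℝ → ℝ} (hr : Continuous r)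
    (hr01 : ∀ t, r t ∈ Icc (0 : ℝ) 1) (h : CommutesMul W r) (p : Polynomial ℝ) :
    CommutesMul W fun t => p.eval (r t) := by
  have hbdd : ∀ p : Polynomial ℝ, ∃ C : ℝ, ∀ t, |p.eval (r t)| ≤ C := by
    intro p
    obtain ⟨C, hC⟩ := isCompact_Icc.exists_bound_of_continuousOn
      (p.continuous.continuousOn (s := Icc (0 : ℝ) 1))
    exact ⟨C, fun t => hC _ (hr01 t)⟩
  induction p using Polynomial.induction_on' with
  | add p s hp hs =>
    intro x u hu
    obtain ⟨C, hC⟩ := hbdd p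
    obtain ⟨v, hv⟩ := exists_ae_eq_mul (p.continuous.comp hr) hC x
    obtain ⟨C', hC'⟩ := hbdd s
    obtain ⟨w, hw⟩ := exists_ae_eq_mul (s.continuous.comp hr) hC' x
    have : u = v + w := by
      apply Lp.ext
      filter_upwards [hu, hv, hw, Lp.coeFn_add v w] with t h1 h2 h3 h4
      rw [h1, h4, Pi.add_apply, h2, h3, Polynomial.eval_add]
      push_cast
      simp only [Function.comp_apply]
      ring
    rw [this, map_add]
    filter_upwards [hp x v hv, hs x w hw, Lp.coeFn_add (W v) (W w)] with t h1 h2 h3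
    rw [h3, Pi.add_apply, h1, h2, Polynomial.eval_add]
    push_cast
    ring
  | monomial n a =>
    induction n with
    | zero =>
      intro x u hu
      have : u = (a : ℂ) • x := by
        apply Lp.ext
        filter_upwards [hu, Lp.coeFn_smul (a : ℂ) x] with t h1 h2
        rw [h1, h2, Pi.smul_apply]
        simp
      rw [this, map_smul]
      filter_upwards [Lp.coeFn_smul (a : ℂ) (W x)] with t h1
      rw [h1, Pi.smul_apply]
      simp
    | succ n ih =>
      intro x u hu
      obtain ⟨C, hC⟩ := hbdd (Polynomial.monomial n a)
      obtain ⟨v, hv⟩ := exists_ae_eq_mul ((Polynomial.monomial n a).continuous.comp hr) hC x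
      have h1 := h v u (by
        filter_upwards [hu, hv] with t h1 h2
        rw [h1, h2]
        simp only [Function.comp_apply, Polynomial.eval_monomial]
        push_cast
        ring)
      filter_upwards [h1, ih x v hv] with t h2 h3
      rw [h2, h3]
      simp only [Polynomial.eval_monomial]
      push_cast
      ring

/-- The continuous functional calculus, by uniform approximation with polynomials. -/
theorem CommutesMul.comp {W : H ≃ₗᵢ[ℂ] H} {r : ℝ → ℝ} (hr : Continuous r)
    (hr01 : ∀ t, r t ∈ Icc (0 : ℝ) 1) (h : CommutesMul W r) {g : ℝ → ℝ}
    (hg : ContinuousOn g (Icc 0 1)) : CommutesMul W fun t => g (r t) := by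
  intro x u hu
  have hgr : Continuous fun t => g (r t) := hg.comp_continuous hr hr01
  obtain ⟨C, hC⟩ := isCompact_Icc.exists_bound_of_continuousOn hg
  obtain ⟨v, hv⟩ := exists_ae_eq_mul hgr (fun t => hC _ (hr01 t)) (W x)
  have key : ∀ ε : ℝ, 0 < ε → ‖W u - v‖ ≤ ε * (‖x‖ + ‖W x‖) := by
    intro ε hε
    obtain ⟨p, hp⟩ := exists_polynomial_near_of_continuousOn 0 1 g hg ε hε
    obtain ⟨C, hC⟩ := isCompact_Icc.exists_bound_of_continuousOn
      (p.continuous.continuousOn (s := Icc (0 : ℝ) 1))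
    obtain ⟨w, hw⟩ := exists_ae_eq_mul (p.continuous.comp hr) (fun t => hC _ (hr01 t)) x
    have hb : ∀ t, ‖(g (r t) : ℂ) - p.eval (r t)‖ ≤ ε := fun t => by
      rw [← Complex.ofReal_sub, Complex.norm_real, Real.norm_eq_abs, abs_sub_comm]
      exact (hp _ (hr01 t)).le
    have e1 : ‖u - w‖ ≤ ε * ‖x‖ := by
      refine Lp.norm_le_mul_norm_of_ae_le_mul ?_
      filter_upwards [hu, hw, Lp.coeFn_sub u w] with t h1 h2 h3
      rw [h3, Pi.sub_apply, h1, h2, Function.comp_apply, ← sub_mul, norm_mul]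
      gcongr
      exact hb t
    have e2 : ‖W w - v‖ ≤ ε * ‖W x‖ := by
      refine Lp.norm_le_mul_norm_of_ae_le_mul ?_
      filter_upwards [hv, h.polynomial hr hr01 p x w hw, Lp.coeFn_sub (W w) v] with t h1 h2 h3
      rw [h3, Pi.sub_apply, h1, h2, ← sub_mul, norm_mul, norm_sub_rev]
      gcongr
      exact hb t
    calc ‖W u - v‖ = ‖W (u - w) + (W w - v)‖ := by rw [map_sub]; congr 1; abel
      _ ≤ ‖W (u - w)‖ + ‖W w - v‖ := norm_add_le _ _
      _ ≤ ε * ‖x‖ + ε * ‖W x‖ := by rw [W.norm_map]; exact add_le_add e1 e2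
      _ = _ := by ring
  have h0 : W u = v := by
    rw [← sub_eq_zero, ← norm_le_zero_iff]
    by_contra! hne
    have hs : 0 ≤ ‖x‖ + ‖W x‖ := by positivity
    have h1 := key (‖W u - v‖ / (2 * (‖x‖ + ‖W x‖ + 1))) (by positivity)
    rw [div_mul_eq_mul_div, le_div_iff₀ (by positivity)] at h1
    nlinarith
  rw [h0]
  exact hv

/-- A unitary operator that leaves the closure of `U` invariant commutes with its resolvent: the
domain of the closure is the range of `(1 + weight)⁻¹`. -/
theorem commutesMul_of_conjOp_eq {τ : ℝ} (hτ : 0 < τ) {W : H ≃ₗᵢ[ℂ] H}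
    (h : conjOp W (onH (U τ)).closure = (onH (U τ)).closure) :
    CommutesMul W fun t => (1 + weight τ t)⁻¹ := by
  intro x u hu
  have hg : (u, x - u) ∈ (onH (U τ)).closure.graph := by
    rw [mem_graph_closure_onH_U hτ]
    filter_upwards [hu, Lp.coeFn_sub x u] with t h1 h2
    rw [h2, Pi.sub_apply, h1]
    have := one_add_weight_ne_zero τ t
    push_cast
    field_simp
    ring
  rw [← h, mem_graph_conjOp, mem_graph_closure_onH_U hτ, map_sub] at hg
  filter_upwards [hg, Lp.coeFn_sub (W x) (W u)] with t h1 h2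
  rw [h2, Pi.sub_apply] at h1
  have := one_add_weight_ne_zero τ t
  push_cast
  rw [eq_inv_mul_iff_mul_eq₀ this]
  linear_combination -h1

/-- The converse of `commutesMul_of_conjOp_eq`. One inclusion suffices, by maximality of
self-adjoint operators. -/
theorem conjOp_eq_of_commutesMul {τ : ℝ} (hτ : 0 < τ) {W : H ≃ₗᵢ[ℂ] H}
    (h : CommutesMul W fun t => (1 + weight τ t)⁻¹) :
    conjOp W (onH (U τ)).closure = (onH (U τ)).closure := by
  refine eq_closure_of_le (isSelfAdjoint_conjOp W (closure_onH_U hτ).2) (closure_onH_U hτ).2 ?_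
  rw [onH_le_iff]
  intro f
  have hf := (onH_le_iff _ _).1 (onH (U τ : Module.End ℂ Dom)).le_closure f
  set x := toH f
  set y := toH ((U τ : Module.End ℂ Dom) f)
  rw [mem_graph_closure_onH_U hτ] at hf
  rw [mem_graph_conjOp, mem_graph_closure_onH_U hτ]
  have h1 := h (x + y) x (by
    filter_upwards [hf, Lp.coeFn_add x y] with t h1 h2
    rw [h2, Pi.add_apply, h1]
    have := one_add_weight_ne_zero τ t
    push_cast
    field_simp)
  rw [map_add] at h1
  filter_upwards [h1, Lp.coeFn_add (W x) (W y)] with t h2 h3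
  rw [h3, Pi.add_apply] at h2
  push_cast at h2
  rw [eq_inv_mul_iff_mul_eq₀ (one_add_weight_ne_zero τ t)] at h2
  linear_combination -h2

/-- The multipliers of `U` for `τ` and `1/τ` are powers of each other, so their resolvents are
continuous functions of each other. -/
theorem inv_one_add_weight_eq {τ : ℝ} (hτ : 0 < τ) (t : ℝ) :
    (1 + weight τ t)⁻¹ = (1 + weight τ⁻¹ t)⁻¹ ^ τ /
      ((1 + weight τ⁻¹ t)⁻¹ ^ τ + (1 - (1 + weight τ⁻¹ t)⁻¹) ^ τ) := by
  set w := weight τ⁻¹ t with hw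
  have hw0 : 0 < w := weight_pos _ _
  have e1 : weight τ t = w ^ τ := by
    have hb : 0 < Real.sqrt τ := Real.sqrt_pos.2 hτ
    rw [hw, weight, weight, ← Real.exp_mul, Real.sqrt_inv]
    congr 1
    have := Real.sq_sqrt hτ.le
    field_simp
    rw [this]
    ring
  have e2 : 1 - (1 + w)⁻¹ = w * (1 + w)⁻¹ := by field_simp; ring
  have h3 : 0 < (1 + w)⁻¹ ^ τ := by positivity
  have h4 : 0 < w ^ τ := by positivity
  rw [e1, e2, Real.mul_rpow hw0.le (by positivity)]
  field_simp

theorem continuousOn_rpow_ratio {τ : ℝ} (hτ : 0 < τ) :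
    ContinuousOn (fun s : ℝ => s ^ τ / (s ^ τ + (1 - s) ^ τ)) (Icc 0 1) := by
  have h1 : Continuous fun s : ℝ => s ^ τ := Real.continuous_rpow_const hτ.le
  have h2 : Continuous fun s : ℝ => (1 - s) ^ τ :=
    h1.comp (by fun_prop : Continuous fun s : ℝ => 1 - s)
  refine h1.continuousOn.div (h1.add h2).continuousOn fun s hs => ne_of_gt ?_
  rcases hs.1.eq_or_lt with h | h
  · have : (0 : ℝ) < (1 - s) ^ τ := Real.rpow_pos_of_pos (by linarith) τ
    linarith [Real.rpow_nonneg hs.1 τ]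
  · have := Real.rpow_pos_of_pos h τ
    linarith [Real.rpow_nonneg (by linarith [hs.2] : (0 : ℝ) ≤ 1 - s) τ]

/-- The periodicity for all `τ`; for `τ > 1` it is transported from `1/τ`, with the unitary
operator `S ^ 5` in the role of `W`. -/
theorem opT_add_five {τ : ℝ} (hτ : 0 < τ) (i : ℤ) : opT τ (i + 5) = opT τ i := by
  rcases le_total τ 1 with hτ1 | hτ1
  · exact opT_add_five_of_eq (j := 0) (opT_five_of_le_one hτ hτ1) i
  · refine opT_add_five_of_eq (j := 1) ?_ i
    have hσ : 0 < τ⁻¹ := inv_pos.2 hτ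
    have h := opT_add_five_of_eq (j := 0)
      (opT_five_of_le_one hσ (inv_le_one_of_one_le₀ hτ1)) 1
    rw [opT_add, opT_one, S_inv] at h
    rw [opT_add, opT_one]
    have hc := commutesMul_of_conjOp_eq hσ h
    have hcont : Continuous fun t => (1 + weight τ⁻¹ t)⁻¹ :=
      Continuous.inv₀ (continuous_const.add (continuous_weight _)) fun t =>
        ne_of_gt (add_pos one_pos (weight_pos τ⁻¹ t))
    have h01 : ∀ t, (1 + weight τ⁻¹ t)⁻¹ ∈ Icc (0 : ℝ) 1 := fun t =>
      ⟨by have := weight_pos τ⁻¹ t; positivity,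
        inv_le_one_of_one_le₀ (by linarith [weight_pos τ⁻¹ t])⟩
    have h2 := hc.comp hcont h01 (continuousOn_rpow_ratio hτ)
    refine conjOp_eq_of_commutesMul hτ ?_
    simpa only [inv_one_add_weight_eq hτ] using h2

end Duality

section Algebra

/-! ### The relations between the operators `Xᵢ` -/

theorem X_mul_X {τ : ℝ} (hτ : 0 < τ) (i : ZMod 5) :
    X τ i * X τ (i + 2) = 1 + q τ • X τ (i + 1) := by
  have hq := q_ne_zero τ
  have hw : ∀ x, (weight τ x : ℂ) ≠ 0 := fun x => by exact_mod_cast (weight_pos τ x).ne'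
  fin_cases i
  · change X5 τ * (V τ : Module.End ℂ Dom) = 1 + q τ • (U τ : Module.End ℂ Dom)
    rw [X5, mul_assoc, Units.inv_mul, mul_one]
  · change (U τ : Module.End ℂ Dom) * X3 τ = 1 + q τ • (V τ : Module.End ℂ Dom)
    rw [X3, Units.mul_inv_cancel_left]
  · change (V τ : Module.End ℂ Dom) * X4 τ = 1 + q τ • X3 τ
    refine LinearMap.ext fun f => ext_ofReal fun x => ?_
    change ((V τ : Module.End ℂ Dom) (X4 τ f)).1 x = f.1 x + q τ * (X3 τ f).1 x
    rw [V_apply, X3_apply hτ, X4, Module.End.mul_apply, Module.End.mul_apply, U_inv_apply hτ]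
    set g := (↑(V τ)⁻¹ : Module.End ℂ Dom) f with hg
    change _ * ((q τ)⁻¹ * g.1 _ + ((U τ : Module.End ℂ Dom) g).1 _ +
      ((V τ : Module.End ℂ Dom) g).1 _) = _
    rw [U_apply hτ, V_apply, hg, V_inv_apply, V_inv_apply, add_sub_cancel_right,
      add_sub_cancel_right, ← neg_neg (2 * Real.pi * Real.sqrt τ * (x + Real.sqrt τ * Complex.I)),
      Complex.exp_neg, neg_neg, exp_weight_add hτ]
    have := hw x
    field_simp
    ring
  · change X3 τ * X5 τ = 1 + q τ • X4 τ
    refine LinearMap.ext fun f => ext_ofReal fun x => ?_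
    change (X3 τ (X5 τ f)).1 x = f.1 x + q τ * (X4 τ f).1 x
    rw [X3_apply hτ, X4_apply hτ, X5_apply hτ, X5, Module.End.mul_apply, one_add_smul_U_apply hτ,
      V_inv_apply, add_sub_cancel_right, exp_weight_add hτ]
    have := hw x
    field_simp
    ring
  · change X4 τ * (U τ : Module.End ℂ Dom) = 1 + q τ • X5 τ
    refine LinearMap.ext fun f => ext_ofReal fun x => ?_
    change (X4 τ ((U τ : Module.End ℂ Dom) f)).1 x = f.1 x + q τ * (X5 τ f).1 x
    rw [X4_apply hτ, X5_apply hτ, U_apply_ofReal hτ, U_apply hτ, exp_weight_sub hτ]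
    have := hw x
    field_simp

end Algebra

/-- A property of the pairs `(Tᵢ, Xᵢ)` has to be verified only for five consecutive indices. -/
theorem forall_opT_of_five {τ : ℝ} (hτ : 0 < τ)
    {Q : (H →ₗ.[ℂ] H) → Module.End ℂ Dom → Prop} (h0 : Q (opT τ 0) (X5 τ)) (h1 : Q (opT τ 1) (U τ))
    (h2 : Q (opT τ 2) (V τ)) (h3 : Q (opT τ 3) (X3 τ)) (h4 : Q (opT τ 4) (X4 τ)) (i : ℤ) :
    Q (opT τ i) (X τ i) := by
  have hp : Function.Periodic (fun i : ℤ => (opT τ i, X τ i)) 5 := by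
    intro i
    refine Prod.ext (opT_add_five hτ i) ?_
    change X τ ((i + 5 : ℤ) : ZMod 5) = X τ i
    congr 1
    push_cast
    rw [show (5 : ZMod 5) = 0 by rfl, add_zero]
  have he := hp.zsmul (i / 5) (i % 5)
  rw [zsmul_eq_mul, Int.cast_id, Int.emod_add_ediv_mul] at he
  obtain ⟨e1, e2⟩ := Prod.mk.inj he
  rw [e1, e2]
  have hl := Int.emod_nonneg i (by norm_num : (5 : ℤ) ≠ 0)
  have hu := Int.emod_lt_of_pos i (by norm_num : (0 : ℤ) < 5)
  generalize i % 5 = j at hl hu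
  interval_cases j
  · exact h0
  · exact h1
  · exact h2
  · exact h3
  · exact h4

end QuantumYSystem

theorem mainTheorem3 (τ : ℝ) (hτ : 0 < τ) :
    (∀ i : ZMod 5, X τ i * X τ (i + 2) = 1 + q τ • X τ (i + 1)) ∧
    ∃ T : ℤ → (H →ₗ.[ℂ] H),
      (∀ i : ℤ, IsSelfAdjoint (T i)) ∧
      T 1 = (onH (U τ)).closure ∧
      T 2 = (onH (V τ)).closure ∧
      (∀ i : ℤ, onH (X τ i) ≤ T i) ∧
      (τ ≤ 1 → ∀ i : ℤ, T i = (onH (X τ i)).closure) ∧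
      (∀ i : ℤ, T (i + 1) = conjOp (S τ) (T i)) ∧
      (∀ i : ℤ, T (i + 5) = T i) := by
  refine ⟨X_mul_X hτ, opT τ, isSelfAdjoint_opT hτ, opT_one τ, opT_two hτ, ?_, ?_, opT_add_one τ,
    opT_add_five hτ⟩
  · exact forall_opT_of_five hτ (Q := fun T A => onH A ≤ T) (onH_X5_le hτ) (onH_U_le τ)
      (onH_V_le hτ) (onH_X3_le hτ) (onH_X4_le hτ)
  · exact fun hτ1 => forall_opT_of_five hτ (Q := fun T A => T = (onH A).closure)
      (opT_zero hτ hτ1) (opT_one τ) (opT_two hτ) (opT_three hτ hτ1) (opT_four hτ hτ1)
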